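/- For $\alpha>-\tfrac12$, $f\in L^2(\mathbb R)$ and $t\in\mathbb R$, let $e^{-t\partial_x^3}D^\alpha f$ be the tempered distribution on $\mathbb R$ with Fourier transform $e^{itk^3}|k|^\alpha\widehat f(k)$. For $h_0>0$ and $x_0\in\mathbb R$ let $[g_{0,x_0,h_0}f](x)=h_0^{-1/2}f\big(\tfrac{x-x_0}{h_0}\big)$. Let $q,r\in[1,\infty]$ and $\alpha\in\mathbb R$ satisfy $$-\alpha+\frac3q+\frac1r=\frac12,\qquad -\frac12<\alpha<\frac12,\qquad \alpha\le\frac1q,\qquad (q,r)\ne(\infty,2)$$ (with $1/\infty=0$). Let $\phi^j,\phi^k\in L^2(\mathbb R)$ be complex-valued, and let $(h_n^j,x_n^j,t_n^j)_{n}$ and $(h_n^k,x_n^k,t_n^k)_{n}$ be two sequences in $(0,\infty)\times\mathbb R^2$ which are orthogonal, i.e. the quantities $$Q_n:=\frac{h_n^j}{h_n^k}+\frac{h_n^k}{h_n^j}+\frac{|t_n^j-t_n^k|}{(h_n^j)^3}+\frac{|x_n^j-x_n^k|}{h_n^j}$$ satisfy $\limsup_{n\to\infty}Q_n=\infty$.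 Put $g_n^j:=g_{0,x_n^j,h_n^j}$ and $g_n^k:=g_{0,x_n^k,h_n^k}$. Then, for every $n$, the evolutions $e^{-(t-t_n^j)\partial_x^3}D^\alpha g_n^j(\phi^j)$ and $e^{-(t-t_n^k)\partial_x^3}D^\alpha g_n^k(\phi^k)$ are given, for almost every $t$, by measurable functions of $(t,x)$; any such functions may be used below. There is a subsequence $(n_m)$ with $Q_{n_m}\to\infty$, and for every subsequence $(n_m)$ with $Q_{n_m}\to\infty$, $$\lim_{m\to\infty}\Big\|e^{-(t-t_{n_m}^j)\partial_x^3}D^\alpha g_{n_m}^j(\phi^j)\;e^{-(t-t_{n_m}^k)\partial_x^3}D^\alpha g_{n_m}^k(\phi^k)\Big\|_{L^{q/2}_tL^{r/2}_x}=0 .$$ In particular, if $Q_n\to\infty$, then the norm tends to $0$ along the whole sequence. -/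

import Mathlib

open MeasureTheory Filter Topology FourierTransform
open scoped ENNReal SchwartzMap

namespace AiryStrichartz

/-- The complex Hilbert space `L²(ℝ)`. -/
abbrev L2 : Type := Lp ℂ 2 (volume : Measure ℝ)

/-- The function `x ↦ h₀^{-1/2} e^{iθ} f((x - x₀) / h₀)`. -/
noncomputable def gFun (θ x₀ h₀ : ℝ) (f : ℝ → ℂ) (x : ℝ) : ℂ :=
  ((h₀ ^ (-(1 / 2) : ℝ) : ℝ) : ℂ) * Complex.exp (Complex.I * (θ : ℂ)) * f ((x - x₀) / h₀)

theorem memLp_gFun (θ x₀ : ℝ) {h₀ : ℝ} (hh : 0 < h₀) {f : ℝ → ℂ} (hf : MemLp f 2 volume) :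
    MemLp (gFun θ x₀ h₀ f) 2 volume := by
  have h1 : MemLp (fun x : ℝ => f (h₀⁻¹ * x)) 2 volume := by
    have hm : Measure.map (fun x : ℝ => h₀⁻¹ * x) volume
        = ENNReal.ofReal |h₀⁻¹⁻¹| • (volume : Measure ℝ) :=
      Real.map_volume_mul_left (inv_ne_zero hh.ne')
    have h2 : MemLp f 2 (Measure.map (fun x : ℝ => h₀⁻¹ * x) volume) := by
      rw [hm]; exact hf.smul_measure ENNReal.ofReal_ne_top
    exact h2.comp_of_map (measurable_const_mul _).aemeasurable
  have h3 : MemLp (fun x : ℝ => f (h₀⁻¹ * (x - x₀))) 2 volume :=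
    h1.comp_measurePreserving (measurePreserving_sub_right volume x₀)
  have h4 := h3.const_mul (((h₀ ^ (-(1 / 2) : ℝ) : ℝ) : ℂ) * Complex.exp (Complex.I * (θ : ℂ)))
  have h5 : gFun θ x₀ h₀ f = fun x : ℝ => ((h₀ ^ (-(1 / 2) : ℝ) : ℝ) : ℂ) *
      Complex.exp (Complex.I * (θ : ℂ)) * f (h₀⁻¹ * (x - x₀)) := by
    funext x
    simp only [gFun, div_eq_inv_mul (x - x₀) h₀]
  rw [h5]
  exact h4

/-- The unitary transform `g_{θ,x₀,h₀}` of `L²(ℝ)`, for `h₀ > 0`. -/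
noncomputable def g (θ x₀ h₀ : ℝ) (hh : 0 < h₀) (f : L2) : L2 :=
  (memLp_gFun θ x₀ hh (Lp.memLp f)).toLp _

/-- The function `v` is (the function representing) the tempered distribution
`e^{-t ∂ₓ³} D^α f`, that is, the Fourier transform of `v` in the sense of tempered distributions is
`e^{i t k³} |k|^α f̂`. Mathlib's Fourier transform has the kernel `e^{-2πixξ}`, so that the
angular frequency is `k = 2πξ`. -/
def IsFracAirySlice (α : ℝ) (f : L2) (t : ℝ) (v : ℝ → ℂ) : Prop :=
  ∀ ψ : 𝓢(ℝ, ℂ),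
    Integrable (fun x : ℝ => v x * (𝓕 ψ) x) volume ∧
    ∫ x : ℝ, v x * (𝓕 ψ) x =
      ∫ ξ : ℝ, Complex.exp (Complex.I * (t : ℂ) * ((2 * Real.pi * ξ : ℝ) : ℂ) ^ 3) *
        ((|2 * Real.pi * ξ| ^ α : ℝ) : ℂ) * (𝓕 f : L2) ξ * ψ ξ

/-- The space-time function `u = u(t, x)` is the evolution `e^{-(t - t₀) ∂ₓ³} D^α f`. Such a `u` is
unique up to a null set. -/
def IsFracAiryEvolution (α : ℝ) (f : L2) (t₀ : ℝ) (u : ℝ → ℝ → ℂ) : Prop :=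
  AEStronglyMeasurable (Function.uncurry u) ((volume : Measure ℝ).prod (volume : Measure ℝ)) ∧
    ∀ᵐ t : ℝ, IsFracAirySlice α f (t - t₀) (u t)

/-- The mixed norm `‖u‖_{L^p_t L^s_x}` of `u = u(t, x)`, with values in `[0, ∞]`. -/
noncomputable def mixedNorm (p s : ℝ≥0∞) (u : ℝ → ℝ → ℂ) : ℝ≥0∞ :=
  eLpNorm (fun t : ℝ => eLpNorm (u t) s volume) p volume

/-- The quantity whose divergence expresses the orthogonality of two triples
`(h, x, t)` and `(h', x', t')`. -/
noncomputable def orthoQuantity (h x t h' x' t' : ℝ) : ℝ :=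
  h / h' + h' / h + |t - t'| / h ^ 3 + |x - x'| / h

/-- The sequences `(hₙ, xₙ, tₙ)` and `(hₙ', xₙ', tₙ')` are orthogonal: the limit superior of
the quantity above is `∞`. -/
def OrthogonalParameters (h x t h' x' t' : ℕ → ℝ) : Prop :=
  limsup (fun n => ((orthoQuantity (h n) (x n) (t n) (h' n) (x' n) (t' n) : ℝ) : EReal)) atTop = ⊤

end AiryStrichartz

/-!
The product of the two evolutions is controlled by Hölder's inequality and by a Strichartz estimate
`‖e^{-t∂ₓ³} D^α φ‖_{L^q_t L^r_x} ≤ K ‖φ‖₂` for the admissible exponents. The scaling relation makes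
the norm invariant under the rescaling `h^{-1/2-α} U((t - t₀)/h³, (x - x₀)/h)`, which is the
evolution of the rescaled datum (`IsFracAiryEvolution.rescale`). Both profiles may therefore be
replaced by bounded functions supported in boxes (`Approximable`), at the cost of a small error that
is uniform in the parameters. For such profiles the claim is elementary: if the ratio of the scales
degenerates, the product is smaller than a power `1/2 + α > 0` of that ratio
(`Admissible.mixN_rescale_mul_le`); if the scales are comparable, then the space-time centres
separate and the supports are disjoint (`Admissible.eventually_mixN_rescale_mul_le`).

The Strichartz estimate is proved for data with frequencies in a finite union of dyadic annuli
(`Admissible.exists_mixN_ev_band_le`). The endpoint `L⁴_t L^∞_x` with `α = 1/4` follows by the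
`TT*` method from van der Corput's bound `|t|^{-1/2}` for the kernel and from the
Hardy–Littlewood–Sobolev inequality on the line (`mixN_ev_quarterWeight_le`). For data in one dyadic
annulus the other corners, `L^∞_{t,x}` and `L^∞_t L²_x`, are the trivial bounds. All exponents in
question lie in the triangle spanned by these three corners. Away from the endpoint, products of
waves from two annuli are interpolated between the corners with weights that differ for the two
factors (`CornerBounds.mixN_mul_le`), which gives a gain that is geometric in the distance of the
annuli, so that the squares of the norms over the annuli can be summed.

For a general square integrable datum the frequency line, with the origin removed, is cut into
pieces lying in annuli `2^{-m} ≤ |k| < 2^m` such that the `L²` norms of the pieces are summable; the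
evolution is the sum of the series of the corresponding waves (`Admissible.exists_evolution`). Since
`α > -1/2`, the weight `|k|^α` times a Schwartz function is square integrable, and hence the sum has
the required Fourier transform. Waves with frequencies in an annulus vanish at infinity in
space-time, so they are approximable, and so is the sum of the series.
-/

namespace AiryStrichartz

/-! ### Lebesgue norms of `ℝ≥0∞`-valued functions -/

section Lebesgue

variable {X : Type*} [MeasurableSpace X] {μ : Measure X} {p : ℝ≥0∞}

theorem eLpNorm_ennreal_of_ne_top (hp0 : p ≠ 0) (hp : p ≠ ⊤) (f : X → ℝ≥0∞) :
    eLpNorm f p μ = (∫⁻ x, f x ^ p.toReal ∂μ) ^ (1 / p.toReal) := by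
  simp [eLpNorm_eq_lintegral_rpow_enorm_toReal hp0 hp]

theorem eLpNorm_ennreal_top (f : X → ℝ≥0∞) : eLpNorm f ⊤ μ = essSup f μ := by
  simp [eLpNorm_exponent_top, eLpNormEssSup]

theorem eLpNorm_ennreal_mono {f g : X → ℝ≥0∞} (h : ∀ᵐ x ∂μ, f x ≤ g x) :
    eLpNorm f p μ ≤ eLpNorm g p μ :=
  eLpNorm_mono_enorm_ae (by simpa using h)

theorem eLpNorm_ennreal_mul_le {f g : X → ℝ≥0∞} (hf : AEMeasurable f μ) (hg : AEMeasurable g μ) :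
    eLpNorm (fun x => f x * g x) (p / 2) μ ≤ eLpNorm f p μ * eLpNorm g p μ := by
  rcases eq_or_ne p 0 with rfl | hp0
  · simp
  rcases eq_or_ne p ⊤ with rfl | hp
  · rw [ENNReal.top_div_of_ne_top (by simp), eLpNorm_ennreal_top, eLpNorm_ennreal_top,
      eLpNorm_ennreal_top]
    exact ENNReal.essSup_mul_le _ _
  have hP : 0 < p.toReal := ENNReal.toReal_pos hp0 hp
  have h20 : p / 2 ≠ 0 := by simp [hp0]
  have h2t : p / 2 ≠ ⊤ := ENNReal.div_ne_top hp (by simp)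
  have h2 : (p / 2).toReal = p.toReal / 2 := by simp [ENNReal.toReal_div]
  rw [eLpNorm_ennreal_of_ne_top h20 h2t, eLpNorm_ennreal_of_ne_top hp0 hp,
    eLpNorm_ennreal_of_ne_top hp0 hp, h2]
  have key := ENNReal.lintegral_mul_norm_pow_le (μ := μ) (hf.pow_const p.toReal)
    (hg.pow_const p.toReal) (p := 1 / 2) (q := 1 / 2) (by norm_num) (by norm_num) (by norm_num)
  have e1 : ∀ a : ℝ≥0∞, (a ^ p.toReal) ^ (1 / 2 : ℝ) = a ^ (p.toReal / 2) := fun a => by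
    rw [← ENNReal.rpow_mul]; congr 1; ring
  simp only [e1] at key
  calc (∫⁻ x, (f x * g x) ^ (p.toReal / 2) ∂μ) ^ (1 / (p.toReal / 2))
      = (∫⁻ x, f x ^ (p.toReal / 2) * g x ^ (p.toReal / 2) ∂μ) ^ (1 / (p.toReal / 2)) := by
        congr 1
        refine lintegral_congr fun x => ?_
        rw [ENNReal.mul_rpow_of_nonneg _ _ (by positivity)]
    _ ≤ ((∫⁻ x, f x ^ p.toReal ∂μ) ^ (1 / 2 : ℝ) * (∫⁻ x, g x ^ p.toReal ∂μ) ^ (1 / 2 : ℝ)) ^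
          (1 / (p.toReal / 2)) := by gcongr
    _ = _ := by
        rw [ENNReal.mul_rpow_of_nonneg _ _ (by positivity), ← ENNReal.rpow_mul,
          ← ENNReal.rpow_mul]
        congr 2 <;> field_simp

theorem eLpNorm_ennreal_add_le {f g : X → ℝ≥0∞} (hf : AEMeasurable f μ) (hg : AEMeasurable g μ)
    (hp : 1 ≤ p) : eLpNorm (fun x => f x + g x) p μ ≤ eLpNorm f p μ + eLpNorm g p μ :=
  eLpNorm_add_le hf.aestronglyMeasurable hg.aestronglyMeasurable hp

theorem eLpNorm_ennreal_sum_le {ι : Type*} (s : Finset ι) {f : ι → X → ℝ≥0∞}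
    (hf : ∀ i, AEMeasurable (f i) μ) (hp : 1 ≤ p) :
    eLpNorm (fun x => ∑ i ∈ s, f i x) p μ ≤ ∑ i ∈ s, eLpNorm (f i) p μ := by
  have h : (fun x => ∑ i ∈ s, f i x) = ∑ i ∈ s, f i := by ext x; simp
  rw [h]
  exact eLpNorm_sum_le (fun i _ => (hf i).aestronglyMeasurable) hp

theorem eLpNorm_ennreal_tsum_le {f : ℕ → X → ℝ≥0∞} (hf : ∀ n, AEMeasurable (f n) μ)
    (hp : 1 ≤ p) :
    eLpNorm (fun x => ∑' n, f n x) p μ ≤ ∑' n, eLpNorm (f n) p μ := by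
  have hp0 : p ≠ 0 := (zero_lt_one.trans_le hp).ne'
  rcases eq_or_ne p ⊤ with rfl | hpt
  · simp only [eLpNorm_ennreal_top]
    refine essSup_le_of_ae_le _ ?_
    have h : ∀ᵐ x ∂μ, ∀ n, f n x ≤ essSup (f n) μ :=
      ae_all_iff.2 fun n => ENNReal.ae_le_essSup (f n)
    filter_upwards [h] with x hx
    exact ENNReal.tsum_le_tsum hx
  · have hP : 0 < p.toReal := ENNReal.toReal_pos hp0 hpt
    have hlim : Tendsto (fun N => eLpNorm (fun x => ∑ n ∈ Finset.range N, f n x) p μ) atTop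
        (𝓝 (eLpNorm (fun x => ∑' n, f n x) p μ)) := by
      simp only [eLpNorm_ennreal_of_ne_top hp0 hpt]
      refine (ENNReal.continuous_rpow_const.tendsto _).comp ?_
      refine lintegral_tendsto_of_tendsto_of_monotone ?_ ?_ ?_
      · intro N
        exact (Finset.aemeasurable_fun_sum _ fun n _ => hf n).pow_const _
      · refine Eventually.of_forall fun x M N hMN => ?_
        dsimp only
        gcongr
      · refine Eventually.of_forall fun x => ?_
        exact (ENNReal.continuous_rpow_const.tendsto _).comp (ENNReal.tendsto_nat_tsum _)
    refine le_of_tendsto' hlim fun N => ?_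
    exact (eLpNorm_ennreal_sum_le _ hf hp).trans (ENNReal.sum_le_tsum _)

end Lebesgue

/-! ### Mixed norms -/

/-- The mixed norm `‖f‖_{L^q_t L^r_x}` of a function with values in `[0, ∞]`. -/
noncomputable def mixN (q r : ℝ≥0∞) (f : ℝ → ℝ → ℝ≥0∞) : ℝ≥0∞ :=
  eLpNorm (fun t : ℝ => eLpNorm (f t) r volume) q volume

theorem mixedNorm_eq_mixN (q r : ℝ≥0∞) (u : ℝ → ℝ → ℂ) :
    mixedNorm q r u = mixN q r (fun t x => ‖u t x‖ₑ) := by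
  simp only [mixedNorm, mixN, eLpNorm_enorm]

/-- Measurability, up to null sets, of a function of `(t, x)`. -/
abbrev AEM (f : ℝ → ℝ → ℝ≥0∞) : Prop :=
  AEMeasurable (Function.uncurry f) ((volume : Measure ℝ).prod (volume : Measure ℝ))

theorem AEM.slice {f : ℝ → ℝ → ℝ≥0∞} (hf : AEM f) : ∀ᵐ t : ℝ, AEMeasurable (f t) volume := by
  have h := Measure.ae_ae_of_ae_prod hf.ae_eq_mk
  filter_upwards [h] with t ht
  exact ⟨fun x => hf.mk _ (t, x), hf.measurable_mk.comp measurable_prodMk_left, ht⟩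

/-- The slice norms `t ↦ ‖f(t, ·)‖_{L^p}` of a measurable function are measurable, including the
case `p = ∞`. -/
theorem AEM.eLpNorm_slice {f : ℝ → ℝ → ℝ≥0∞} (hf : AEM f) (p : ℝ≥0∞) :
    AEMeasurable (fun t => eLpNorm (f t) p volume) volume := by
  refine ⟨fun t => eLpNorm (fun x => hf.mk _ (t, x)) p volume, ?_, ?_⟩
  · have hm := hf.measurable_mk
    set g := hf.mk _
    rcases eq_or_ne p 0 with rfl | hp0
    · simp
    rcases eq_or_ne p ⊤ with rfl | hp
    · simp only [eLpNorm_ennreal_top]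
      refine measurable_of_Ioi fun c => ?_
      have hs : MeasurableSet {z : ℝ × ℝ | c < g z} := measurableSet_lt measurable_const hm
      have h1 := measurable_measure_prodMk_left (ν := (volume : Measure ℝ)) hs
      have h2 : (fun t => essSup (fun x => g (t, x)) volume) ⁻¹' Set.Ioi c =
          {t | 0 < (volume : Measure ℝ) (Prod.mk t ⁻¹' {z : ℝ × ℝ | c < g z})} := by
        ext t
        simp only [Set.mem_preimage, Set.mem_Ioi, Set.mem_ofPred_eq]
        rw [← not_le, ← not_le, not_iff_not]
        constructor
        · intro h
          have h3 : ∀ᵐ x : ℝ, g (t, x) ≤ c := (ENNReal.ae_le_essSup _).mono fun x hx => hx.trans h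
          rw [ae_iff] at h3
          simp only [not_le] at h3
          exact h3.le
        · intro h
          refine essSup_le_of_ae_le _ ?_
          change ∀ᵐ x : ℝ, g (t, x) ≤ c
          rw [ae_iff]
          simpa only [not_le] using! le_antisymm h (zero_le)
      rw [h2]
      exact measurableSet_lt measurable_const h1
    · simp only [eLpNorm_ennreal_of_ne_top hp0 hp]
      refine Measurable.pow_const ?_ _
      exact Measurable.lintegral_prod_right (hm.pow_const p.toReal)
  · filter_upwards [Measure.ae_ae_of_ae_prod hf.ae_eq_mk] with t ht
    exact eLpNorm_congr_ae ht

theorem mixN_mono_ae {q r : ℝ≥0∞} {f g : ℝ → ℝ → ℝ≥0∞}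
    (h : ∀ᵐ t : ℝ, ∀ᵐ x : ℝ, f t x ≤ g t x) : mixN q r f ≤ mixN q r g :=
  eLpNorm_ennreal_mono (h.mono fun _ ht => eLpNorm_ennreal_mono ht)

theorem mixN_mono {q r : ℝ≥0∞} {f g : ℝ → ℝ → ℝ≥0∞}
    (h : ∀ t x, f t x ≤ g t x) : mixN q r f ≤ mixN q r g :=
  mixN_mono_ae (Eventually.of_forall fun t => Eventually.of_forall (h t))

theorem mixN_add_le {q r : ℝ≥0∞} (hq : 1 ≤ q) (hr : 1 ≤ r) {f g : ℝ → ℝ → ℝ≥0∞}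
    (hf : AEM f) (hg : AEM g) :
    mixN q r (fun t x => f t x + g t x) ≤ mixN q r f + mixN q r g := by
  refine le_trans (eLpNorm_ennreal_mono ?_)
    (eLpNorm_ennreal_add_le (hf.eLpNorm_slice r) (hg.eLpNorm_slice r) hq)
  filter_upwards [hf.slice, hg.slice] with t h1 h2
  exact eLpNorm_ennreal_add_le h1 h2 hr

theorem mixN_sum_le {q r : ℝ≥0∞} (hq : 1 ≤ q) (hr : 1 ≤ r) {ι : Type*} (s : Finset ι)
    {f : ι → ℝ → ℝ → ℝ≥0∞} (hf : ∀ i, AEM (f i)) :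
    mixN q r (fun t x => ∑ i ∈ s, f i t x) ≤ ∑ i ∈ s, mixN q r (f i) := by
  refine le_trans (eLpNorm_ennreal_mono ?_)
    (eLpNorm_ennreal_sum_le s (fun i => (hf i).eLpNorm_slice r) hq)
  have h : ∀ i ∈ s, ∀ᵐ t : ℝ, AEMeasurable (f i t) volume := fun i _ => (hf i).slice
  filter_upwards [(ae_ball_iff s.countable_toSet).2 h] with t ht
  have h3 : (fun x => ∑ i ∈ s, f i t x) = ∑ i ∈ s, f i t := by ext x; simp
  rw [h3]
  exact eLpNorm_sum_le (fun i hi => (ht i hi).aestronglyMeasurable) hr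

theorem mixN_tsum_le {q r : ℝ≥0∞} (hq : 1 ≤ q) (hr : 1 ≤ r)
    {f : ℕ → ℝ → ℝ → ℝ≥0∞} (hf : ∀ i, AEM (f i)) :
    mixN q r (fun t x => ∑' i, f i t x) ≤ ∑' i, mixN q r (f i) := by
  refine le_trans (eLpNorm_ennreal_mono ?_)
    (eLpNorm_ennreal_tsum_le (fun i => (hf i).eLpNorm_slice r) hq)
  filter_upwards [ae_all_iff.2 fun i => (hf i).slice] with t ht
  exact eLpNorm_ennreal_tsum_le ht hr

theorem mixN_mul_le {q r : ℝ≥0∞} {f g : ℝ → ℝ → ℝ≥0∞} (hf : AEM f) (hg : AEM g) :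
    mixN (q / 2) (r / 2) (fun t x => f t x * g t x) ≤ mixN q r f * mixN q r g := by
  refine le_trans (eLpNorm_ennreal_mono ?_)
    (eLpNorm_ennreal_mul_le (hf.eLpNorm_slice r) (hg.eLpNorm_slice r))
  filter_upwards [hf.slice, hg.slice] with t h1 h2
  exact eLpNorm_ennreal_mul_le h1 h2

theorem eLpNorm_ennreal_sq {X : Type*} [MeasurableSpace X] {μ : Measure X} {p : ℝ≥0∞}
    (f : X → ℝ≥0∞) :
    eLpNorm (fun x => f x ^ 2) (p / 2) μ = eLpNorm f p μ ^ 2 := by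
  have h := eLpNorm_enorm_rpow f (p := p / 2) (μ := μ) (q := 2) (by norm_num)
  simpa [ENNReal.div_mul_cancel] using h

theorem mixN_sq (q r : ℝ≥0∞) (f : ℝ → ℝ → ℝ≥0∞) :
    mixN (q / 2) (r / 2) (fun t x => f t x ^ 2) = mixN q r f ^ 2 := by
  simp only [mixN, eLpNorm_ennreal_sq]

theorem eLpNorm_comp_affine (f : ℝ → ℝ≥0∞) (p : ℝ≥0∞) (a : ℝ) {h : ℝ} (hh : 0 < h) :
    eLpNorm (fun x => f ((x - a) / h)) p volume =
      ENNReal.ofReal h ^ (1 / p).toReal * eLpNorm f p volume := by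
  have hm : Measure.map (fun x : ℝ => h⁻¹ * x) volume
      = ENNReal.ofReal h • (volume : Measure ℝ) := by
    rw [Real.map_volume_mul_left (inv_ne_zero hh.ne'), inv_inv, abs_of_pos hh]
  have he : MeasurableEmbedding (fun x : ℝ => h⁻¹ * x) :=
    (Homeomorph.mulLeft₀ h⁻¹ (inv_ne_zero hh.ne')).measurableEmbedding
  have h1 : eLpNorm (fun x => f (h⁻¹ * x)) p volume =
      ENNReal.ofReal h ^ (1 / p).toReal * eLpNorm f p volume := by
    have := he.eLpNorm_map_measure (g := f) (p := p) (μ := (volume : Measure ℝ))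
    rw [hm] at this
    rw [eLpNorm_smul_measure_of_ne_zero (by simpa using hh)] at this
    exact this.symm
  rw [← h1]
  have h2 := (measurePreserving_sub_right (volume : Measure ℝ) a)
  have he2 : MeasurableEmbedding (fun x : ℝ => x - a) :=
    (Homeomorph.subRight a).measurableEmbedding
  have h3 := he2.eLpNorm_map_measure (g := fun x => f (h⁻¹ * x)) (p := p)
    (μ := (volume : Measure ℝ))
  rw [h2.map_eq] at h3
  rw [h3]
  congr 1
  ext x
  simp [div_eq_inv_mul]

theorem eLpNorm_ennreal_const_mul {X : Type*} [MeasurableSpace X] {μ : Measure X} {p : ℝ≥0∞}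
    {c : ℝ≥0∞} (hc : c ≠ ⊤) (f : X → ℝ≥0∞) :
    eLpNorm (fun x => c * f x) p μ = c * eLpNorm f p μ := by
  rcases eq_or_ne p 0 with rfl | hp0
  · simp
  rcases eq_or_ne p ⊤ with rfl | hp
  · simp only [eLpNorm_ennreal_top]
    exact ENNReal.essSup_const_mul
  · have hP : 0 < p.toReal := ENNReal.toReal_pos hp0 hp
    simp only [eLpNorm_ennreal_of_ne_top hp0 hp, ENNReal.mul_rpow_of_nonneg _ _ hP.le]
    rw [lintegral_const_mul' _ _ (ENNReal.rpow_ne_top_of_nonneg hP.le hc),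
      ENNReal.mul_rpow_of_nonneg _ _ (by positivity), ← ENNReal.rpow_mul,
      mul_one_div_cancel hP.ne', ENNReal.rpow_one]

theorem mixN_const_mul {q r c : ℝ≥0∞} (hc : c ≠ ⊤) (f : ℝ → ℝ → ℝ≥0∞) :
    mixN q r (fun t x => c * f t x) = c * mixN q r f := by
  simp only [mixN, eLpNorm_ennreal_const_mul hc]

theorem mixN_comp_affine (q r : ℝ≥0∞) (f : ℝ → ℝ → ℝ≥0∞) (s a : ℝ) {h : ℝ} (hh : 0 < h) :
    mixN q r (fun t x => f ((t - s) / h ^ 3) ((x - a) / h)) =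
      ENNReal.ofReal h ^ (3 * (1 / q).toReal + (1 / r).toReal) * mixN q r f := by
  have h0 : ENNReal.ofReal h ≠ 0 := by simpa using hh
  simp only [mixN, eLpNorm_comp_affine _ r a hh]
  rw [eLpNorm_ennreal_const_mul (ENNReal.rpow_ne_top_of_nonneg (by positivity) (by simp)),
    eLpNorm_comp_affine (fun t => eLpNorm (f t) r volume) q s (pow_pos hh 3), ← mul_assoc]
  congr 1
  rw [ENNReal.ofReal_pow hh.le, ← ENNReal.rpow_natCast, ← ENNReal.rpow_mul,
    ← ENNReal.rpow_add _ _ h0 (by simp), add_comm]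
  norm_num

/-! ### The dispersive estimate -/

/-- Integration by parts for an oscillatory integral whose amplitude is `ψ φ'` with `ψ`
monotone. -/
theorem norm_integral_mul_deriv_mul_exp_le {ψ ψ' φ φ' : ℝ → ℝ} {a b M : ℝ} (hab : a ≤ b)
    (hψ : ∀ k ∈ Set.Icc a b, HasDerivAt ψ (ψ' k) k) (hφ : ∀ k ∈ Set.Icc a b, HasDerivAt φ (φ' k) k)
    (hψc : ContinuousOn ψ' (Set.Icc a b)) (hφc : ContinuousOn φ' (Set.Icc a b))
    (hsign : (∀ k ∈ Set.Icc a b, 0 ≤ ψ' k) ∨ (∀ k ∈ Set.Icc a b, ψ' k ≤ 0))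
    (ha : |ψ a| ≤ M) (hb : |ψ b| ≤ M) :
    ‖∫ k in a..b, ((ψ k * φ' k : ℝ) : ℂ) * Complex.exp (Complex.I * (φ k : ℝ))‖ ≤ 4 * M := by
  have hu : Set.uIcc a b = Set.Icc a b := Set.uIcc_of_le hab
  set v : ℝ → ℂ := fun k => -Complex.I * Complex.exp (Complex.I * (φ k : ℝ)) with hv
  have hvd : ∀ k ∈ Set.uIcc a b,
      HasDerivAt v ((φ' k : ℂ) * Complex.exp (Complex.I * (φ k : ℝ))) k := by
    intro k hk
    have h1 := (((hφ k (hu ▸ hk)).ofReal_comp.const_mul Complex.I).cexp).const_mul (-Complex.I)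
    convert! h1 using 1
    linear_combination
      ((φ' k : ℂ) * Complex.exp (Complex.I * (φ k : ℝ))) * Complex.I_mul_I
  have hψd : ∀ k ∈ Set.uIcc a b, HasDerivAt (fun k => (ψ k : ℂ)) ((ψ' k : ℝ) : ℂ) k :=
    fun k hk => (hψ k (hu ▸ hk)).ofReal_comp
  have hφcont : ContinuousOn φ (Set.Icc a b) := fun k hk =>
    (hφ k hk).continuousAt.continuousWithinAt
  have hi1 : IntervalIntegrable (fun k => ((ψ' k : ℝ) : ℂ)) volume a b := by
    refine ContinuousOn.intervalIntegrable ?_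
    rw [hu]; exact Complex.continuous_ofReal.comp_continuousOn hψc
  have hi2 : IntervalIntegrable
      (fun k => (φ' k : ℂ) * Complex.exp (Complex.I * (φ k : ℝ))) volume a b := by
    refine ContinuousOn.intervalIntegrable ?_
    rw [hu]
    exact (Complex.continuous_ofReal.comp_continuousOn hφc).mul
      (Complex.continuous_exp.comp_continuousOn
        (continuousOn_const.mul (Complex.continuous_ofReal.comp_continuousOn hφcont)))
  have key := intervalIntegral.integral_mul_deriv_eq_deriv_mul hψd hvd hi1 hi2
  have hvn : ∀ k, ‖v k‖ = 1 := fun k => by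
    simp [hv, Complex.norm_exp]
  have hrw : (∫ k in a..b, ((ψ k * φ' k : ℝ) : ℂ) * Complex.exp (Complex.I * (φ k : ℝ))) =
      ∫ k in a..b, (ψ k : ℂ) * ((φ' k : ℂ) * Complex.exp (Complex.I * (φ k : ℝ))) := by
    refine intervalIntegral.integral_congr fun k _ => ?_
    push_cast; ring
  rw [hrw, key]
  have hi3 : IntervalIntegrable ψ' volume a b := by
    refine ContinuousOn.intervalIntegrable ?_
    rwa [hu]
  have hftc : ∫ k in a..b, ψ' k = ψ b - ψ a :=
    intervalIntegral.integral_eq_sub_of_hasDerivAt (fun k hk => hψ k (hu ▸ hk)) hi3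
  have habs : ∫ k in a..b, |ψ' k| ≤ 2 * M := by
    rcases hsign with h | h
    · have : ∫ k in a..b, |ψ' k| = ∫ k in a..b, ψ' k :=
        intervalIntegral.integral_congr fun k hk => abs_of_nonneg (h k (hu ▸ hk))
      rw [this, hftc]
      linarith [le_abs_self (ψ b), neg_abs_le (ψ a)]
    · have : ∫ k in a..b, |ψ' k| = ∫ k in a..b, -ψ' k :=
        intervalIntegral.integral_congr fun k hk => abs_of_nonpos (h k (hu ▸ hk))
      rw [this, intervalIntegral.integral_neg, hftc]
      linarith [le_abs_self (ψ a), neg_abs_le (ψ b)]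
  have h3 : ‖∫ k in a..b, ((ψ' k : ℝ) : ℂ) * v k‖ ≤ 2 * M := by
    refine (intervalIntegral.norm_integral_le_integral_norm hab).trans (le_trans (le_of_eq ?_) habs)
    refine intervalIntegral.integral_congr fun k _ => ?_
    simp [hvn]
  calc _ ≤ ‖(ψ b : ℂ) * v b‖ + ‖(ψ a : ℂ) * v a‖ + ‖∫ k in a..b, ((ψ' k : ℝ) : ℂ) * v k‖ :=
        (norm_sub_le _ _).trans (by gcongr; exact norm_sub_le _ _)
    _ ≤ M + M + 2 * M := by
        simp only [norm_mul, hvn, mul_one, Complex.norm_real, Real.norm_eq_abs]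
        gcongr
    _ = 4 * M := by ring

/-- The integrand `√k e^{i(k³ + xk)}`. -/
noncomputable def airyIntegrand (x k : ℝ) : ℂ :=
  (√k : ℂ) * Complex.exp (Complex.I * ((k ^ 3 + x * k : ℝ) : ℂ))

theorem continuous_airyIntegrand (x : ℝ) : Continuous (airyIntegrand x) := by
  unfold airyIntegrand
  fun_prop

theorem norm_airyIntegrand (x k : ℝ) : ‖airyIntegrand x k‖ = √k := by
  rw [airyIntegrand, norm_mul, mul_comm Complex.I, Complex.norm_exp_ofReal_mul_I, mul_one,
    Complex.norm_real, Real.norm_of_nonneg (Real.sqrt_nonneg k)]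

/-- Away from the zeros of `3k² + x` the integral is controlled by the amplitude
`√k / (3k² + x)`, whose derivative has the sign of `x - 9k²`. -/
theorem norm_integral_airyIntegrand_le_of_ne {x a b M : ℝ} (ha : 0 < a) (hab : a ≤ b)
    (hd : ∀ k ∈ Set.Icc a b, 3 * k ^ 2 + x ≠ 0) (hs : x ≤ 9 * a ^ 2 ∨ 9 * b ^ 2 ≤ x)
    (hMa : √a ≤ M * |3 * a ^ 2 + x|) (hMb : √b ≤ M * |3 * b ^ 2 + x|) :
    ‖∫ k in a..b, airyIntegrand x k‖ ≤ 4 * M := by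
  have hpos : ∀ k ∈ Set.Icc a b, 0 < k := fun k hk => ha.trans_le hk.1
  have hb := ha.trans_le hab
  have h := norm_integral_mul_deriv_mul_exp_le (M := M)
    (ψ := fun k => √k / (3 * k ^ 2 + x))
    (ψ' := fun k => (x - 9 * k ^ 2) / (2 * √k * (3 * k ^ 2 + x) ^ 2))
    (φ := fun k => k ^ 3 + x * k) (φ' := fun k => 3 * k ^ 2 + x) hab ?_ ?_ ?_ ?_ ?_ ?_ ?_
  · convert! h using 2
    refine intervalIntegral.integral_congr fun k hk => ?_
    rw [Set.uIcc_of_le hab] at hk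
    simp only [airyIntegrand]
    rw [div_mul_cancel₀ _ (hd k hk)]
  · intro k hk
    have hk0 := hpos k hk
    have hsk : √k ≠ 0 := (Real.sqrt_pos.2 hk0).ne'
    have h1 := Real.hasDerivAt_sqrt hk0.ne'
    have h2 : HasDerivAt (fun k : ℝ => 3 * k ^ 2 + x) (6 * k) k := by
      have := (((hasDerivAt_id k).pow 2).const_mul 3).add_const x
      convert! this using 1
      simp; ring
    convert! h1.div h2 (hd k hk) using 1
    have hdk := hd k hk
    have hsq : √k ^ 2 = k := Real.sq_sqrt hk0.le
    have hx : x - 9 * k ^ 2 = (3 * k ^ 2 + x) - 12 * k ^ 2 := by ring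
    rw [hx]
    generalize 3 * k ^ 2 + x = d at hdk
    field_simp
    linear_combination (12 * k) * hsq
  · intro k _
    have := ((hasDerivAt_id k).pow 3).add ((hasDerivAt_id k).const_mul x)
    convert! this using 1
    simp
  · refine ContinuousOn.div (by fun_prop) (by fun_prop) ?_
    intro k hk
    have hsk : √k ≠ 0 := (Real.sqrt_pos.2 (hpos k hk)).ne'
    have := hd k hk
    positivity
  · fun_prop
  · rcases hs with hs | hs
    · right
      intro k hk
      refine div_nonpos_of_nonpos_of_nonneg ?_ (by positivity)
      nlinarith [hk.1, ha]
    · left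
      intro k hk
      refine div_nonneg ?_ (by positivity)
      nlinarith [hk.2, hpos k hk]
  · rw [abs_div, abs_of_nonneg (Real.sqrt_nonneg _)]
    exact div_le_of_le_mul₀ (abs_nonneg _) (by
      by_contra hM
      have := mul_nonpos_of_nonpos_of_nonneg (not_le.1 hM).le (abs_nonneg (3 * a ^ 2 + x))
      linarith [Real.sqrt_pos.2 ha]) hMa
  · rw [abs_div, abs_of_nonneg (Real.sqrt_nonneg _)]
    exact div_le_of_le_mul₀ (abs_nonneg _) (by
      by_contra hM
      have := mul_nonpos_of_nonpos_of_nonneg (not_le.1 hM).le (abs_nonneg (3 * a ^ 2 + x))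
      linarith [Real.sqrt_pos.2 ha]) hMb

theorem norm_integral_airyIntegrand_le_length {x a b : ℝ} (hab : a ≤ b) :
    ‖∫ k in a..b, airyIntegrand x k‖ ≤ √b * (b - a) := by
  have h := intervalIntegral.norm_integral_le_of_norm_le_const (f := airyIntegrand x) (a := a)
    (b := b) (C := √b) fun k hk => by
      rw [Set.uIoc_of_le hab] at hk
      rw [norm_airyIntegrand]
      exact Real.sqrt_le_sqrt hk.2
  rwa [abs_of_nonneg (sub_nonneg.2 hab)] at h

/-- A bound for the integral over any interval follows from bounds for the intervals on either
side of a point. -/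
theorem norm_integral_le_add_of_split {f : ℝ → ℂ} (hf : Continuous f) {l p B₁ B₂ : ℝ}
    (hB₁ : 0 ≤ B₁) (hB₂ : 0 ≤ B₂)
    (h₁ : ∀ a b, l ≤ a → a ≤ b → b ≤ p → ‖∫ k in a..b, f k‖ ≤ B₁)
    (h₂ : ∀ a b, l ≤ a → p ≤ a → a ≤ b → ‖∫ k in a..b, f k‖ ≤ B₂)
    (a b : ℝ) (ha : l ≤ a) (hab : a ≤ b) : ‖∫ k in a..b, f k‖ ≤ B₁ + B₂ := by
  rcases le_total b p with hb | hb
  · linarith [h₁ a b ha hab hb]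
  rcases le_total p a with hp | hp
  · linarith [h₂ a b ha hp hab]
  rw [← intervalIntegral.integral_add_adjacent_intervals (hf.intervalIntegrable a p)
    (hf.intervalIntegrable p b)]
  exact (norm_add_le _ _).trans (add_le_add (h₁ a p ha hp le_rfl) (h₂ p b (ha.trans hp) le_rfl hb))

theorem norm_integral_airyIntegrand_le {x a b : ℝ} (ha : 0 < a) (hab : a ≤ b) :
    ‖∫ k in a..b, airyIntegrand x k‖ ≤ 11 := by
  have hs2 : √(2 : ℝ) ≤ 3 / 2 := by
    rw [Real.sqrt_le_left (by norm_num)]; norm_num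
  have hc := continuous_airyIntegrand x
  rcases le_total (-3) x with hx | hx
  · -- no stationary point beyond `k = 2`
    have tail : ∀ a b, 0 < a → 2 ≤ a → a ≤ b → (x ≤ 9 * a ^ 2 ∨ 9 * b ^ 2 ≤ x) →
        ‖∫ k in a..b, airyIntegrand x k‖ ≤ 4 := by
      intro a b ha h2 hab hs
      have hbd : ∀ k, 2 ≤ k → √k ≤ 1 * |3 * k ^ 2 + x| := by
        intro k hk
        have h1 : √k ≤ k := by
          rw [Real.sqrt_le_left (by linarith)]; nlinarith
        rw [one_mul]
        refine (h1.trans ?_).trans (le_abs_self _)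
        nlinarith
      have := norm_integral_airyIntegrand_le_of_ne (M := 1) ha hab ?_ hs (hbd a h2)
        (hbd b (h2.trans hab))
      · linarith
      · intro k hk
        have : 2 ≤ k := h2.trans hk.1
        nlinarith
    have tail' : ∀ a b, 0 < a → 2 ≤ a → a ≤ b → ‖∫ k in a..b, airyIntegrand x k‖ ≤ 4 + 4 := by
      intro a b ha h2 hab
      refine norm_integral_le_add_of_split hc (l := 2) (p := √x / 3) (by norm_num) (by norm_num)
        ?_ ?_ a b h2 hab
      · intro a b h2 hab hb
        refine tail a b (by linarith) h2 hab (Or.inr ?_)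
        have hx0 : 0 ≤ x := by
          by_contra h
          rw [Real.sqrt_eq_zero_of_nonpos (not_le.1 h).le] at hb
          linarith
        have h3 : (3 * b) ^ 2 ≤ √x ^ 2 := by
          have : 3 * b ≤ √x := by linarith
          have : 0 ≤ 3 * b := by linarith
          gcongr
        rw [Real.sq_sqrt hx0] at h3
        linarith
      · intro a b h2 ha hab
        refine tail a b (by linarith) h2 hab (Or.inl ?_)
        rcases le_total x 0 with h | h
        · nlinarith
        · have h3 : √x ^ 2 ≤ (3 * a) ^ 2 := by
            have : √x ≤ 3 * a := by linarith
            gcongr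
          rw [Real.sq_sqrt h] at h3
          linarith
    have := norm_integral_le_add_of_split hc (l := a) (p := 2) (B₁ := 3) (B₂ := 8) (by norm_num)
      (by norm_num) ?_ ?_ a b le_rfl hab
    · linarith
    · intro a' b' ha' hab' hb'
      refine (norm_integral_airyIntegrand_le_length hab').trans ?_
      have h1 : √b' ≤ √2 := Real.sqrt_le_sqrt hb'
      calc √b' * (b' - a') ≤ (3 / 2) * 2 := by
            apply mul_le_mul (h1.trans hs2) (by linarith) (by linarith) (by norm_num)
        _ = 3 := by norm_num
    · intro a' b' ha' h2 hab'
      linarith [tail' a' b' (by linarith) h2 hab']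
  · -- stationary point `c = √(-x/3) ≥ 1`, with critical window of radius `1/√c`
    set c := √(-x / 3) with hcdef
    have hcx : c ^ 2 = -x / 3 := Real.sq_sqrt (by linarith)
    have hc1 : 1 ≤ c := by
      rw [hcdef, Real.one_le_sqrt]; linarith
    set m := √c with hm
    have hm1 : 1 ≤ m := by rw [hm, Real.one_le_sqrt]; exact hc1
    have hmc : m ^ 2 = c := Real.sq_sqrt (by linarith)
    have hm0 : 0 < m := by linarith
    have hbd : ∀ k, 0 < k → 1 / m ≤ |k - c| → √k ≤ (1 / 6) * |3 * k ^ 2 + x| := by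
      intro k hk hkc
      have e : 3 * k ^ 2 + x = 3 * ((k - c) * (k + c)) := by linear_combination 3 * hcx
      have hsk : √k ^ 2 = k := Real.sq_sqrt hk.le
      rw [e, abs_mul, abs_mul, abs_of_pos (by norm_num : (0 : ℝ) < 3),
        abs_of_pos (by linarith : 0 < k + c)]
      have h1 : 2 * (√k * m) ≤ k + c := by nlinarith [sq_nonneg (√k - m)]
      have h2 : 2 * √k ≤ (1 / m) * (k + c) := by
        rw [one_div, inv_mul_eq_div, le_div_iff₀ hm0]; linarith
      have h3 : (1 / m) * (k + c) ≤ |k - c| * (k + c) := by gcongr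
      linarith
    have off : ∀ a b, 0 < a → a ≤ b → (∀ k ∈ Set.Icc a b, 1 / m ≤ |k - c|) →
        ‖∫ k in a..b, airyIntegrand x k‖ ≤ 1 := by
      intro a b ha hab h
      have := norm_integral_airyIntegrand_le_of_ne (x := x) (M := 1 / 6) ha hab ?_
        (Or.inl (by nlinarith)) (hbd a ha (h a ⟨le_rfl, hab⟩))
        (hbd b (ha.trans_le hab) (h b ⟨hab, le_rfl⟩))
      · linarith
      · intro k hk h0
        have h1 := hbd k (ha.trans_le hk.1) (h k hk)
        rw [h0, abs_zero, mul_zero] at h1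
        exact absurd (Real.sqrt_pos.2 (ha.trans_le hk.1)) (not_lt.2 h1)
    have := norm_integral_le_add_of_split hc (l := a) (p := c - 1 / m) (B₁ := 1) (B₂ := 3 + 1)
      (by norm_num) (by norm_num) ?_ ?_ a b le_rfl hab
    · linarith
    · intro a' b' ha' hab' hb'
      refine off a' b' (by linarith) hab' fun k hk => ?_
      rw [abs_sub_comm]
      exact le_trans (by linarith [hk.2]) (le_abs_self _)
    · intro a' b' ha' hp' hab'
      refine norm_integral_le_add_of_split hc (l := a') (p := c + 1 / m) (B₁ := 3) (B₂ := 1)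
        (by norm_num) (by norm_num) ?_ ?_ a' b' le_rfl hab'
      · intro a'' b'' ha'' hab'' hb''
        refine (norm_integral_airyIntegrand_le_length hab'').trans ?_
        have h1 : 1 / m ≤ 1 := by rw [div_le_one hm0]; exact hm1
        have h2 : √b'' ≤ √2 * m := by
          rw [hm, ← Real.sqrt_mul (by norm_num)]
          exact Real.sqrt_le_sqrt (by linarith)
        calc √b'' * (b'' - a'') ≤ (3 / 2 * m) * (2 * (1 / m)) := by
              apply mul_le_mul _ (by linarith) (by linarith) (by positivity)
              exact h2.trans (by gcongr)
          _ = 3 := by field_simp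
      · intro a'' b'' ha'' hp'' hab''
        refine off a'' b'' (by linarith) hab'' fun k hk => ?_
        exact le_trans (by linarith [hk.1]) (le_abs_self _)

/-- Dispersion: the kernel of `D^{1/2} e^{-t∂ₓ³}`, with arbitrary sharp frequency cutoffs, decays
like `|t|^{-1/2}`. -/
theorem norm_integral_sqrt_mul_exp_cubic_le {t x a b : ℝ} (ht : t ≠ 0) (ha : 0 < a) (hab : a ≤ b) :
    ‖∫ k in a..b, (√k : ℂ) * Complex.exp (Complex.I * ((t * k ^ 3 + x * k : ℝ) : ℂ))‖ ≤
      11 / √|t| := by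
  have pos : ∀ t x : ℝ, 0 < t →
      ‖∫ k in a..b, (√k : ℂ) * Complex.exp (Complex.I * ((t * k ^ 3 + x * k : ℝ) : ℂ))‖ ≤
      11 / √t := by
    intro t x ht
    obtain ⟨s, hs, rfl⟩ : ∃ s : ℝ, 0 < s ∧ s ^ 3 = t :=
      ⟨t ^ (1 / 3 : ℝ), by positivity, by
        rw [← Real.rpow_natCast, ← Real.rpow_mul ht.le]; norm_num⟩
    have h1 := intervalIntegral.integral_comp_mul_left (a := a) (b := b) (airyIntegrand (x / s))
      hs.ne'
    have h2 : ∀ k, airyIntegrand (x / s) (s * k) = (√s : ℂ) *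
        ((√k : ℂ) * Complex.exp (Complex.I * ((s ^ 3 * k ^ 3 + x * k : ℝ) : ℂ))) := by
      intro k
      rw [airyIntegrand, Real.sqrt_mul hs.le]
      have : (s * k) ^ 3 + x / s * (s * k) = s ^ 3 * k ^ 3 + x * k := by field_simp
      rw [this]
      push_cast
      ring
    simp only [h2] at h1
    rw [intervalIntegral.integral_const_mul] at h1
    have h3 := congrArg norm h1
    rw [norm_mul, norm_smul, Complex.norm_real, Real.norm_of_nonneg (Real.sqrt_nonneg _),
      Real.norm_of_nonneg (inv_nonneg.2 hs.le)] at h3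
    have h4 := norm_integral_airyIntegrand_le (x := x / s) (mul_pos hs ha)
      (mul_le_mul_of_nonneg_left hab hs.le)
    have h5 : √(s ^ 3) = s * √s := by
      rw [pow_succ, Real.sqrt_mul (by positivity), Real.sqrt_sq hs.le]
    have hss : 0 < √s := Real.sqrt_pos.2 hs
    rw [h5, le_div_iff₀ (by positivity), mul_comm, mul_assoc, h3]
    calc s * (s⁻¹ * ‖∫ k in s * a..s * b, airyIntegrand (x / s) k‖)
        = ‖∫ k in s * a..s * b, airyIntegrand (x / s) k‖ := by field_simp
      _ ≤ 11 := h4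
  rcases lt_or_gt_of_ne ht with h | h
  · rw [abs_of_neg h, ← Complex.norm_conj, ← intervalIntegral.intervalIntegral_conj]
    have := pos (-t) (-x) (by linarith)
    convert! this using 3
    ext k
    rw [map_mul, ← Complex.exp_conj, map_mul, Complex.conj_I, Complex.conj_ofReal,
      Complex.conj_ofReal]
    congr 2
    push_cast; ring
  · rw [abs_of_pos h]; exact pos t x h

/-! ### A fractional integration inequality -/

theorem lintegral_comp_abs' (f : ℝ → ℝ≥0∞) :
    ∫⁻ x : ℝ, f |x| = 2 * ∫⁻ x in Set.Ioi (0 : ℝ), f x := by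
  rw [← lintegral_add_compl (fun x : ℝ => f |x|) (measurableSet_Ioi (a := (0 : ℝ))), two_mul]
  congr 1
  · exact setLIntegral_congr_fun measurableSet_Ioi fun x hx => by
      simp only [abs_of_pos (Set.mem_Ioi.1 hx)]
  · rw [Set.compl_Ioi, setLIntegral_congr Iio_ae_eq_Iic.symm]
    have h := (Measure.measurePreserving_neg (volume : Measure ℝ)).setLIntegral_comp_preimage_emb
      (Homeomorph.neg ℝ).measurableEmbedding f (Set.Ioi 0)
    rw [← h]
    have h2 : (fun x : ℝ => -x) ⁻¹' Set.Ioi 0 = Set.Iio 0 := by ext; simp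
    have h3 : (Neg.neg : ℝ → ℝ) ⁻¹' Set.Ioi 0 = Set.Iio 0 := h2
    rw [h3]
    exact setLIntegral_congr_fun measurableSet_Iio fun x hx => by
      simp only [abs_of_neg (Set.mem_Iio.1 hx)]

/-- The kernel `|u|^{-1/2}`. -/
noncomputable def rieszKernel (u : ℝ) : ℝ≥0∞ := ENNReal.ofReal (|u| ^ (-(1 / 2) : ℝ))

theorem measurable_rieszKernel : Measurable rieszKernel := by
  unfold rieszKernel
  fun_prop

theorem lintegral_rieszKernel_near {δ : ℝ} (hδ : 0 < δ) :
    ∫⁻ u : ℝ, (if |u| < δ then rieszKernel u else 0) = ENNReal.ofReal (4 * √δ) := by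
  have h := lintegral_comp_abs' (fun u => if u < δ then ENNReal.ofReal (u ^ (-(1 / 2) : ℝ)) else 0)
  simp only [rieszKernel]
  rw [h]
  have h1 : ∫⁻ u in Set.Ioi (0 : ℝ), (if u < δ then ENNReal.ofReal (u ^ (-(1 / 2) : ℝ)) else 0) =
      ∫⁻ u in Set.Ioc (0 : ℝ) δ, ENNReal.ofReal (u ^ (-(1 / 2) : ℝ)) := by
    have : (fun u : ℝ => if u < δ then ENNReal.ofReal (u ^ (-(1 / 2) : ℝ)) else 0) =
      (Set.Iio δ).indicator (fun u => ENNReal.ofReal (u ^ (-(1 / 2) : ℝ))) := by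
      ext u; simp [Set.indicator]
    rw [this, setLIntegral_indicator measurableSet_Iio, Set.inter_comm, Set.Ioi_inter_Iio]
    exact setLIntegral_congr Ioo_ae_eq_Ioc
  have hint : IntervalIntegrable (fun u : ℝ => u ^ (-(1 / 2) : ℝ)) volume 0 δ :=
    intervalIntegral.intervalIntegrable_rpow' (by norm_num)
  rw [h1, ← ofReal_integral_eq_lintegral_ofReal
    ((intervalIntegrable_iff_integrableOn_Ioc_of_le hδ.le).1 hint),
    ← intervalIntegral.integral_of_le hδ.le, integral_rpow (Or.inl (by norm_num))]
  · rw [show (2 : ℝ≥0∞) = ENNReal.ofReal 2 by simp, ← ENNReal.ofReal_mul (by norm_num)]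
    congr 1
    rw [Real.sqrt_eq_rpow]
    norm_num
    ring
  · filter_upwards [ae_restrict_mem measurableSet_Ioc] with u hu
    exact Real.rpow_nonneg hu.1.le _

theorem lintegral_rieszKernel_far {δ : ℝ} (hδ : 0 < δ) :
    ∫⁻ u : ℝ, (if |u| < δ then 0 else rieszKernel u ^ (4 : ℝ)) = ENNReal.ofReal (2 / δ) := by
  have h := lintegral_comp_abs'
    (fun u => if u < δ then 0 else ENNReal.ofReal (u ^ (-(1 / 2) : ℝ)) ^ (4 : ℝ))
  simp only [rieszKernel]
  rw [h]
  have h1 : ∫⁻ u in Set.Ioi (0 : ℝ),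
      (if u < δ then 0 else ENNReal.ofReal (u ^ (-(1 / 2) : ℝ)) ^ (4 : ℝ)) =
      ∫⁻ u in Set.Ioi δ, ENNReal.ofReal (u ^ (-2 : ℝ)) := by
    have : (fun u : ℝ => if u < δ then 0 else ENNReal.ofReal (u ^ (-(1 / 2) : ℝ)) ^ (4 : ℝ)) =
      (Set.Ici δ).indicator (fun u => ENNReal.ofReal (u ^ (-2 : ℝ))) := by
      ext u
      by_cases hu : u < δ
      · simp [hu]
      · have hu' : δ ≤ u := not_lt.1 hu
        have : 0 < u := hδ.trans_le hu'
        rw [if_neg hu, Set.indicator_of_mem (Set.mem_Ici.2 hu'),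
          ENNReal.ofReal_rpow_of_nonneg (by positivity) (by norm_num), ← Real.rpow_mul this.le]
        norm_num
    rw [this, setLIntegral_indicator measurableSet_Ici]
    have h2 : Set.Ici δ ∩ Set.Ioi 0 = Set.Ici δ :=
      Set.inter_eq_left.2 fun x hx => hδ.trans_le hx
    rw [h2]
    exact setLIntegral_congr Ioi_ae_eq_Ici.symm
  rw [h1, ← ofReal_integral_eq_lintegral_ofReal
    (integrableOn_Ioi_rpow_of_lt (by norm_num) hδ),
    integral_Ioi_rpow_of_lt (by norm_num) hδ]
  · rw [show (2 : ℝ≥0∞) = ENNReal.ofReal 2 by simp, ← ENNReal.ofReal_mul (by norm_num)]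
    congr 1
    norm_num [Real.rpow_neg_one]
    field_simp
  · filter_upwards [ae_restrict_mem measurableSet_Ioi] with u hu
    exact Real.rpow_nonneg (hδ.trans hu).le _

/-- The contribution of the values of `g` below `g t`: splitting the kernel at the radius
`δ = Γ / g(t)^{4/3}`, `Γ = ∫ g^{4/3}`, balances the bounds `g(t) δ^{1/2}` (near) and
`Γ^{3/4} δ^{-1/4}` (far, by Hölder). -/
theorem lintegral_lower_mul_rieszKernel_le {g : ℝ → ℝ≥0∞} (hg : Measurable g)
    (hΓ0 : ∫⁻ s, g s ^ (4 / 3 : ℝ) ≠ 0) (hΓ : ∫⁻ s, g s ^ (4 / 3 : ℝ) ≠ ⊤) {t : ℝ} (ht : g t ≠ ⊤) :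
    g t * ∫⁻ s, (if g s ≤ g t then g s else 0) * rieszKernel (t - s) ≤
      6 * (g t ^ (4 / 3 : ℝ) * (∫⁻ s, g s ^ (4 / 3 : ℝ)) ^ (1 / 2 : ℝ)) := by
  rcases eq_or_ne (g t) 0 with h0 | h0
  · simp [h0]
  set Γ := ∫⁻ s, g s ^ (4 / 3 : ℝ) with hΓdef
  obtain ⟨m, hm, hmg⟩ : ∃ m : ℝ, 0 < m ∧ g t = ENNReal.ofReal m ^ (3 : ℝ) := by
    refine ⟨((g t) ^ (1 / 3 : ℝ)).toReal, ENNReal.toReal_pos ?_ ?_, ?_⟩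
    · simp [h0]
    · exact ENNReal.rpow_ne_top_of_nonneg (by norm_num) ht
    · rw [ENNReal.ofReal_toReal (ENNReal.rpow_ne_top_of_nonneg (by norm_num) ht),
        ← ENNReal.rpow_mul]
      norm_num
  obtain ⟨n, hn, hnΓ⟩ : ∃ n : ℝ, 0 < n ∧ Γ = ENNReal.ofReal n ^ (4 : ℝ) := by
    refine ⟨(Γ ^ (1 / 4 : ℝ)).toReal, ENNReal.toReal_pos ?_ ?_, ?_⟩
    · simp [hΓ0]
    · exact ENNReal.rpow_ne_top_of_nonneg (by norm_num) hΓ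
    · rw [ENNReal.ofReal_toReal (ENNReal.rpow_ne_top_of_nonneg (by norm_num) hΓ),
        ← ENNReal.rpow_mul]
      norm_num
  set δ : ℝ := (n / m) ^ 4 with hδdef
  have hδ : 0 < δ := by positivity
  have hsq : √δ = (n / m) ^ 2 := by
    rw [hδdef, show (n / m) ^ 4 = ((n / m) ^ 2) ^ 2 by ring, Real.sqrt_sq (by positivity)]
  have near : ∫⁻ s, g t * (if |t - s| < δ then rieszKernel (t - s) else 0) =
      ENNReal.ofReal (4 * m * n ^ 2) := by
    rw [lintegral_const_mul' _ _ ht,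
      lintegral_sub_left_eq_self (fun u => if |u| < δ then rieszKernel u else 0) t,
      lintegral_rieszKernel_near hδ, hmg, ENNReal.ofReal_rpow_of_pos hm,
      ← ENNReal.ofReal_mul (by positivity), hsq]
    congr 1
    norm_cast
    field_simp
  have far : ∫⁻ s, g s * (if |t - s| < δ then 0 else rieszKernel (t - s)) ≤
      ENNReal.ofReal (2 * m * n ^ 2) := by
    have hmeas : Measurable fun s => if |t - s| < δ then 0 else rieszKernel (t - s) :=
      Measurable.ite (measurableSet_lt (by fun_prop) measurable_const) measurable_const
        (measurable_rieszKernel.comp (by fun_prop))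
    have hH := ENNReal.lintegral_mul_le_Lp_mul_Lq volume (p := 4 / 3) (q := 4)
      (Real.holderConjugate_iff.2 ⟨by norm_num, by norm_num⟩) hg.aemeasurable hmeas.aemeasurable
    have e1 : ∀ s, (if |t - s| < δ then 0 else rieszKernel (t - s)) ^ (4 : ℝ) =
        (if |t - s| < δ then 0 else rieszKernel (t - s) ^ (4 : ℝ)) := fun s => by
      split_ifs
      · simp
      · rfl
    simp only [e1] at hH
    rw [lintegral_sub_left_eq_self (fun u => if |u| < δ then 0 else rieszKernel u ^ (4 : ℝ)) t,
      lintegral_rieszKernel_far hδ, ← hΓdef, hnΓ, ← ENNReal.rpow_mul] at hH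
    refine hH.trans ?_
    rw [ENNReal.ofReal_rpow_of_pos hn, ENNReal.ofReal_rpow_of_pos (by positivity),
      ← ENNReal.ofReal_mul (by positivity)]
    refine ENNReal.ofReal_le_ofReal ?_
    have e2 : (2 / δ) ^ (1 / 4 : ℝ) ≤ 2 * (m / n) := by
      have h1 : 2 / δ ≤ (2 * (m / n)) ^ 4 := by
        rw [hδdef, div_pow, div_div_eq_mul_div, mul_pow, div_pow]
        rw [mul_div_assoc]
        gcongr
        norm_num
      calc (2 / δ) ^ (1 / 4 : ℝ) ≤ ((2 * (m / n)) ^ 4) ^ (1 / 4 : ℝ) := by gcongr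
        _ = 2 * (m / n) := by
          rw [← Real.rpow_natCast, ← Real.rpow_mul (by positivity)]
          norm_num
    calc n ^ (4 * (1 / (4 / 3)) : ℝ) * (2 / δ) ^ (1 / 4 : ℝ) ≤ n ^ 3 * (2 * (m / n)) := by
          have : n ^ (4 * (1 / (4 / 3)) : ℝ) = n ^ 3 := by
            rw [← Real.rpow_natCast]; norm_num
          rw [this]
          gcongr
      _ = 2 * m * n ^ 2 := by field_simp
  have split : ∫⁻ s, (if g s ≤ g t then g s else 0) * rieszKernel (t - s) ≤
      ENNReal.ofReal (6 * m * n ^ 2) := by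
    calc _ ≤ ∫⁻ s, (g t * (if |t - s| < δ then rieszKernel (t - s) else 0) +
          g s * (if |t - s| < δ then 0 else rieszKernel (t - s))) := by
          refine lintegral_mono fun s => ?_
          by_cases h1 : |t - s| < δ <;> by_cases h2 : g s ≤ g t <;> simp [h1, h2]
          gcongr
      _ = _ + _ := lintegral_add_left (Measurable.const_mul (Measurable.ite
          (measurableSet_lt (by fun_prop) measurable_const)
          (measurable_rieszKernel.comp (by fun_prop)) measurable_const) _) _
      _ ≤ ENNReal.ofReal (4 * m * n ^ 2) + ENNReal.ofReal (2 * m * n ^ 2) := by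
          exact add_le_add near.le far
      _ = _ := by
          rw [← ENNReal.ofReal_add (by positivity) (by positivity)]
          congr 1; ring
  calc _ ≤ g t * ENNReal.ofReal (6 * m * n ^ 2) := by gcongr
    _ = _ := by
      rw [hmg, hnΓ, ← ENNReal.rpow_mul, ← ENNReal.rpow_mul, ENNReal.ofReal_rpow_of_pos hm,
        ENNReal.ofReal_rpow_of_pos hm, ENNReal.ofReal_rpow_of_pos hn,
        show (6 : ℝ≥0∞) = ENNReal.ofReal 6 by simp, ← ENNReal.ofReal_mul (by positivity),
        ← ENNReal.ofReal_mul (by positivity), ← ENNReal.ofReal_mul (by norm_num)]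
      congr 1
      norm_num
      norm_cast
      ring

/-- The diagonal case `L^{4/3} → L^4` of the Hardy–Littlewood–Sobolev inequality. -/
theorem lintegral_lintegral_rieszKernel_le {g : ℝ → ℝ≥0∞} (hg : Measurable g)
    (hfin : ∀ t, g t ≠ ⊤) :
    ∫⁻ t, ∫⁻ s, g t * g s * rieszKernel (t - s) ≤
      12 * (∫⁻ s, g s ^ (4 / 3 : ℝ)) ^ (3 / 2 : ℝ) := by
  set Γ := ∫⁻ s, g s ^ (4 / 3 : ℝ) with hΓdef
  rcases eq_or_ne Γ 0 with h0 | h0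
  · have h1 : ∀ᵐ t : ℝ, g t = 0 := by
      have := (lintegral_eq_zero_iff (hg.pow_const _)).1 h0
      filter_upwards [this] with t ht
      exact (ENNReal.rpow_eq_zero_iff_of_pos (by norm_num)).1 ht
    have : ∫⁻ t, ∫⁻ s, g t * g s * rieszKernel (t - s) = 0 := by
      rw [← lintegral_zero (μ := (volume : Measure ℝ))]
      refine lintegral_congr_ae ?_
      filter_upwards [h1] with t ht
      simp [ht]
    simp [this]
  rcases eq_or_ne Γ ⊤ with ht | ht
  · rw [ht, ENNReal.top_rpow_of_pos (by norm_num), ENNReal.mul_top (by norm_num)]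
    exact le_top
  set F : ℝ → ℝ → ℝ≥0∞ := fun t s =>
    g t * ((if g s ≤ g t then g s else 0) * rieszKernel (t - s)) with hF
  have hFm : Measurable (Function.uncurry F) := by
    refine (hg.comp measurable_fst).mul (Measurable.mul ?_ ?_)
    · exact Measurable.ite (measurableSet_le (hg.comp measurable_snd) (hg.comp measurable_fst))
        (hg.comp measurable_snd) measurable_const
    · exact measurable_rieszKernel.comp (measurable_fst.sub measurable_snd)
  have hlow : ∫⁻ t, ∫⁻ s, F t s ≤ 6 * Γ ^ (3 / 2 : ℝ) := by
    calc ∫⁻ t, ∫⁻ s, F t s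
        ≤ ∫⁻ t, 6 * (g t ^ (4 / 3 : ℝ) * Γ ^ (1 / 2 : ℝ)) := by
          refine lintegral_mono fun t => ?_
          simp only [hF]
          rw [lintegral_const_mul' _ _ (hfin t)]
          exact lintegral_lower_mul_rieszKernel_le hg h0 ht (hfin t)
      _ = 6 * (Γ * Γ ^ (1 / 2 : ℝ)) := by
          rw [lintegral_const_mul' _ _ (by norm_num), lintegral_mul_const' _ _
            (ENNReal.rpow_ne_top_of_nonneg (by norm_num) ht)]
      _ = 6 * Γ ^ (3 / 2 : ℝ) := by
          congr 1
          nth_rewrite 1 [← ENNReal.rpow_one Γ]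
          rw [← ENNReal.rpow_add _ _ h0 ht]
          norm_num
  calc ∫⁻ t, ∫⁻ s, g t * g s * rieszKernel (t - s)
      ≤ ∫⁻ t, ∫⁻ s, (F t s + F s t) := by
        refine lintegral_mono fun t => lintegral_mono fun s => ?_
        have hsymm : rieszKernel (s - t) = rieszKernel (t - s) := by
          simp only [rieszKernel, abs_sub_comm]
        simp only [hF, hsymm]
        rcases le_total (g s) (g t) with h | h
        · simp only [h, if_true]
          exact le_add_right (by rw [mul_assoc])
        · simp only [h, if_true]
          exact le_add_left (by rw [mul_comm (g t), mul_assoc])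
    _ = ∫⁻ t, ((∫⁻ s, F t s) + ∫⁻ s, F s t) := by
        refine lintegral_congr fun t => ?_
        exact lintegral_add_left (hFm.comp measurable_prodMk_left) _
    _ = (∫⁻ t, ∫⁻ s, F t s) + ∫⁻ t, ∫⁻ s, F s t :=
        lintegral_add_left (Measurable.lintegral_prod_right hFm) _
    _ = (∫⁻ t, ∫⁻ s, F t s) + ∫⁻ t, ∫⁻ s, F t s := by
        congr 1
        exact lintegral_lintegral_swap (f := fun t s => F s t)
          (hFm.comp measurable_swap).aemeasurable
    _ ≤ 6 * Γ ^ (3 / 2 : ℝ) + 6 * Γ ^ (3 / 2 : ℝ) := add_le_add hlow hlow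
    _ = 12 * Γ ^ (3 / 2 : ℝ) := by rw [← add_mul]; norm_num

/-! ### The extension operator -/

/-- The space-time character `e^{i(tk³ + xk)}` at the angular frequency `k = 2πξ`. -/
noncomputable def phase (t x ξ : ℝ) : ℂ :=
  Complex.exp (Complex.I * ((t * (2 * Real.pi * ξ) ^ 3 + x * (2 * Real.pi * ξ) : ℝ) : ℂ))

theorem norm_phase (t x ξ : ℝ) : ‖phase t x ξ‖ = 1 := by
  rw [phase, mul_comm, Complex.norm_exp_ofReal_mul_I]

theorem continuous_phase : Continuous fun z : ℝ × ℝ × ℝ => phase z.1 z.2.1 z.2.2 := by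
  unfold phase
  fun_prop

theorem phase_mul_conj (t x s y ξ : ℝ) :
    phase t x ξ * (starRingEnd ℂ) (phase s y ξ) = phase (t - s) (x - y) ξ := by
  simp only [phase, ← Complex.exp_conj, map_mul, Complex.conj_I, Complex.conj_ofReal,
    ← Complex.exp_add]
  congr 1
  push_cast
  ring

/-- The superposition `∫ e^{i(tk³ + xk)} h(ξ) dξ`, `k = 2πξ`, of Airy waves with frequency
density `h`. -/
noncomputable def ev (h : ℝ → ℂ) (t x : ℝ) : ℂ := ∫ ξ, phase t x ξ * h ξ

theorem integrable_phase_mul {h : ℝ → ℂ} (hh : Integrable h) (t x : ℝ) :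
    Integrable fun ξ => phase t x ξ * h ξ := by
  refine hh.bdd_mul (c := 1) ?_ (Eventually.of_forall fun ξ => (norm_phase t x ξ).le)
  exact (continuous_phase.comp (by fun_prop :
    Continuous fun ξ : ℝ => (t, x, ξ))).aestronglyMeasurable

theorem norm_ev_le (h : ℝ → ℂ) (t x : ℝ) : ‖ev h t x‖ ≤ ∫ ξ, ‖h ξ‖ := by
  refine (norm_integral_le_integral_norm _).trans (le_of_eq ?_)
  simp [norm_phase]

theorem continuous_ev {h : ℝ → ℂ} (hh : Integrable h) :
    Continuous fun z : ℝ × ℝ => ev h z.1 z.2 := by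
  refine continuous_of_dominated (bound := fun ξ => ‖h ξ‖)
    (fun z => (integrable_phase_mul hh z.1 z.2).aestronglyMeasurable)
    (fun z => Eventually.of_forall fun ξ => by simp [norm_phase]) hh.norm
    (Eventually.of_forall fun ξ => ?_)
  exact (continuous_phase.comp (by fun_prop :
    Continuous fun z : ℝ × ℝ => (z.1, z.2, ξ))).mul continuous_const

theorem aem_ev {h : ℝ → ℂ} (hh : Integrable h) : AEM fun t x => ‖ev h t x‖ₑ :=
  (continuous_ev hh).enorm.measurable.aemeasurable

/-- The frequency annulus `a ≤ |k| < b`, `k = 2πξ`. -/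
def shell (a b : ℝ) : Set ℝ := {ξ | a ≤ |2 * Real.pi * ξ| ∧ |2 * Real.pi * ξ| < b}

theorem measurableSet_shell (a b : ℝ) : MeasurableSet (shell a b) := by
  have h1 : Measurable fun ξ : ℝ => |2 * Real.pi * ξ| := by fun_prop
  exact (measurableSet_le measurable_const h1).inter (measurableSet_lt h1 measurable_const)

theorem shell_eq_union {a b : ℝ} (ha : 0 < a) :
    shell a b = Set.Ico (a / (2 * Real.pi)) (b / (2 * Real.pi)) ∪
      Set.Ioc (-(b / (2 * Real.pi))) (-(a / (2 * Real.pi))) := by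
  have hπ : 0 < 2 * Real.pi := by positivity
  ext ξ
  simp only [shell, Set.mem_ofPred_eq, Set.mem_union, Set.mem_Ico, Set.mem_Ioc,
    div_le_iff₀ hπ, lt_div_iff₀ hπ, neg_lt, le_neg]
  rw [mul_comm (2 * Real.pi) ξ]
  rcases le_total 0 (ξ * (2 * Real.pi)) with h | h
  · rw [abs_of_nonneg h]
    constructor
    · exact Or.inl
    · rintro (h1 | ⟨_, h2⟩)
      · exact h1
      · linarith
  · rw [abs_of_nonpos h]
    constructor
    · rintro ⟨h1, h2⟩
      exact Or.inr ⟨by linarith, by linarith⟩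
    · rintro (⟨h1, _⟩ | ⟨h1, h2⟩)
      · linarith
      · exact ⟨by linarith, by linarith⟩

theorem volume_shell_le {a b : ℝ} (ha : 0 < a) (hab : a ≤ b) :
    volume (shell a b) ≤ ENNReal.ofReal b := by
  have hπ : 1 ≤ Real.pi := by linarith [Real.pi_gt_three]
  rw [shell_eq_union ha]
  refine (measure_union_le _ _).trans ?_
  rw [Real.volume_Ico, Real.volume_Ioc, ← ENNReal.ofReal_add]
  · refine ENNReal.ofReal_le_ofReal ?_
    have h1 : b / (2 * Real.pi) ≤ b / 2 := by
      apply div_le_div_of_nonneg_left (by linarith) (by norm_num) (by linarith)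
    have h2 : 0 ≤ a / (2 * Real.pi) := by positivity
    linarith
  · rw [sub_nonneg]; gcongr
  · have : a / (2 * Real.pi) ≤ b / (2 * Real.pi) := by gcongr
    linarith

/-- The kernel of `TT*` at the endpoint. -/
theorem enorm_setIntegral_shell_le {a b t : ℝ} (x : ℝ) (ha : 0 < a) (hab : a ≤ b) (ht : t ≠ 0) :
    ‖∫ ξ in shell a b, phase t x ξ * (√|2 * Real.pi * ξ| : ℂ)‖ₑ ≤ 4 * rieszKernel t := by
  have hπ : 0 < 2 * Real.pi := by positivity
  have hle : a / (2 * Real.pi) ≤ b / (2 * Real.pi) := by gcongr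
  have ha' : 0 < a / (2 * Real.pi) := by positivity
  set f : ℝ → ℝ → ℝ → ℂ := fun t x ξ => phase t x ξ * (√|2 * Real.pi * ξ| : ℂ) with hf
  have hfc : ∀ t x, Continuous (f t x) := fun t x =>
    (continuous_phase.comp (by fun_prop : Continuous fun ξ : ℝ => (t, x, ξ))).mul (by fun_prop)
  have half : ∀ t x : ℝ, t ≠ 0 →
      ‖∫ ξ in (a / (2 * Real.pi))..(b / (2 * Real.pi)), f t x ξ‖ ≤ 2 / √|t| := by
    intro t x ht
    have h1 := norm_integral_sqrt_mul_exp_cubic_le (x := x) ht ha hab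
    have h2 := intervalIntegral.integral_comp_mul_left (a := a / (2 * Real.pi))
      (b := b / (2 * Real.pi)) (fun k : ℝ => (√k : ℂ) *
        Complex.exp (Complex.I * ((t * k ^ 3 + x * k : ℝ) : ℂ))) hπ.ne'
    rw [mul_div_cancel₀ _ hπ.ne', mul_div_cancel₀ _ hπ.ne'] at h2
    have h3 : ∫ ξ in (a / (2 * Real.pi))..(b / (2 * Real.pi)), f t x ξ =
        ∫ ξ in (a / (2 * Real.pi))..(b / (2 * Real.pi)), (√(2 * Real.pi * ξ) : ℂ) *
        Complex.exp
          (Complex.I * ((t * (2 * Real.pi * ξ) ^ 3 + x * (2 * Real.pi * ξ) : ℝ) : ℂ)) := by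
      refine intervalIntegral.integral_congr fun ξ hξ => ?_
      rw [Set.uIcc_of_le hle] at hξ
      simp only [hf, phase]
      rw [abs_of_nonneg (by have := ha'.trans_le hξ.1; positivity), mul_comm]
    rw [h3, h2, norm_smul, Real.norm_of_nonneg (by positivity)]
    calc (2 * Real.pi)⁻¹ * _ ≤ (2 * Real.pi)⁻¹ * (11 / √|t|) := by gcongr
      _ = (11 / (2 * Real.pi)) / √|t| := by ring
      _ ≤ 2 / √|t| := by
        gcongr
        rw [div_le_iff₀ hπ]; linarith [Real.pi_gt_three]
  have hdisj : Disjoint (Set.Ico (a / (2 * Real.pi)) (b / (2 * Real.pi)))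
      (Set.Ioc (-(b / (2 * Real.pi))) (-(a / (2 * Real.pi)))) := by
    rw [Set.disjoint_left]
    intro ξ h1 h2
    linarith [h1.1, h2.2]
  have hsum : ∫ ξ in shell a b, f t x ξ =
      (∫ ξ in (a / (2 * Real.pi))..(b / (2 * Real.pi)), f t x ξ) +
      ∫ ξ in (a / (2 * Real.pi))..(b / (2 * Real.pi)), f (-t) (-x) ξ := by
    rw [shell_eq_union ha, setIntegral_union hdisj measurableSet_Ioc
      ((hfc t x).integrableOn_Icc.mono_set Set.Ico_subset_Icc_self)
      ((hfc t x).integrableOn_Icc.mono_set Set.Ioc_subset_Icc_self)]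
    congr 1
    · rw [intervalIntegral.integral_of_le hle, integral_Ico_eq_integral_Ioo,
        integral_Ioc_eq_integral_Ioo]
    · rw [← intervalIntegral.integral_of_le (by linarith),
        ← intervalIntegral.integral_comp_neg]
      refine intervalIntegral.integral_congr fun ξ _ => ?_
      simp only [hf, phase]
      congr 3
      · push_cast; ring
      · rw [mul_neg, abs_neg]
  rw [hsum]
  have hreal : ‖(∫ ξ in (a / (2 * Real.pi))..(b / (2 * Real.pi)), f t x ξ) +
      ∫ ξ in (a / (2 * Real.pi))..(b / (2 * Real.pi)), f (-t) (-x) ξ‖ ≤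
      4 * |t| ^ (-(1 / 2) : ℝ) := by
    refine (norm_add_le _ _).trans ((add_le_add (half t x ht)
      (half (-t) (-x) (neg_ne_zero.2 ht))).trans (le_of_eq ?_))
    rw [abs_neg, Real.rpow_neg (abs_nonneg t), ← Real.sqrt_eq_rpow]
    ring
  rw [rieszKernel, show (4 : ℝ≥0∞) = ENNReal.ofReal 4 by simp, ← ENNReal.ofReal_mul (by norm_num),
    ← ofReal_norm]
  exact ENNReal.ofReal_le_ofReal hreal

/-! ### The endpoint estimate -/

section Endpoint

variable {a b : ℝ} {G : ℝ → ℂ}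

/-- The weight `|k|^{1/4}` on the annulus `a ≤ |k| < b`. -/
noncomputable def quarterWeight (a b ξ : ℝ) : ℝ :=
  (shell a b).indicator (fun ξ => |2 * Real.pi * ξ| ^ (1 / 4 : ℝ)) ξ

theorem measurable_quarterWeight : Measurable (quarterWeight a b) :=
  Measurable.indicator (by fun_prop) (measurableSet_shell a b)

theorem quarterWeight_sq (ξ : ℝ) :
    quarterWeight a b ξ ^ 2 = (shell a b).indicator (fun ξ => √|2 * Real.pi * ξ|) ξ := by
  by_cases h : ξ ∈ shell a b
  · rw [quarterWeight, Set.indicator_of_mem h, Set.indicator_of_mem h, Real.sqrt_eq_rpow,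
      ← Real.rpow_natCast, ← Real.rpow_mul (abs_nonneg _)]
    norm_num
  · simp [quarterWeight, Set.indicator_of_notMem h]

theorem integrable_quarterWeight_sq (ha : 0 < a) (hab : a ≤ b) :
    Integrable fun ξ => quarterWeight a b ξ ^ 2 := by
  simp only [quarterWeight_sq]
  rw [integrable_indicator_iff (measurableSet_shell a b)]
  refine Measure.integrableOn_of_bounded (M := √b)
    ((volume_shell_le ha hab).trans_lt ENNReal.ofReal_lt_top).ne ?_ ?_
  · exact (by fun_prop : Continuous fun ξ : ℝ => √|2 * Real.pi * ξ|).aestronglyMeasurable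
  · filter_upwards [ae_restrict_mem (measurableSet_shell a b)] with ξ hξ
    rw [Real.norm_of_nonneg (Real.sqrt_nonneg _)]
    exact Real.sqrt_le_sqrt hξ.2.le

theorem memLp_quarterWeight (ha : 0 < a) (hab : a ≤ b) :
    MemLp (fun ξ => (quarterWeight a b ξ : ℂ)) 2 volume := by
  have hm : AEStronglyMeasurable (fun ξ => (quarterWeight a b ξ : ℂ)) volume :=
    (Complex.measurable_ofReal.comp measurable_quarterWeight).aestronglyMeasurable
  rw [memLp_two_iff_integrable_sq_norm hm]
  simpa using integrable_quarterWeight_sq ha hab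

theorem integrable_quarterWeight_mul (ha : 0 < a) (hab : a ≤ b) (hG : MemLp G 2 volume) :
    Integrable fun ξ => (quarterWeight a b ξ : ℂ) * G ξ :=
  (memLp_quarterWeight ha hab).integrable_mul hG

/-- The `T*` half of the argument: the dual of the operator of the endpoint estimate, sampled along
a measurable path `x = X(t)`, maps `L^{4/3}` to `L²`. -/
theorem lintegral_quarterWeight_sq_mul_le (ha : 0 < a) (hab : a ≤ b) {X : ℝ → ℝ}
    (hX : Measurable X) {g : ℝ → ℂ} (hgm : Measurable g) (hg : Integrable g) :
    ∫⁻ ξ, ‖(quarterWeight a b ξ : ℂ) * ∫ t, g t * phase t (X t) ξ‖ₑ ^ (2 : ℝ) ≤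
      48 * (∫⁻ t, ‖g t‖ₑ ^ (4 / 3 : ℝ)) ^ (3 / 2 : ℝ) := by
  set s : ℝ → ℂ := fun ξ => ∫ t, g t * phase t (X t) ξ with hs
  have hphm : Measurable fun z : ℝ × ℝ => phase z.2 (X z.2) z.1 :=
    continuous_phase.measurable.comp (measurable_snd.prodMk
      ((hX.comp measurable_snd).prodMk measurable_fst))
  set Φ : ℝ → ℝ × ℝ → ℂ := fun ξ z => ((quarterWeight a b ξ ^ 2 : ℝ) : ℂ) *
    ((g z.1 * phase z.1 (X z.1) ξ) *
      (starRingEnd ℂ) (g z.2 * phase z.2 (X z.2) ξ)) with hΦ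
  have hΦ' : ∀ ξ z, Φ ξ z = phase (z.1 - z.2) (X z.1 - X z.2) ξ *
      (((quarterWeight a b ξ ^ 2 : ℝ) : ℂ) * (g z.1 * (starRingEnd ℂ) (g z.2))) := by
    intro ξ z
    rw [← phase_mul_conj]
    simp only [hΦ, map_mul]
    ring
  have hΦint : Integrable (Function.uncurry Φ)
      ((volume : Measure ℝ).prod ((volume : Measure ℝ).prod (volume : Measure ℝ))) := by
    have h1 : Integrable (fun z : ℝ × ℝ => g z.1 * (starRingEnd ℂ) (g z.2))
        ((volume : Measure ℝ).prod (volume : Measure ℝ)) :=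
      hg.mul_prod (LinearIsometryEquiv.integrable_comp_iff Complex.conjLIE |>.2 hg)
    have h2 := ((integrable_quarterWeight_sq ha hab).ofReal (𝕜 := ℂ)).mul_prod h1
    have h3 := h2.bdd_mul (c := 1) (f := fun w : ℝ × ℝ × ℝ =>
      phase (w.2.1 - w.2.2) (X w.2.1 - X w.2.2) w.1) ?_ (Eventually.of_forall fun w =>
        (norm_phase _ _ _).le)
    · refine h3.congr (Eventually.of_forall fun w => ?_)
      simp only [Function.uncurry]
      rw [hΦ']
      rfl
    · refine Measurable.aestronglyMeasurable ?_
      refine continuous_phase.measurable.comp (Measurable.prodMk ?_ (Measurable.prodMk ?_ ?_))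
      · fun_prop
      · fun_prop
      · fun_prop
  have hss : ∀ ξ, ∫ z, Φ ξ z ∂((volume : Measure ℝ).prod (volume : Measure ℝ)) =
      ((‖(quarterWeight a b ξ : ℂ) * s ξ‖ ^ 2 : ℝ) : ℂ) := by
    intro ξ
    simp only [hΦ]
    rw [integral_const_mul]
    have := integral_prod_mul (μ := (volume : Measure ℝ)) (ν := (volume : Measure ℝ))
      (fun t => g t * phase t (X t) ξ)
      (fun t => (starRingEnd ℂ) (g t * phase t (X t) ξ))
    rw [this, integral_conj, Complex.mul_conj, Complex.normSq_eq_norm_sq, norm_mul, mul_pow]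
    simp [hs]
  have hswap : ∫ ξ, ((‖(quarterWeight a b ξ : ℂ) * s ξ‖ ^ 2 : ℝ) : ℂ) =
      ∫ z, ∫ ξ, Φ ξ z ∂volume ∂((volume : Measure ℝ).prod (volume : Measure ℝ)) := by
    simp only [← hss]
    exact integral_integral_swap hΦint
  have hsq_int : Integrable fun ξ => ‖(quarterWeight a b ξ : ℂ) * s ξ‖ ^ 2 := by
    have h1 := hΦint.integral_prod_left
    have h2 : Integrable fun ξ => ((‖(quarterWeight a b ξ : ℂ) * s ξ‖ ^ 2 : ℝ) : ℂ) := by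
      refine h1.congr (Eventually.of_forall fun ξ => ?_)
      exact hss ξ
    exact h2.re
  have hinner : ∀ z : ℝ × ℝ, ∫ ξ, Φ ξ z = g z.1 * (starRingEnd ℂ) (g z.2) *
      ∫ ξ in shell a b, phase (z.1 - z.2) (X z.1 - X z.2) ξ * (√|2 * Real.pi * ξ| : ℂ) := by
    intro z
    rw [← integral_const_mul, ← integral_indicator (measurableSet_shell a b)]
    refine integral_congr_ae (Eventually.of_forall fun ξ => ?_)
    simp only [hΦ', quarterWeight_sq]
    by_cases h : ξ ∈ shell a b
    · rw [Set.indicator_of_mem h, Set.indicator_of_mem h]; ring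
    · simp [Set.indicator_of_notMem h]
  have hbound : ∀ᵐ z ∂((volume : Measure ℝ).prod (volume : Measure ℝ)),
      ‖∫ ξ, Φ ξ z‖ₑ ≤ 4 * (‖g z.1‖ₑ * ‖g z.2‖ₑ * rieszKernel (z.1 - z.2)) := by
    have hne : ∀ᵐ z ∂((volume : Measure ℝ).prod (volume : Measure ℝ)), z.1 ≠ z.2 := by
      have hms : MeasurableSet {z : ℝ × ℝ | z.1 ≠ z.2} :=
        (measurableSet_eq_fun measurable_fst measurable_snd).compl
      rw [Measure.ae_prod_iff_ae_ae hms]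
      refine Eventually.of_forall fun t => ?_
      have : ∀ᵐ s : ℝ, s ≠ t := by simp [ae_iff]
      filter_upwards [this] with s hs
      exact Ne.symm hs
    filter_upwards [hne] with z hz
    rw [hinner, enorm_mul, enorm_mul, RCLike.enorm_conj]
    calc _ ≤ ‖g z.1‖ₑ * ‖g z.2‖ₑ * (4 * rieszKernel (z.1 - z.2)) := by
          gcongr
          exact enorm_setIntegral_shell_le _ ha hab (sub_ne_zero.2 hz)
      _ = _ := by ring
  calc ∫⁻ ξ, ‖(quarterWeight a b ξ : ℂ) * s ξ‖ₑ ^ (2 : ℝ)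
      = ∫⁻ ξ, ENNReal.ofReal (‖(quarterWeight a b ξ : ℂ) * s ξ‖ ^ 2) := by
        refine lintegral_congr fun ξ => ?_
        rw [ENNReal.ofReal_pow (norm_nonneg _), ofReal_norm]
        norm_cast
    _ = ENNReal.ofReal (∫ ξ, ‖(quarterWeight a b ξ : ℂ) * s ξ‖ ^ 2) :=
        (ofReal_integral_eq_lintegral_ofReal hsq_int
          (Eventually.of_forall fun ξ => by positivity)).symm
    _ ≤ ‖∫ ξ, ((‖(quarterWeight a b ξ : ℂ) * s ξ‖ ^ 2 : ℝ) : ℂ)‖ₑ := by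
        rw [integral_complex_ofReal, ← ofReal_norm, Complex.norm_real]
        exact ENNReal.ofReal_le_ofReal (le_abs_self _)
    _ ≤ ∫⁻ z, 4 * (‖g z.1‖ₑ * ‖g z.2‖ₑ * rieszKernel (z.1 - z.2))
          ∂((volume : Measure ℝ).prod (volume : Measure ℝ)) := by
        rw [hswap]
        exact (enorm_integral_le_lintegral_enorm _).trans (lintegral_mono_ae hbound)
    _ = 4 * ∫⁻ t, ∫⁻ τ, ‖g t‖ₑ * ‖g τ‖ₑ * rieszKernel (t - τ) := by
        rw [lintegral_const_mul' _ _ (by norm_num), lintegral_prod]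
        exact (((hgm.comp measurable_fst).enorm.mul (hgm.comp measurable_snd).enorm).mul
          (measurable_rieszKernel.comp (measurable_fst.sub measurable_snd))).aemeasurable
    _ ≤ 4 * (12 * (∫⁻ t, ‖g t‖ₑ ^ (4 / 3 : ℝ)) ^ (3 / 2 : ℝ)) := by
        gcongr
        exact lintegral_lintegral_rieszKernel_le hgm.enorm fun t => enorm_ne_top
    _ = _ := by rw [← mul_assoc]; norm_num

set_option maxHeartbeats 1000000 in
/-- The endpoint estimate sampled along a measurable path `x = X(t)`, on a bounded time
interval. -/
theorem setLIntegral_enorm_ev_path_le (ha : 0 < a) (hab : a ≤ b) (hG : MemLp G 2 volume)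
    {X : ℝ → ℝ} (hX : Measurable X) (R : ℝ) :
    ∫⁻ t in Set.Icc (-R) R, ‖ev (fun ξ => (quarterWeight a b ξ : ℂ) * G ξ) t (X t)‖ₑ ^ (4 : ℝ) ≤
      2304 * eLpNorm G 2 volume ^ (4 : ℝ) := by
  set h : ℝ → ℂ := fun ξ => (quarterWeight a b ξ : ℂ) * G ξ with hh
  have hhi : Integrable h := integrable_quarterWeight_mul ha hab hG
  set y : ℝ → ℂ := fun t => ev h t (X t) with hy
  have hym : Measurable y :=
    (continuous_ev hhi).measurable.comp (measurable_id.prodMk hX)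
  set A := ∫ ξ, ‖h ξ‖ with hA
  have hyA : ∀ t, ‖y t‖ ≤ A := fun t => norm_ev_le h t (X t)
  -- the function dual to `y` in `L⁴([-R, R])`
  set g : ℝ → ℂ := (Set.Icc (-R) R).indicator
    (fun t => ((‖y t‖ ^ 2 : ℝ) : ℂ) * (starRingEnd ℂ) (y t)) with hg
  have hgm : Measurable g := by
    refine Measurable.indicator ?_ measurableSet_Icc
    exact (Complex.measurable_ofReal.comp (hym.norm.pow_const 2)).mul
      (Complex.continuous_conj.measurable.comp hym)
  have hgi : Integrable g := by
    rw [hg, integrable_indicator_iff measurableSet_Icc]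
    refine Measure.integrableOn_of_bounded (M := A ^ 3) (by simp) ?_ ?_
    · exact ((Complex.measurable_ofReal.comp (hym.norm.pow_const 2)).mul
        (Complex.continuous_conj.measurable.comp hym)).aestronglyMeasurable
    · refine Eventually.of_forall fun t => ?_
      rw [norm_mul, RCLike.norm_conj, Complex.norm_real, Real.norm_of_nonneg (by positivity),
        ← pow_succ]
      have := hyA t
      gcongr
  have hgn : ∀ t, ‖g t‖ₑ ^ (4 / 3 : ℝ) =
      (Set.Icc (-R) R).indicator (fun t => ‖y t‖ₑ ^ (4 : ℝ)) t := by
    intro t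
    by_cases ht : t ∈ Set.Icc (-R) R
    · rw [hg, Set.indicator_of_mem ht, Set.indicator_of_mem ht, enorm_mul, RCLike.enorm_conj]
      have : ‖((‖y t‖ ^ 2 : ℝ) : ℂ)‖ₑ = ‖y t‖ₑ ^ 2 := by
        rw [← ofReal_norm, Complex.norm_real, Real.norm_of_nonneg (by positivity),
          ENNReal.ofReal_pow (norm_nonneg _), ofReal_norm]
      rw [this, ← pow_succ, ← ENNReal.rpow_natCast, ← ENNReal.rpow_mul]
      norm_num
    · rw [hg, Set.indicator_of_notMem ht, Set.indicator_of_notMem ht]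
      simp
  set Y := ∫⁻ t in Set.Icc (-R) R, ‖y t‖ₑ ^ (4 : ℝ) with hY
  have hgY : ∫⁻ t, ‖g t‖ₑ ^ (4 / 3 : ℝ) = Y := by
    simp only [hgn]
    rw [lintegral_indicator measurableSet_Icc]
  have hYtop : Y ≠ ⊤ := by
    have hle : Y ≤ ∫⁻ t in Set.Icc (-R) R, ENNReal.ofReal (A ^ 4) := by
      refine lintegral_mono fun t => ?_
      rw [ENNReal.ofReal_pow ((norm_nonneg _).trans (hyA t)), ← ENNReal.rpow_natCast]
      push_cast
      gcongr
      rw [← ofReal_norm]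
      exact ENNReal.ofReal_le_ofReal (hyA t)
    refine (hle.trans_lt ?_).ne
    rw [setLIntegral_const]
    exact ENNReal.mul_lt_top ENNReal.ofReal_lt_top (by simp)
  -- `Y = ∫ g y`, and Fubini moves the extension operator onto `g`
  have hpair : Y ≤ ‖∫ t, g t * y t‖ₑ := by
    have e : ∀ t, g t * y t = (((Set.Icc (-R) R).indicator (fun t => ‖y t‖ ^ 4) t : ℝ) : ℂ) := by
      intro t
      by_cases ht : t ∈ Set.Icc (-R) R
      · rw [hg, Set.indicator_of_mem ht, Set.indicator_of_mem ht, mul_assoc,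
          mul_comm ((starRingEnd ℂ) (y t)), Complex.mul_conj, Complex.normSq_eq_norm_sq]
        push_cast; ring
      · rw [hg, Set.indicator_of_notMem ht, Set.indicator_of_notMem ht]; simp
    simp only [e]
    rw [integral_complex_ofReal, ← ofReal_norm, Complex.norm_real,
      Real.norm_of_nonneg
        (integral_nonneg fun t => Set.indicator_nonneg (fun _ _ => by positivity) t),
      integral_indicator measurableSet_Icc, ofReal_integral_eq_lintegral_ofReal]
    · refine le_of_eq (lintegral_congr fun t => ?_)
      rw [ENNReal.ofReal_pow (norm_nonneg _), ofReal_norm]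
      norm_cast
    · refine Measure.integrableOn_of_bounded (M := A ^ 4) (by simp)
        (hym.norm.pow_const 4).aestronglyMeasurable (Eventually.of_forall fun t => ?_)
      rw [Real.norm_of_nonneg (by positivity)]
      have := hyA t
      gcongr
    · exact Eventually.of_forall fun t => by positivity
  have hfub : ∫ t, g t * y t = ∫ ξ, G ξ * ((quarterWeight a b ξ : ℂ) *
      ∫ t, g t * phase t (X t) ξ) := by
    have hint : Integrable (Function.uncurry fun t ξ => g t * (phase t (X t) ξ * h ξ))
        ((volume : Measure ℝ).prod (volume : Measure ℝ)) := by
      have h2 := (hgi.mul_prod hhi).bdd_mul (c := 1) (f := fun w : ℝ × ℝ =>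
        phase w.1 (X w.1) w.2) ?_ (Eventually.of_forall fun w => (norm_phase _ _ _).le)
      · refine h2.congr (Eventually.of_forall fun w => ?_)
        simp only [Function.uncurry]
        ring
      · refine Measurable.aestronglyMeasurable ?_
        exact continuous_phase.measurable.comp (measurable_fst.prodMk
          ((hX.comp measurable_fst).prodMk measurable_snd))
    calc ∫ t, g t * y t = ∫ t, ∫ ξ, g t * (phase t (X t) ξ * h ξ) := by
          refine integral_congr_ae (Eventually.of_forall fun t => ?_)
          simp only [hy, ev]
          rw [integral_const_mul]
      _ = ∫ ξ, ∫ t, g t * (phase t (X t) ξ * h ξ) := integral_integral_swap hint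
      _ = _ := by
          refine integral_congr_ae (Eventually.of_forall fun ξ => ?_)
          simp only [hh]
          rw [← mul_assoc, ← integral_const_mul]
          refine integral_congr_ae (Eventually.of_forall fun t => ?_)
          ring
  have hsm : AEMeasurable (fun ξ => ‖(quarterWeight a b ξ : ℂ) * ∫ t, g t * phase t (X t) ξ‖ₑ)
      volume := by
    refine Measurable.aemeasurable (Measurable.enorm (Measurable.mul
      (Complex.measurable_ofReal.comp measurable_quarterWeight) ?_))
    refine StronglyMeasurable.measurable (StronglyMeasurable.integral_prod_right'
      (f := fun z : ℝ × ℝ => g z.2 * phase z.2 (X z.2) z.1) ?_)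
    refine Measurable.stronglyMeasurable ((hgm.comp measurable_snd).mul ?_)
    exact continuous_phase.measurable.comp (measurable_snd.prodMk
          ((hX.comp measurable_snd).prodMk measurable_fst))
  have hmain : Y ≤ eLpNorm G 2 volume * (48 * Y ^ (3 / 2 : ℝ)) ^ (1 / 2 : ℝ) := by
    calc Y ≤ ∫⁻ ξ, ‖G ξ‖ₑ * ‖(quarterWeight a b ξ : ℂ) * ∫ t, g t * phase t (X t) ξ‖ₑ := by
          refine hpair.trans ?_
          rw [hfub]
          refine (enorm_integral_le_lintegral_enorm _).trans (le_of_eq ?_)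
          simp only [enorm_mul]
      _ ≤ _ := ENNReal.lintegral_mul_le_Lp_mul_Lq volume (p := 2) (q := 2)
          (Real.holderConjugate_iff.2 ⟨by norm_num, by norm_num⟩)
          hG.aestronglyMeasurable.enorm hsm
      _ ≤ _ := by
          gcongr
          · rw [eLpNorm_eq_lintegral_rpow_enorm_toReal (by norm_num) (by norm_num)]
            simp
          · rw [← hgY]
            exact lintegral_quarterWeight_sq_mul_le ha hab hX hgm hgi
  rcases eq_or_ne Y 0 with h0 | h0
  · rw [h0]; exact zero_le
  have h4 : Y ^ (4 : ℝ) ≤ 2304 * eLpNorm G 2 volume ^ (4 : ℝ) * Y ^ (3 : ℝ) := by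
    calc Y ^ (4 : ℝ) ≤ (eLpNorm G 2 volume * (48 * Y ^ (3 / 2 : ℝ)) ^ (1 / 2 : ℝ)) ^ (4 : ℝ) := by
          gcongr
      _ = _ := by
          rw [ENNReal.mul_rpow_of_nonneg _ _ (by norm_num), ← ENNReal.rpow_mul,
            ENNReal.mul_rpow_of_nonneg _ _ (by norm_num), ← ENNReal.rpow_mul]
          norm_num
          ring
  have h5 : Y ^ (4 : ℝ) = Y * Y ^ (3 : ℝ) := by
    nth_rewrite 2 [← ENNReal.rpow_one Y]
    rw [← ENNReal.rpow_add _ _ h0 hYtop]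
    norm_num
  rw [h5] at h4
  exact (ENNReal.mul_le_mul_iff_left (by simp [h0])
    (ENNReal.rpow_ne_top_of_nonneg (by norm_num) hYtop)).1 h4

theorem lintegral_enorm_ev_path_le (ha : 0 < a) (hab : a ≤ b) (hG : MemLp G 2 volume)
    {X : ℝ → ℝ} (hX : Measurable X) :
    ∫⁻ t, ‖ev (fun ξ => (quarterWeight a b ξ : ℂ) * G ξ) t (X t)‖ₑ ^ (4 : ℝ) ≤
      2304 * eLpNorm G 2 volume ^ (4 : ℝ) := by
  have hcov : AECover (volume : Measure ℝ) atTop (fun n : ℕ => Set.Icc (-(n : ℝ)) n) :=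
    aecover_Icc (tendsto_neg_atTop_atBot.comp tendsto_natCast_atTop_atTop)
      tendsto_natCast_atTop_atTop
  have hm : Measurable fun t =>
      ‖ev (fun ξ => (quarterWeight a b ξ : ℂ) * G ξ) t (X t)‖ₑ ^ (4 : ℝ) :=
    ((continuous_ev (integrable_quarterWeight_mul ha hab hG)).measurable.comp
      (measurable_id.prodMk hX)).enorm.pow_const _
  exact le_of_tendsto' (hcov.lintegral_tendsto_of_countably_generated hm.aemeasurable)
    fun n => setLIntegral_enorm_ev_path_le ha hab hG hX n

/-- The endpoint Strichartz estimate `L² → L⁴_t L^∞_x` with the weight `|k|^{1/4}`, uniform in the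
frequency cutoffs. The supremum in `x` is approached along paths maximising over finite sets. -/
theorem mixN_ev_quarterWeight_le (ha : 0 < a) (hab : a ≤ b) (hG : MemLp G 2 volume) :
    mixN 4 ⊤ (fun t x => ‖ev (fun ξ => (quarterWeight a b ξ : ℂ) * G ξ) t x‖ₑ) ≤
      7 * eLpNorm G 2 volume := by
  set u := ev (fun ξ => (quarterWeight a b ξ : ℂ) * G ξ) with hu
  have hc : Continuous fun z : ℝ × ℝ => u z.1 z.2 :=
    continuous_ev (integrable_quarterWeight_mul ha hab hG)
  set d := TopologicalSpace.denseSeq ℝ with hd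
  let X : ℕ → ℝ → ℝ := fun n => Nat.rec (fun _ => d 0)
    (fun n Xn t => if ‖u t (Xn t)‖ₑ ≤ ‖u t (d (n + 1))‖ₑ then d (n + 1) else Xn t) n
  have hXs : ∀ n t, X (n + 1) t =
      if ‖u t (X n t)‖ₑ ≤ ‖u t (d (n + 1))‖ₑ then d (n + 1) else X n t := fun n t => rfl
  have hXm : ∀ n, Measurable (X n) := by
    intro n
    induction n with
    | zero => exact measurable_const
    | succ n ih =>
      refine Measurable.ite (measurableSet_le ?_ ?_) measurable_const ih
      · exact (hc.measurable.comp (measurable_id.prodMk ih)).enorm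
      · exact (hc.measurable.comp (measurable_id.prodMk measurable_const)).enorm
  have hmono : ∀ t, Monotone fun n => ‖u t (X n t)‖ₑ := by
    refine fun t => monotone_nat_of_le_succ fun n => ?_
    simp only [hXs]
    split_ifs with h
    · exact h
    · exact le_rfl
  have hge : ∀ t n, ‖u t (d n)‖ₑ ≤ ‖u t (X n t)‖ₑ := by
    intro t n
    cases n with
    | zero => exact le_rfl
    | succ n =>
      simp only [hXs]
      split_ifs with h
      · exact le_rfl
      · exact (not_le.1 h).le
  have hsup : ∀ t x, ‖u t x‖ₑ ≤ ⨆ n, ‖u t (X n t)‖ₑ := by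
    intro t x
    have hcl : IsClosed {x | ‖u t x‖ₑ ≤ ⨆ n, ‖u t (X n t)‖ₑ} :=
      isClosed_le ((hc.comp (by fun_prop : Continuous fun x : ℝ => (t, x))).enorm)
        continuous_const
    have hsub : Set.range d ⊆ {x | ‖u t x‖ₑ ≤ ⨆ n, ‖u t (X n t)‖ₑ} := by
      rintro _ ⟨n, rfl⟩
      exact (hge t n).trans (le_iSup (fun n => ‖u t (X n t)‖ₑ) n)
    exact hcl.closure_subset_iff.2 hsub (TopologicalSpace.denseRange_denseSeq ℝ x)
  have hmeas : ∀ n, Measurable fun t => ‖u t (X n t)‖ₑ := fun n =>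
    (hc.measurable.comp (measurable_id.prodMk (hXm n))).enorm
  have hpow : ∫⁻ t, (⨆ n, ‖u t (X n t)‖ₑ) ^ (4 : ℝ) ≤ 2304 * eLpNorm G 2 volume ^ (4 : ℝ) := by
    have hlim : Tendsto (fun n => ∫⁻ t, ‖u t (X n t)‖ₑ ^ (4 : ℝ)) atTop
        (𝓝 (∫⁻ t, (⨆ n, ‖u t (X n t)‖ₑ) ^ (4 : ℝ))) := by
      refine lintegral_tendsto_of_tendsto_of_monotone
        (fun n => ((hmeas n).pow_const _).aemeasurable) ?_ ?_
      · refine Eventually.of_forall fun t m n hmn => ?_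
        have := hmono t hmn
        dsimp only at this ⊢
        gcongr
      · refine Eventually.of_forall fun t => ?_
        exact (ENNReal.continuous_rpow_const.tendsto _).comp (tendsto_atTop_iSup (hmono t))
    exact le_of_tendsto' hlim fun n => lintegral_enorm_ev_path_le ha hab hG (hXm n)
  have hslice : ∀ t, eLpNorm (fun x => ‖u t x‖ₑ) ⊤ volume ≤ ⨆ n, ‖u t (X n t)‖ₑ := by
    intro t
    rw [eLpNorm_ennreal_top]
    exact essSup_le_of_ae_le _ (Eventually.of_forall (hsup t))
  calc mixN 4 ⊤ (fun t x => ‖u t x‖ₑ)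
      ≤ eLpNorm (fun t => ⨆ n, ‖u t (X n t)‖ₑ) 4 volume :=
        eLpNorm_ennreal_mono (Eventually.of_forall hslice)
    _ = (∫⁻ t, (⨆ n, ‖u t (X n t)‖ₑ) ^ (4 : ℝ)) ^ (1 / 4 : ℝ) := by
        rw [eLpNorm_ennreal_of_ne_top (by norm_num) (by norm_num)]
        norm_num
    _ ≤ ((7 * eLpNorm G 2 volume) ^ (4 : ℝ)) ^ (1 / 4 : ℝ) := by
        gcongr
        refine hpow.trans ?_
        rw [ENNReal.mul_rpow_of_nonneg _ _ (by norm_num)]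
        gcongr
        norm_cast
    _ = 7 * eLpNorm G 2 volume := by
        rw [← ENNReal.rpow_mul]; norm_num

end Endpoint

/-! ### Fourier transforms of square integrable functions and tempered pairings -/

theorem integral_fourier_L2_mul (F : L2) (ψ : 𝓢(ℝ, ℂ)) :
    ∫ ξ, (𝓕 F : L2) ξ * ψ ξ = ∫ x, F x * (𝓕 ψ) x := by
  have h := congrArg (fun T => T ψ) (Lp.fourier_toTemperedDistribution_eq F)
  simp only [TemperedDistribution.fourier_apply, Lp.toTemperedDistribution_apply] at h
  simp only [smul_eq_mul] at h
  rw [integral_congr_ae (Eventually.of_forall fun ξ => mul_comm ((𝓕 F : L2) ξ) (ψ ξ)), ← h]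
  exact integral_congr_ae (Eventually.of_forall fun ξ => mul_comm _ _)

theorem locallyIntegrable_of_integrable_mul_schwartz {v : ℝ → ℂ}
    (hv : ∀ ψ : 𝓢(ℝ, ℂ), Integrable fun x => v x * ψ x) : LocallyIntegrable v := by
  intro x
  let f : ContDiffBump x := ⟨1, 2, by norm_num, by norm_num⟩
  have h1 : HasCompactSupport fun y => ((f y : ℝ) : ℂ) :=
    f.hasCompactSupport.comp_left (g := fun r : ℝ => (r : ℂ)) (by simp)
  have h2 : ContDiff ℝ (⊤ : ℕ∞) fun y => ((f y : ℝ) : ℂ) :=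
    Complex.ofRealCLM.contDiff.comp f.contDiff
  have h3 := (hv (h1.toSchwartzMap h2)).integrableOn (s := Metric.closedBall x 1)
  refine ⟨Metric.closedBall x 1, Metric.closedBall_mem_nhds x one_pos, ?_⟩
  refine h3.congr_fun (fun y hy => ?_) Metric.isClosed_closedBall.measurableSet
  have : f y = 1 := f.one_of_mem_closedBall hy
  simp [this]

/-- A function is determined, up to a null set, by its integrals against Schwartz functions. -/
theorem ae_eq_of_integral_mul_schwartz_eq {v w : ℝ → ℂ}
    (hv : ∀ ψ : 𝓢(ℝ, ℂ), Integrable fun x => v x * ψ x)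
    (hw : ∀ ψ : 𝓢(ℝ, ℂ), Integrable fun x => w x * ψ x)
    (h : ∀ ψ : 𝓢(ℝ, ℂ), ∫ x, v x * ψ x = ∫ x, w x * ψ x) : v =ᵐ[volume] w := by
  refine ae_eq_of_integral_contDiff_smul_eq (locallyIntegrable_of_integrable_mul_schwartz hv)
    (locallyIntegrable_of_integrable_mul_schwartz hw) fun g hg hgc => ?_
  have h1 : HasCompactSupport fun y => ((g y : ℝ) : ℂ) :=
    hgc.comp_left (g := fun r : ℝ => (r : ℂ)) (by simp)
  have h2 : ContDiff ℝ (⊤ : ℕ∞) fun y => ((g y : ℝ) : ℂ) :=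
    Complex.ofRealCLM.contDiff.comp hg
  have h3 := h (h1.toSchwartzMap h2)
  simpa [mul_comm] using h3

theorem ae_eq_of_integral_mul_fourier_eq {v w : ℝ → ℂ}
    (hv : ∀ ψ : 𝓢(ℝ, ℂ), Integrable fun x => v x * (𝓕 ψ) x)
    (hw : ∀ ψ : 𝓢(ℝ, ℂ), Integrable fun x => w x * (𝓕 ψ) x)
    (h : ∀ ψ : 𝓢(ℝ, ℂ), ∫ x, v x * (𝓕 ψ) x = ∫ x, w x * (𝓕 ψ) x) : v =ᵐ[volume] w := by
  refine ae_eq_of_integral_mul_schwartz_eq (fun ψ => ?_) (fun ψ => ?_) (fun ψ => ?_)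
  · simpa using hv (𝓕⁻ ψ)
  · simpa using hw (𝓕⁻ ψ)
  · simpa using h (𝓕⁻ ψ)

theorem IsFracAirySlice.ae_eq {α : ℝ} {f : L2} {t : ℝ} {v w : ℝ → ℂ}
    (hv : IsFracAirySlice α f t v) (hw : IsFracAirySlice α f t w) : v =ᵐ[volume] w :=
  ae_eq_of_integral_mul_fourier_eq (fun ψ => (hv ψ).1) (fun ψ => (hw ψ).1)
    fun ψ => (hv ψ).2.trans (hw ψ).2.symm

theorem IsFracAiryEvolution.ae_eq {α : ℝ} {f : L2} {t₀ : ℝ} {u v : ℝ → ℝ → ℂ}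
    (hu : IsFracAiryEvolution α f t₀ u) (hv : IsFracAiryEvolution α f t₀ v) :
    ∀ᵐ t : ℝ, u t =ᵐ[volume] v t := by
  filter_upwards [hu.2, hv.2] with t h1 h2
  exact h1.ae_eq h2

/-- The multiplier `e^{itk³}`, `k = 2πξ`, of the Airy group. -/
noncomputable def airyMult (t ξ : ℝ) : ℂ :=
  Complex.exp (Complex.I * (t : ℂ) * ((2 * Real.pi * ξ : ℝ) : ℂ) ^ 3)

theorem phase_zero_eq_airyMult (t ξ : ℝ) : phase t 0 ξ = airyMult t ξ := by
  simp only [phase, airyMult]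
  congr 1
  push_cast
  ring

theorem norm_airyMult (t ξ : ℝ) : ‖airyMult t ξ‖ = 1 := by
  rw [← phase_zero_eq_airyMult, norm_phase]

theorem continuous_airyMult (t : ℝ) : Continuous (airyMult t) := by
  unfold airyMult
  fun_prop

theorem phase_eq_airyMult_mul (t x ξ : ℝ) :
    phase t x ξ = airyMult t ξ * Complex.exp (2 * Real.pi * Complex.I * (x * ξ : ℝ)) := by
  simp only [phase, airyMult, ← Complex.exp_add]
  congr 1
  push_cast
  ring

theorem integrable_ev_mul_schwartz {h : ℝ → ℂ} (hh : Integrable h) (t : ℝ) (ψ : 𝓢(ℝ, ℂ)) :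
    Integrable fun x => ev h t x * ψ x :=
  ψ.integrable.bdd_mul (c := ∫ ξ, ‖h ξ‖)
    ((continuous_ev hh).comp (by fun_prop : Continuous fun x : ℝ => (t, x))).aestronglyMeasurable
    (Eventually.of_forall fun x => norm_ev_le h t x)

/-- The Fourier transform of `ev h t`, as a tempered distribution, is `e^{itk³} h`. -/
theorem integral_ev_mul_fourier {h : ℝ → ℂ} (hh : Integrable h) (t : ℝ) (ψ : 𝓢(ℝ, ℂ)) :
    ∫ x, ev h t x * (𝓕 ψ) x = ∫ ξ, airyMult t ξ * h ξ * ψ ξ := by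
  have hint : Integrable (Function.uncurry fun x ξ => phase t x ξ * h ξ * (𝓕 ψ) x)
      ((volume : Measure ℝ).prod (volume : Measure ℝ)) := by
    have h1 := ((𝓕 ψ).integrable (μ := volume)).mul_prod hh
    have h2 := h1.bdd_mul (c := 1) (f := fun w : ℝ × ℝ => phase t w.1 w.2)
      (continuous_phase.comp (by fun_prop :
        Continuous fun w : ℝ × ℝ => (t, w.1, w.2))).aestronglyMeasurable
      (Eventually.of_forall fun w => (norm_phase _ _ _).le)
    refine h2.congr (Eventually.of_forall fun w => ?_)
    simp only [Function.uncurry]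
    ring
  calc ∫ x, ev h t x * (𝓕 ψ) x = ∫ x, ∫ ξ, phase t x ξ * h ξ * (𝓕 ψ) x := by
        refine integral_congr_ae (Eventually.of_forall fun x => ?_)
        simp only [ev]
        rw [integral_mul_const]
    _ = ∫ ξ, ∫ x, phase t x ξ * h ξ * (𝓕 ψ) x := integral_integral_swap hint
    _ = ∫ ξ, airyMult t ξ * h ξ * ψ ξ := by
        refine integral_congr_ae (Eventually.of_forall fun ξ => ?_)
        have h1 : ψ ξ = (𝓕⁻ (𝓕 ψ)) ξ := by simp
        dsimp only
        rw [h1, SchwartzMap.fourierInv_coe, Real.fourierInv_eq', ← integral_const_mul]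
        refine integral_congr_ae (Eventually.of_forall fun x => ?_)
        simp only [phase_eq_airyMult_mul, smul_eq_mul]
        have : (2 * Real.pi * Complex.I * ((x * ξ : ℝ) : ℂ)) =
            ((2 * Real.pi * inner ℝ x ξ : ℝ) : ℂ) * Complex.I := by
          simp only [RCLike.inner_apply, conj_trivial]
          push_cast; ring
        rw [this]
        ring

/-- Plancherel's theorem for a fixed time. -/
theorem eLpNorm_ev_two_le {h : ℝ → ℂ} (hh : Integrable h) (h2 : MemLp h 2 volume) (t : ℝ) :
    eLpNorm (ev h t) 2 volume ≤ eLpNorm h 2 volume := by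
  have hm : AEStronglyMeasurable (airyMult t) volume :=
    (continuous_airyMult t).aestronglyMeasurable
  have he : MemLp (fun ξ => airyMult t ξ * h ξ) 2 volume := by
    refine h2.of_le (hm.mul h2.1) (Eventually.of_forall fun ξ => ?_)
    simp [norm_airyMult]
  set E : L2 := he.toLp _ with hE
  set V : L2 := 𝓕⁻ E with hV
  have hVE : 𝓕 V = E := by simp [hV]
  have hVev : V =ᵐ[volume] ev h t := by
    refine ae_eq_of_integral_mul_fourier_eq (fun ψ => ?_)
      (fun ψ => integrable_ev_mul_schwartz hh t (𝓕 ψ)) (fun ψ => ?_)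
    · exact (Lp.memLp V).integrable_mul ((𝓕 ψ).memLp 2)
    · rw [← integral_fourier_L2_mul, hVE, integral_ev_mul_fourier hh]
      refine integral_congr_ae ?_
      filter_upwards [he.coeFn_toLp] with ξ hξ
      rw [hξ]
  rw [← eLpNorm_congr_ae hVev]
  have h3 : ‖V‖ₑ = ‖E‖ₑ := by
    rw [← hVE, ← ofReal_norm, ← ofReal_norm, Lp.norm_fourier_eq]
  rw [Lp.enorm_def, Lp.enorm_def] at h3
  rw [h3, hE, eLpNorm_congr_ae he.coeFn_toLp]
  refine eLpNorm_mono fun ξ => ?_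
  simp [norm_airyMult]

/-! ### Bilinear interpolation between the three corners -/

/-- A two-function form of the log-convexity of Lebesgue norms below the exponent `∞`. -/
theorem eLpNorm_rpow_mul_rpow_le {X : Type*} [MeasurableSpace X] {μ : Measure X}
    {f g : X → ℝ≥0∞} (hf : AEMeasurable f μ) (hg : AEMeasurable g μ) {p p₀ : ℝ≥0∞} (hp : p ≠ 0)
    (hp₀ : p₀ ≠ 0) (hp₀' : p₀ ≠ ⊤) {θ θ' : ℝ} (hθ : 0 ≤ θ) (hθ' : 0 ≤ θ')
    (h : θ + θ' = 2 * p₀.toReal * (1 / p).toReal) :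
    eLpNorm (fun x => f x ^ θ * g x ^ θ') (p / 2) μ ≤
      eLpNorm f p₀ μ ^ θ * eLpNorm g p₀ μ ^ θ' := by
  rcases eq_or_ne p ⊤ with rfl | hpt
  · have h0 : θ = 0 := by
      have : θ + θ' = 0 := by simpa using h
      linarith
    have h0' : θ' = 0 := by
      have : θ + θ' = 0 := by simpa using h
      linarith
    subst h0 h0'
    rw [ENNReal.top_div_of_ne_top (by simp), eLpNorm_ennreal_top]
    exact essSup_le_of_ae_le _ (Eventually.of_forall fun x => by simp)
  have hP : 0 < p.toReal := ENNReal.toReal_pos hp hpt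
  have hP₀ : 0 < p₀.toReal := ENNReal.toReal_pos hp₀ hp₀'
  have h20 : p / 2 ≠ 0 := by simp [hp]
  have h2t : p / 2 ≠ ⊤ := ENNReal.div_ne_top hpt (by simp)
  have h2 : (p / 2).toReal = p.toReal / 2 := by simp [ENNReal.toReal_div]
  have hinv : (1 / p).toReal = 1 / p.toReal := by simp
  rw [hinv] at h
  rw [eLpNorm_ennreal_of_ne_top h20 h2t, eLpNorm_ennreal_of_ne_top hp₀ hp₀',
    eLpNorm_ennreal_of_ne_top hp₀ hp₀', h2]
  set P := p.toReal
  set P₀ := p₀.toReal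
  have key := ENNReal.lintegral_mul_norm_pow_le (μ := μ) (hf.pow_const P₀) (hg.pow_const P₀)
    (p := θ * P / (2 * P₀)) (q := θ' * P / (2 * P₀)) (by positivity) (by positivity) (by
      rw [← add_div, ← add_mul, h]; field_simp)
  have e : ∀ (a : ℝ≥0∞) (s : ℝ), (a ^ P₀) ^ (s * P / (2 * P₀)) = (a ^ s) ^ (P / 2) := fun a s => by
    rw [← ENNReal.rpow_mul, ← ENNReal.rpow_mul]; congr 1; field_simp
  have e2 : ∀ x, (f x ^ P₀) ^ (θ * P / (2 * P₀)) * (g x ^ P₀) ^ (θ' * P / (2 * P₀)) =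
      (f x ^ θ * g x ^ θ') ^ (P / 2) := fun x => by
    rw [e, e, ENNReal.mul_rpow_of_nonneg _ _ (by positivity)]
  simp only [e2] at key
  calc (∫⁻ x, (f x ^ θ * g x ^ θ') ^ (P / 2) ∂μ) ^ (1 / (P / 2))
      ≤ ((∫⁻ x, f x ^ P₀ ∂μ) ^ (θ * P / (2 * P₀)) *
          (∫⁻ x, g x ^ P₀ ∂μ) ^ (θ' * P / (2 * P₀))) ^ (1 / (P / 2)) := by gcongr
    _ = _ := by
      rw [ENNReal.mul_rpow_of_nonneg _ _ (by positivity), ← ENNReal.rpow_mul, ← ENNReal.rpow_mul,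
        ← ENNReal.rpow_mul, ← ENNReal.rpow_mul]
      congr 2 <;> field_simp

/-- Bounds for a function of `(t, x)` in the spaces `L^∞_{t,x}`, `L^∞_t L²_x` and `L⁴_t L^∞_x` at
the three corners of the region of admissible exponents. -/
structure CornerBounds (f : ℝ → ℝ → ℝ≥0∞) (A B C : ℝ≥0∞) : Prop where
  aem : AEM f
  le_top : ∀ t x, f t x ≤ A
  two_le : ∀ t, eLpNorm (f t) 2 volume ≤ B
  four_top_le : mixN 4 ⊤ f ≤ C

theorem CornerBounds.mixN_mul_le {f g : ℝ → ℝ → ℝ≥0∞} {A B C A' B' C' : ℝ≥0∞}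
    (hf : CornerBounds f A B C) (hg : CornerBounds g A' B' C') (hA : A ≠ ⊤) (hB : B ≠ ⊤)
    (hA' : A' ≠ ⊤) (hB' : B' ≠ ⊤)
    {q r : ℝ≥0∞} (hq : q ≠ 0) (hr : r ≠ 0) {a b c a' b' c' : ℝ} (ha : 0 ≤ a) (hb : 0 ≤ b)
    (hc : 0 ≤ c) (ha' : 0 ≤ a') (hb' : 0 ≤ b') (hc' : 0 ≤ c') (habc : a + b + c = 1)
    (habc' : a' + b' + c' = 1) (hbr : b + b' = 4 * (1 / r).toReal)
    (hcq : c + c' = 8 * (1 / q).toReal) :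
    mixN (q / 2) (r / 2) (fun t x => f t x * g t x) ≤
      (A ^ a * B ^ b * C ^ c) * (A' ^ a' * B' ^ b' * C' ^ c') := by
  set S : ℝ → ℝ≥0∞ := fun t => eLpNorm (f t) ⊤ volume with hS
  set S' : ℝ → ℝ≥0∞ := fun t => eLpNorm (g t) ⊤ volume with hS'
  have hSA : ∀ t, S t ≤ A := fun t => by
    rw [hS]; simp only [eLpNorm_ennreal_top]
    exact essSup_le_of_ae_le _ (Eventually.of_forall (hf.le_top t))
  have hSA' : ∀ t, S' t ≤ A' := fun t => by
    rw [hS']; simp only [eLpNorm_ennreal_top]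
    exact essSup_le_of_ae_le _ (Eventually.of_forall (hg.le_top t))
  have e1 : ∀ z : ℝ≥0∞, z = z ^ (a + c) * z ^ b := fun z => by
    rw [← ENNReal.rpow_add_of_nonneg _ _ (by positivity) hb,
      show a + c + b = 1 by linarith, ENNReal.rpow_one]
  have e1' : ∀ z : ℝ≥0∞, z = z ^ (a' + c') * z ^ b' := fun z => by
    rw [← ENNReal.rpow_add_of_nonneg _ _ (by positivity) hb',
      show a' + c' + b' = 1 by linarith, ENNReal.rpow_one]
  have hinner : ∀ᵐ t : ℝ, eLpNorm (fun x => f t x * g t x) (r / 2) volume ≤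
      (A ^ a * A' ^ a' * (B ^ b * B' ^ b')) * (S t ^ c * S' t ^ c') := by
    filter_upwards [hf.aem.slice, hg.aem.slice] with t hft hgt
    have hSt : S t ≠ ⊤ := ((hSA t).trans_lt hA.lt_top).ne
    have hSt' : S' t ≠ ⊤ := ((hSA' t).trans_lt hA'.lt_top).ne
    have hconst : S t ^ (a + c) * S' t ^ (a' + c') ≠ ⊤ :=
      ENNReal.mul_ne_top (ENNReal.rpow_ne_top_of_nonneg (by positivity) hSt)
        (ENNReal.rpow_ne_top_of_nonneg (by positivity) hSt')
    calc eLpNorm (fun x => f t x * g t x) (r / 2) volume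
        ≤ eLpNorm (fun x => (S t ^ (a + c) * S' t ^ (a' + c')) * (f t x ^ b * g t x ^ b'))
            (r / 2) volume := by
          refine eLpNorm_ennreal_mono ?_
          have h1 : ∀ᵐ x : ℝ, f t x ≤ S t := by
            simp only [hS, eLpNorm_ennreal_top]; exact ENNReal.ae_le_essSup _
          have h2 : ∀ᵐ x : ℝ, g t x ≤ S' t := by
            simp only [hS', eLpNorm_ennreal_top]; exact ENNReal.ae_le_essSup _
          filter_upwards [h1, h2] with x hx hx'
          calc f t x * g t x
              = (f t x ^ (a + c) * f t x ^ b) * (g t x ^ (a' + c') * g t x ^ b') := by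
                rw [← e1, ← e1']
            _ = (f t x ^ (a + c) * g t x ^ (a' + c')) * (f t x ^ b * g t x ^ b') := by ring
            _ ≤ _ := by gcongr
      _ = (S t ^ (a + c) * S' t ^ (a' + c')) *
            eLpNorm (fun x => f t x ^ b * g t x ^ b') (r / 2) volume :=
          eLpNorm_ennreal_const_mul hconst _
      _ ≤ (S t ^ (a + c) * S' t ^ (a' + c')) * (B ^ b * B' ^ b') := by
          gcongr
          refine (eLpNorm_rpow_mul_rpow_le hft hgt hr (p₀ := 2) (by norm_num) (by norm_num) hb hb'
            ?_).trans ?_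
          · rw [hbr]; norm_num
          · have := hf.two_le t
            have := hg.two_le t
            gcongr
      _ = (S t ^ a * S' t ^ a' * (B ^ b * B' ^ b')) * (S t ^ c * S' t ^ c') := by
          rw [ENNReal.rpow_add_of_nonneg _ _ ha hc, ENNReal.rpow_add_of_nonneg _ _ ha' hc']
          ring
      _ ≤ _ := by
          have := hSA t
          have := hSA' t
          gcongr
  have hK : A ^ a * A' ^ a' * (B ^ b * B' ^ b') ≠ ⊤ := by
    refine ENNReal.mul_ne_top (ENNReal.mul_ne_top ?_ ?_) (ENNReal.mul_ne_top ?_ ?_) <;>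
      exact ENNReal.rpow_ne_top_of_nonneg (by assumption) (by assumption)
  calc mixN (q / 2) (r / 2) (fun t x => f t x * g t x)
      ≤ eLpNorm (fun t => (A ^ a * A' ^ a' * (B ^ b * B' ^ b')) * (S t ^ c * S' t ^ c'))
          (q / 2) volume := eLpNorm_ennreal_mono hinner
    _ = (A ^ a * A' ^ a' * (B ^ b * B' ^ b')) *
          eLpNorm (fun t => S t ^ c * S' t ^ c') (q / 2) volume := eLpNorm_ennreal_const_mul hK _
    _ ≤ (A ^ a * A' ^ a' * (B ^ b * B' ^ b')) * (C ^ c * C' ^ c') := by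
        gcongr
        refine (eLpNorm_rpow_mul_rpow_le (hf.aem.eLpNorm_slice ⊤) (hg.aem.eLpNorm_slice ⊤) hq
          (p₀ := 4) (by norm_num) (by norm_num) hc hc' ?_).trans ?_
        · rw [hcq]; norm_num
        · have := hf.four_top_le
          have := hg.four_top_le
          simp only [mixN] at *
          gcongr
    _ = _ := by ring

/-! ### Frequency bands -/

/-- The frequency density `|k|^α H`, `k = 2πξ`, restricted to the annulus `a ≤ |k| < b`. -/
noncomputable def band (α a b : ℝ) (H : ℝ → ℂ) : ℝ → ℂ :=
  (shell a b).indicator fun ξ => ((|2 * Real.pi * ξ| ^ α : ℝ) : ℂ) * H ξ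

theorem band_eq_mul_indicator (α a b : ℝ) (H : ℝ → ℂ) (ξ : ℝ) :
    band α a b H ξ = (((shell a b).indicator (fun ξ => |2 * Real.pi * ξ| ^ α) ξ : ℝ) : ℂ) *
      (shell a b).indicator H ξ := by
  by_cases h : ξ ∈ shell a b
  · simp [band, h]
  · simp [band, h]

theorem norm_band_le {α a b m : ℝ} (hm : ∀ ξ ∈ shell a b, |2 * Real.pi * ξ| ^ α ≤ m)
    (H : ℝ → ℂ) (ξ : ℝ) : ‖band α a b H ξ‖ ≤ m * ‖(shell a b).indicator H ξ‖ := by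
  by_cases h : ξ ∈ shell a b
  · rw [band, Set.indicator_of_mem h, Set.indicator_of_mem h, norm_mul, Complex.norm_real,
      Real.norm_of_nonneg (by positivity)]
    have := hm ξ h
    gcongr
  · simp [band, h]

theorem memLp_indicator_shell {H : ℝ → ℂ} (hH : MemLp H 2 volume) (a b : ℝ) :
    MemLp ((shell a b).indicator H) 2 volume := hH.indicator (measurableSet_shell a b)

theorem aestronglyMeasurable_band {H : ℝ → ℂ} (hH : MemLp H 2 volume) (α a b : ℝ) :
    AEStronglyMeasurable (band α a b H) volume := by
  refine AEStronglyMeasurable.indicator (AEStronglyMeasurable.mul ?_ hH.1) (measurableSet_shell a b)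
  exact (by fun_prop : Measurable fun ξ : ℝ =>
    ((|2 * Real.pi * ξ| ^ α : ℝ) : ℂ)).aestronglyMeasurable

theorem eLpNorm_band_le {α a b m : ℝ} (hm : ∀ ξ ∈ shell a b, |2 * Real.pi * ξ| ^ α ≤ m)
    (H : ℝ → ℂ) :
    eLpNorm (band α a b H) 2 volume ≤
      ENNReal.ofReal m * eLpNorm ((shell a b).indicator H) 2 volume :=
  eLpNorm_le_mul_eLpNorm_of_ae_le_mul (Eventually.of_forall (norm_band_le hm H)) 2

theorem exists_weight_bound {a b : ℝ} (ha : 0 < a) (α : ℝ) :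
    ∃ m : ℝ, 0 ≤ m ∧ ∀ ξ ∈ shell a b, |2 * Real.pi * ξ| ^ α ≤ m := by
  refine ⟨a ^ α + |b| ^ α, by positivity, fun ξ hξ => ?_⟩
  have h0 : 0 < |2 * Real.pi * ξ| := ha.trans_le hξ.1
  have hb : |2 * Real.pi * ξ| ≤ |b| := hξ.2.le.trans (le_abs_self b)
  rcases le_total 0 α with h | h
  · have := Real.rpow_le_rpow h0.le hb h
    have : 0 ≤ a ^ α := by positivity
    linarith
  · have := Real.rpow_le_rpow_of_nonpos ha hξ.1 h
    have : 0 ≤ |b| ^ α := by positivity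
    linarith

theorem memLp_band {a : ℝ} (ha : 0 < a) {H : ℝ → ℂ} (hH : MemLp H 2 volume) (α b : ℝ) :
    MemLp (band α a b H) 2 volume := by
  obtain ⟨m, -, hm⟩ := exists_weight_bound (b := b) ha α
  refine ⟨aestronglyMeasurable_band hH α a b, (eLpNorm_band_le hm H).trans_lt ?_⟩
  exact ENNReal.mul_lt_top ENNReal.ofReal_lt_top (memLp_indicator_shell hH a b).2

/-- Cauchy–Schwarz on the annulus. -/
theorem lintegral_enorm_band_le {α a b m : ℝ} (ha : 0 < a) (hab : a ≤ b)
    (hm : ∀ ξ ∈ shell a b, |2 * Real.pi * ξ| ^ α ≤ m) {H : ℝ → ℂ} (hH : MemLp H 2 volume) :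
    ∫⁻ ξ, ‖band α a b H ξ‖ₑ ≤
      ENNReal.ofReal b ^ (1 / 2 : ℝ) *
        (ENNReal.ofReal m * eLpNorm ((shell a b).indicator H) 2 volume) := by
  have e : ∀ ξ, ‖band α a b H ξ‖ₑ = (shell a b).indicator 1 ξ * ‖band α a b H ξ‖ₑ := by
    intro ξ
    by_cases h : ξ ∈ shell a b
    · simp [h]
    · simp [band, h]
  have h1 := ENNReal.lintegral_mul_le_Lp_mul_Lq volume (p := 2) (q := 2)
    (Real.holderConjugate_iff.2 ⟨by norm_num, by norm_num⟩)
    (f := (shell a b).indicator 1) (g := fun ξ => ‖band α a b H ξ‖ₑ)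
    (measurable_one.indicator (measurableSet_shell a b)).aemeasurable
    (aestronglyMeasurable_band hH α a b).enorm
  calc ∫⁻ ξ, ‖band α a b H ξ‖ₑ = ∫⁻ ξ, (shell a b).indicator 1 ξ * ‖band α a b H ξ‖ₑ :=
        lintegral_congr e
    _ ≤ _ := h1
    _ ≤ _ := by
        gcongr
        · have e2 : ∀ ξ, (shell a b).indicator (1 : ℝ → ℝ≥0∞) ξ ^ (2 : ℝ) =
              (shell a b).indicator 1 ξ := fun ξ => by
            by_cases h : ξ ∈ shell a b <;> simp [h]
          simp only [e2]
          rw [lintegral_indicator_one (measurableSet_shell a b)]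
          exact volume_shell_le ha hab
        · have := eLpNorm_band_le hm H
          rw [eLpNorm_eq_lintegral_rpow_enorm_toReal (by norm_num) (by norm_num)] at this
          simpa using this

theorem integrable_band {a b : ℝ} (ha : 0 < a) (hab : a ≤ b) {H : ℝ → ℂ} (hH : MemLp H 2 volume)
    (α : ℝ) : Integrable (band α a b H) := by
  obtain ⟨m, -, hm⟩ := exists_weight_bound (b := b) ha α
  refine ⟨aestronglyMeasurable_band hH α a b, (lintegral_enorm_band_le ha hab hm hH).trans_lt ?_⟩
  exact ENNReal.mul_lt_top (ENNReal.rpow_lt_top_of_nonneg (by norm_num) (by simp))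
    (ENNReal.mul_lt_top ENNReal.ofReal_lt_top (memLp_indicator_shell hH a b).2)

theorem enorm_ev_le (h : ℝ → ℂ) (t x : ℝ) : ‖ev h t x‖ₑ ≤ ∫⁻ ξ, ‖h ξ‖ₑ := by
  refine (enorm_integral_le_lintegral_enorm _).trans (le_of_eq (lintegral_congr fun ξ => ?_))
  rw [enorm_mul, ← ofReal_norm (phase t x ξ), norm_phase]
  simp

theorem cornerBounds_ev_band {α a b m m' : ℝ} (ha : 0 < a) (hab : a ≤ b)
    (hm : ∀ ξ ∈ shell a b, |2 * Real.pi * ξ| ^ α ≤ m)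
    (hm' : ∀ ξ ∈ shell a b, |2 * Real.pi * ξ| ^ (α - 1 / 4) ≤ m')
    {H : ℝ → ℂ} (hH : MemLp H 2 volume) :
    CornerBounds (fun t x => ‖ev (band α a b H) t x‖ₑ)
      (ENNReal.ofReal b ^ (1 / 2 : ℝ) *
        (ENNReal.ofReal m * eLpNorm ((shell a b).indicator H) 2 volume))
      (ENNReal.ofReal m * eLpNorm ((shell a b).indicator H) 2 volume)
      (7 * (ENNReal.ofReal m' * eLpNorm ((shell a b).indicator H) 2 volume)) where
  aem := aem_ev (integrable_band ha hab hH α)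
  le_top t x := (enorm_ev_le _ t x).trans (lintegral_enorm_band_le ha hab hm hH)
  two_le t := by
    rw [eLpNorm_enorm]
    exact (eLpNorm_ev_two_le (integrable_band ha hab hH α) (memLp_band ha hH α b) t).trans
      (eLpNorm_band_le hm H)
  four_top_le := by
    have e : band α a b H = fun ξ => (quarterWeight a b ξ : ℂ) * band (α - 1 / 4) a b H ξ := by
      funext ξ
      by_cases h : ξ ∈ shell a b
      · have h0 : 0 < |2 * Real.pi * ξ| := ha.trans_le h.1
        rw [band, quarterWeight, band, Set.indicator_of_mem h, Set.indicator_of_mem h,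
          Set.indicator_of_mem h, ← mul_assoc, ← Complex.ofReal_mul, ← Real.rpow_add h0]
        congr 3
        ring
      · simp [band, h]
    rw [e]
    refine (mixN_ev_quarterWeight_le ha hab (memLp_band ha hH _ b)).trans ?_
    gcongr
    exact eLpNorm_band_le hm' H

/-! ### Dyadic decomposition -/

theorem indicator_shell_add {M : Type*} [AddZeroClass M] {a b c : ℝ} (hab : a ≤ b) (hbc : b ≤ c)
    (f : ℝ → M) (ξ : ℝ) :
    (shell a c).indicator f ξ = (shell a b).indicator f ξ + (shell b c).indicator f ξ := by
  rcases lt_or_ge |2 * Real.pi * ξ| b with h | h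
  · rw [Set.indicator_of_notMem (s := shell b c) (fun h' => absurd h'.1 (not_le.2 h)), add_zero]
    have : ξ ∈ shell a c ↔ ξ ∈ shell a b :=
      ⟨fun h' => ⟨h'.1, h⟩, fun h' => ⟨h'.1, h'.2.trans_le hbc⟩⟩
    by_cases h' : ξ ∈ shell a b
    · rw [Set.indicator_of_mem h', Set.indicator_of_mem (this.2 h')]
    · rw [Set.indicator_of_notMem h', Set.indicator_of_notMem (this.not.2 h')]
  · rw [Set.indicator_of_notMem (s := shell a b) (fun h' => absurd h'.2 (not_lt.2 h)), zero_add]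
    have : ξ ∈ shell a c ↔ ξ ∈ shell b c :=
      ⟨fun h' => ⟨h, h'.2⟩, fun h' => ⟨hab.trans h, h'.2⟩⟩
    by_cases h' : ξ ∈ shell b c
    · rw [Set.indicator_of_mem h', Set.indicator_of_mem (this.2 h')]
    · rw [Set.indicator_of_notMem h', Set.indicator_of_notMem (this.not.2 h')]

theorem indicator_shell_eq_sum {M : Type*} [AddCommMonoid M] {a : ℝ} (ha : 0 < a) (n : ℕ)
    (f : ℝ → M) (ξ : ℝ) :
    (shell a (a * 2 ^ n)).indicator f ξ =
      ∑ i ∈ Finset.range n, (shell (a * 2 ^ i) (a * 2 ^ (i + 1))).indicator f ξ := by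
  induction n with
  | zero =>
    have : ξ ∉ shell a (a * 2 ^ 0) := fun h => by
      have := h.1.trans_lt h.2
      simp at this
    rw [Set.indicator_of_notMem this]
    simp
  | succ n ih =>
    rw [Finset.sum_range_succ, ← ih]
    refine indicator_shell_add ?_ ?_ f ξ
    · exact le_mul_of_one_le_right ha.le (one_le_pow₀ (by norm_num))
    · gcongr <;> simp

theorem ev_band_eq_sum {α a : ℝ} (ha : 0 < a) (n : ℕ) {H : ℝ → ℂ} (hH : MemLp H 2 volume)
    (t x : ℝ) : ev (band α a (a * 2 ^ n) H) t x =
      ∑ i ∈ Finset.range n, ev (band α (a * 2 ^ i) (a * 2 ^ (i + 1)) H) t x := by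
  simp only [ev]
  rw [← integral_finsetSum]
  · refine integral_congr_ae (Eventually.of_forall fun ξ => ?_)
    simp only [band]
    rw [indicator_shell_eq_sum ha, Finset.mul_sum]
  · intro i _
    refine integrable_phase_mul (integrable_band (by positivity) ?_ hH α) t x
    gcongr <;> simp

theorem eLpNorm_two_sq_eq_lintegral (f : ℝ → ℂ) :
    eLpNorm f 2 volume ^ 2 = ∫⁻ x, ‖f x‖ₑ ^ 2 := by
  rw [eLpNorm_eq_lintegral_rpow_enorm_toReal (by norm_num) (by norm_num), ← ENNReal.rpow_natCast,
    ← ENNReal.rpow_mul]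
  norm_num

theorem sum_eLpNorm_indicator_shell_sq {a : ℝ} (ha : 0 < a) (n : ℕ) {H : ℝ → ℂ}
    (hH : MemLp H 2 volume) :
    ∑ i ∈ Finset.range n,
        eLpNorm ((shell (a * 2 ^ i) (a * 2 ^ (i + 1))).indicator H) 2 volume ^ 2 =
      eLpNorm ((shell a (a * 2 ^ n)).indicator H) 2 volume ^ 2 := by
  have e : ∀ s : Set ℝ, (fun x => ‖s.indicator H x‖ₑ ^ 2) =
      s.indicator fun x => ‖H x‖ₑ ^ 2 := fun s => by
    funext x
    by_cases h : x ∈ s <;> simp [h]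
  simp only [eLpNorm_two_sq_eq_lintegral, e]
  rw [← lintegral_finsetSum']
  · exact lintegral_congr fun ξ => (indicator_shell_eq_sum ha n _ ξ).symm
  · intro i _
    exact (hH.1.enorm.pow_const 2).indicator (measurableSet_shell _ _)

theorem rpow_le_of_mem_shell_dyadic {D β ξ : ℝ} (hD : 0 < D) (h : ξ ∈ shell D (D * 2)) :
    |2 * Real.pi * ξ| ^ β ≤ 2 ^ |β| * D ^ β := by
  have h0 : 0 < |2 * Real.pi * ξ| := hD.trans_le h.1
  rcases le_total 0 β with hβ | hβ
  · calc |2 * Real.pi * ξ| ^ β ≤ (D * 2) ^ β := by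
          have := h.2.le
          gcongr
      _ = 2 ^ |β| * D ^ β := by
          rw [Real.mul_rpow hD.le (by norm_num), abs_of_nonneg hβ, mul_comm]
  · calc |2 * Real.pi * ξ| ^ β ≤ D ^ β := Real.rpow_le_rpow_of_nonpos hD h.1 hβ
      _ ≤ 2 ^ |β| * D ^ β :=
          le_mul_of_one_le_left (by positivity) (Real.one_le_rpow (by norm_num) (abs_nonneg _))

theorem CornerBounds.mono {f : ℝ → ℝ → ℝ≥0∞} {A B C A' B' C' : ℝ≥0∞} (h : CornerBounds f A B C)
    (hA : A ≤ A') (hB : B ≤ B') (hC : C ≤ C') : CornerBounds f A' B' C' where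
  aem := h.aem
  le_top t x := (h.le_top t x).trans hA
  two_le t := (h.two_le t).trans hB
  four_top_le := h.four_top_le.trans hC

/-- Scale-invariant form of the corner bounds for one dyadic band `D ≤ |k| < 2D`. -/
theorem cornerBounds_ev_dyadic (α : ℝ) {D : ℝ} (hD : 0 < D) {H : ℝ → ℂ}
    (hH : MemLp H 2 volume) :
    CornerBounds (fun t x => ‖ev (band α D (D * 2) H) t x‖ₑ)
      (ENNReal.ofReal (14 * 2 ^ |α|) * ENNReal.ofReal D ^ (α + 1 / 2) *
        eLpNorm ((shell D (D * 2)).indicator H) 2 volume)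
      (ENNReal.ofReal (14 * 2 ^ |α|) * ENNReal.ofReal D ^ α *
        eLpNorm ((shell D (D * 2)).indicator H) 2 volume)
      (ENNReal.ofReal (14 * 2 ^ |α|) * ENNReal.ofReal D ^ (α - 1 / 4) *
        eLpNorm ((shell D (D * 2)).indicator H) 2 volume) := by
  have h2 : (0 : ℝ) < 2 ^ |α| := by positivity
  refine (cornerBounds_ev_band hD (by linarith) (fun ξ hξ => rpow_le_of_mem_shell_dyadic hD hξ)
    (fun ξ hξ => rpow_le_of_mem_shell_dyadic hD hξ) hH).mono ?_ ?_ ?_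
  · rw [← mul_assoc]
    refine mul_le_mul' ?_ le_rfl
    rw [ENNReal.ofReal_rpow_of_pos hD, ENNReal.ofReal_rpow_of_pos (by positivity),
      ← ENNReal.ofReal_mul (by positivity), ← ENNReal.ofReal_mul (by positivity)]
    refine ENNReal.ofReal_le_ofReal ?_
    rw [Real.rpow_add hD, Real.mul_rpow hD.le (by norm_num)]
    have h3 : (2 : ℝ) ^ (1 / 2 : ℝ) ≤ 14 := by
      calc (2 : ℝ) ^ (1 / 2 : ℝ) ≤ 2 ^ (1 : ℝ) :=
            Real.rpow_le_rpow_of_exponent_le (by norm_num) (by norm_num)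
        _ ≤ 14 := by norm_num
    calc D ^ (1 / 2 : ℝ) * 2 ^ (1 / 2 : ℝ) * (2 ^ |α| * D ^ α)
        ≤ D ^ (1 / 2 : ℝ) * 14 * (2 ^ |α| * D ^ α) := by gcongr
      _ = _ := by ring
  · refine mul_le_mul' ?_ le_rfl
    rw [ENNReal.ofReal_rpow_of_pos hD, ← ENNReal.ofReal_mul (by positivity)]
    refine ENNReal.ofReal_le_ofReal ?_
    gcongr
    linarith
  · rw [← mul_assoc]
    refine mul_le_mul' ?_ le_rfl
    rw [ENNReal.ofReal_rpow_of_pos hD, ← ENNReal.ofReal_mul (by positivity),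
      show (7 : ℝ≥0∞) = ENNReal.ofReal 7 by simp, ← ENNReal.ofReal_mul (by positivity)]
    refine ENNReal.ofReal_le_ofReal ?_
    rw [← mul_assoc]
    refine mul_le_mul_of_nonneg_right ?_ (by positivity)
    calc 7 * (2 : ℝ) ^ |α - 1 / 4| ≤ 7 * 2 ^ (|α| + 1) := by
          gcongr
          · norm_num
          · refine (abs_sub _ _).trans ?_
            rw [abs_of_pos (by norm_num : (0 : ℝ) < 1 / 4)]
            linarith
      _ = 14 * 2 ^ |α| := by rw [Real.rpow_add (by norm_num), Real.rpow_one]; ring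

/-! ### Strichartz estimates -/

theorem sum_range_pow_dist_le {ρ : ℝ≥0∞} (n i : ℕ) :
    ∑ j ∈ Finset.range n, ρ ^ ((i - j) + (j - i)) ≤ 2 * (1 - ρ)⁻¹ := by
  have h1 : ∑ j ∈ Finset.range i, ρ ^ ((i - j) + (j - i)) ≤ (1 - ρ)⁻¹ := by
    rw [← ENNReal.tsum_geometric, ← Finset.sum_range_reflect]
    calc _ = ∑ j ∈ Finset.range i, ρ ^ (j + 1) := by
          refine Finset.sum_congr rfl fun j hj => ?_
          congr 1
          have := Finset.mem_range.1 hj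
          omega
      _ ≤ ∑ j ∈ Finset.range (i + 1), ρ ^ j := by
          rw [Finset.sum_range_succ']
          exact le_self_add
      _ ≤ _ := ENNReal.sum_le_tsum _
  have h2 : ∑ j ∈ Finset.range n, ρ ^ ((i - (i + j)) + (i + j - i)) ≤ (1 - ρ)⁻¹ := by
    rw [← ENNReal.tsum_geometric]
    refine le_trans (le_of_eq (Finset.sum_congr rfl fun j _ => ?_)) (ENNReal.sum_le_tsum _)
    congr 1
    omega
  calc _ ≤ ∑ j ∈ Finset.range (i + n), ρ ^ ((i - j) + (j - i)) :=
        Finset.sum_le_sum_of_subset (Finset.range_mono (by omega))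
    _ = _ := Finset.sum_range_add _ _ _
    _ ≤ _ := by rw [two_mul]; exact add_le_add h1 h2

/-- Schur's test for a kernel decaying geometrically off the diagonal. -/
theorem sum_sum_pow_dist_mul_le {ρ : ℝ≥0∞} (n : ℕ) (φ : ℕ → ℝ≥0∞) :
    ∑ i ∈ Finset.range n, ∑ j ∈ Finset.range n, ρ ^ ((i - j) + (j - i)) * (φ i * φ j) ≤
      4 * (1 - ρ)⁻¹ * ∑ i ∈ Finset.range n, φ i ^ 2 := by
  have hle : ∀ x y : ℝ≥0∞, x * y ≤ x ^ 2 + y ^ 2 := fun x y => by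
    rcases le_total x y with h | h
    · exact le_add_left (by rw [sq]; gcongr)
    · exact le_add_right (by rw [sq]; gcongr)
  have hrow : ∑ i ∈ Finset.range n, ∑ j ∈ Finset.range n, ρ ^ ((i - j) + (j - i)) * φ i ^ 2 ≤
      2 * (1 - ρ)⁻¹ * ∑ i ∈ Finset.range n, φ i ^ 2 := by
    rw [Finset.mul_sum]
    refine Finset.sum_le_sum fun i _ => ?_
    rw [← Finset.sum_mul]
    gcongr
    exact sum_range_pow_dist_le n i
  calc _ ≤ ∑ i ∈ Finset.range n, ∑ j ∈ Finset.range n,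
        (ρ ^ ((i - j) + (j - i)) * φ i ^ 2 + ρ ^ ((i - j) + (j - i)) * φ j ^ 2) := by
        refine Finset.sum_le_sum fun i _ => Finset.sum_le_sum fun j _ => ?_
        rw [← mul_add]
        gcongr
        exact hle _ _
    _ = ∑ i ∈ Finset.range n, ∑ j ∈ Finset.range n, ρ ^ ((i - j) + (j - i)) * φ i ^ 2 +
        ∑ i ∈ Finset.range n, ∑ j ∈ Finset.range n, ρ ^ ((i - j) + (j - i)) * φ i ^ 2 := by
        simp only [Finset.sum_add_distrib]
        congr 1
        rw [Finset.sum_comm]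
        simp only [add_comm]
    _ ≤ _ := by
        refine (add_le_add hrow hrow).trans (le_of_eq ?_)
        ring

theorem mixN_sum_sq_le {q r : ℝ≥0∞} (hq : 1 ≤ q / 2) (hr : 1 ≤ r / 2) (n : ℕ)
    {f : ℕ → ℝ → ℝ → ℝ≥0∞} (hf : ∀ i, AEM (f i)) :
    mixN q r (fun t x => ∑ i ∈ Finset.range n, f i t x) ^ 2 ≤
      ∑ i ∈ Finset.range n, ∑ j ∈ Finset.range n,
        mixN (q / 2) (r / 2) (fun t x => f i t x * f j t x) := by
  have h1 := mixN_sum_le hq hr (Finset.range n ×ˢ Finset.range n)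
    (f := fun z t x => f z.1 t x * f z.2 t x) fun z => (hf z.1).mul (hf z.2)
  rw [← mixN_sq, ← Finset.sum_product']
  refine le_trans (mixN_mono fun t x => le_of_eq ?_) h1
  rw [Finset.sum_product, sq, Finset.sum_mul_sum]

/-- The exponents of the theorem: `(q, r)` lies in the triangle `2/q + 1/r ≤ 1/2` without the
corners `(∞, ∞)` and `(∞, 2)`, and `α` is given by scaling. -/
structure Admissible (α : ℝ) (q r : ℝ≥0∞) : Prop where
  one_le_q : 1 ≤ q
  one_le_r : 1 ≤ r
  scaling : -α + 3 * (1 / q).toReal + (1 / r).toReal = 1 / 2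
  neg_half_lt : -(1 / 2) < α
  le_inv : α ≤ (1 / q).toReal
  ne_corner : ¬ (q = ⊤ ∧ r = 2)

namespace Admissible

variable {α : ℝ} {q r : ℝ≥0∞}

theorem q_ne_zero (h : Admissible α q r) : q ≠ 0 := (zero_lt_one.trans_le h.one_le_q).ne'

theorem r_ne_zero (h : Admissible α q r) : r ≠ 0 := (zero_lt_one.trans_le h.one_le_r).ne'

theorem toReal_inj {p p' : ℝ≥0∞} (hp : 1 ≤ p) (hp' : 1 ≤ p')
    (h : (1 / p).toReal = (1 / p').toReal) : p = p' := by
  have h1 : ∀ s : ℝ≥0∞, 1 ≤ s → 1 / s ≠ ⊤ := fun s hs => by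
    simpa using (zero_lt_one.trans_le hs).ne'
  have := (ENNReal.toReal_eq_toReal_iff' (h1 p hp) (h1 p' hp')).1 h
  simpa using this

theorem inv_q_nonneg (_ : Admissible α q r) : 0 ≤ (1 / q).toReal := ENNReal.toReal_nonneg

theorem inv_r_nonneg (_ : Admissible α q r) : 0 ≤ (1 / r).toReal := ENNReal.toReal_nonneg

theorem triangle (h : Admissible α q r) : 2 * (1 / q).toReal + (1 / r).toReal ≤ 1 / 2 := by
  linarith [h.scaling, h.le_inv]

theorem weight_top_lt_one (h : Admissible α q r) :
    1 - 2 * (1 / r).toReal - 4 * (1 / q).toReal < 1 := by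
  have := h.scaling
  have := h.neg_half_lt
  have := h.inv_q_nonneg
  have := h.inv_r_nonneg
  linarith

theorem inv_r_lt_half (h : Admissible α q r) : (1 / r).toReal < 1 / 2 := by
  have h1 := h.triangle
  have h2 := h.inv_q_nonneg
  refine lt_of_le_of_ne (by linarith) fun h3 => h.ne_corner ⟨?_, ?_⟩
  · refine toReal_inj h.one_le_q le_top ?_
    simp only [ENNReal.div_top, ENNReal.toReal_zero]
    linarith
  · refine toReal_inj h.one_le_r (by norm_num) ?_
    rw [h3]
    norm_num

theorem two_le_r (h : Admissible α q r) : 2 ≤ r := by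
  by_contra hlt
  have hr : r ≠ ⊤ := (lt_of_not_ge hlt).ne_top
  have h1 := h.inv_r_lt_half
  have h2 : (1 / r).toReal = 1 / r.toReal := by simp
  have h3 : 0 < r.toReal := ENNReal.toReal_pos h.r_ne_zero hr
  rw [h2, div_lt_div_iff₀ h3 (by norm_num)] at h1
  have h4 : r.toReal < (2 : ℝ≥0∞).toReal :=
    (ENNReal.toReal_lt_toReal hr (by norm_num)).2 (not_le.1 hlt)
  simp at h4
  linarith

theorem four_le_q (h : Admissible α q r) : 4 ≤ q := by
  by_contra hlt
  have hq : q ≠ ⊤ := (lt_of_not_ge hlt).ne_top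
  have h1 := h.triangle
  have h0 := h.inv_r_nonneg
  have h2 : (1 / q).toReal = 1 / q.toReal := by simp
  have h3 : 0 < q.toReal := ENNReal.toReal_pos h.q_ne_zero hq
  have h4 : q.toReal < (4 : ℝ≥0∞).toReal :=
    (ENNReal.toReal_lt_toReal hq (by norm_num)).2 (not_le.1 hlt)
  have h5 : 2 * (1 / q.toReal) ≤ 1 / 2 := by rw [← h2]; linarith
  have h6 : 2 / q.toReal ≤ 1 / 2 := by
    calc 2 / q.toReal = 2 * (1 / q.toReal) := by ring
      _ ≤ _ := h5
  rw [div_le_div_iff₀ h3 (by norm_num)] at h6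
  simp at h4
  linarith

theorem one_le_half_q (h : Admissible α q r) : 1 ≤ q / 2 := by
  rw [ENNReal.le_div_iff_mul_le (by simp) (by simp), one_mul]
  exact le_trans (by norm_num) h.four_le_q

theorem one_le_half_r (h : Admissible α q r) : 1 ≤ r / 2 := by
  rw [ENNReal.le_div_iff_mul_le (by simp) (by simp), one_mul]
  exact h.two_le_r

/-- Away from the endpoint `(4, ∞)` the point `(1/q, 1/r)` can be moved in two opposite directions
inside the triangle, in such a way that the scaling exponent changes. -/
theorem exists_perturbation (h : Admissible α q r) (hne : ¬ (q = 4 ∧ r = ⊤)) :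
    ∃ da db dc : ℝ, da + db + dc = 0 ∧
      |da| ≤ 1 - 2 * (1 / r).toReal - 4 * (1 / q).toReal ∧ |db| ≤ 2 * (1 / r).toReal ∧
      |dc| ≤ 4 * (1 / q).toReal ∧ da / 2 - dc / 4 ≠ 0 := by
  have h1 := h.triangle
  have h2 := h.inv_q_nonneg
  have h3 := h.inv_r_nonneg
  have h4 := h.weight_top_lt_one
  have h5 := h.inv_r_lt_half
  have h6 : 4 * (1 / q).toReal < 1 := by
    refine lt_of_le_of_ne (by linarith) fun h7 => hne ⟨?_, ?_⟩
    · refine toReal_inj h.one_le_q (by norm_num) ?_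
      have : (1 / (4 : ℝ≥0∞)).toReal = 1 / 4 := by norm_num
      rw [this]
      linarith
    · refine toReal_inj h.one_le_r le_top ?_
      simp only [ENNReal.div_top, ENNReal.toReal_zero]
      linarith
  set x := (1 / q).toReal
  set y := (1 / r).toReal
  rcases h2.eq_or_lt with hx | hx
  · -- `q = ∞`: both other weights are positive
    have hy : 0 < y := by linarith
    refine ⟨min (1 - 2 * y) (2 * y), -min (1 - 2 * y) (2 * y), 0, by ring, ?_, ?_,
      by simp; linarith, ?_⟩
    · rw [abs_of_nonneg (le_min (by linarith) (by linarith))]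
      exact (min_le_left _ _).trans (by linarith)
    · rw [abs_neg, abs_of_nonneg (le_min (by linarith) (by linarith))]
      exact min_le_right _ _
    · have : 0 < min (1 - 2 * y) (2 * y) := lt_min (by linarith) (by linarith)
      simp only [zero_div, sub_zero]
      positivity
  · rcases h3.eq_or_lt with hy | hy
    · refine ⟨min (1 - 4 * x) (4 * x), 0, -min (1 - 4 * x) (4 * x), by ring, ?_, by simp; linarith,
        ?_, ?_⟩
      · rw [abs_of_nonneg (le_min (by linarith) (by linarith))]
        exact (min_le_left _ _).trans (by linarith)
      · rw [abs_neg, abs_of_nonneg (le_min (by linarith) (by linarith))]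
        exact min_le_right _ _
      · have : 0 < min (1 - 4 * x) (4 * x) := lt_min (by linarith) (by linarith)
        linarith
    · have : 0 < min (2 * y) (4 * x) := lt_min (by linarith) (by linarith)
      refine ⟨0, min (2 * y) (4 * x), -min (2 * y) (4 * x), by ring, by simp; linarith, ?_, ?_, ?_⟩
      · rw [abs_of_pos this]
        exact min_le_left _ _
      · rw [abs_neg, abs_of_pos this]
        exact min_le_right _ _
      · linarith

theorem combine_rpow {κ δ φ : ℝ≥0∞} (hδ0 : δ ≠ 0) (hδ : δ ≠ ⊤) {a b c e₁ e₂ e₃ : ℝ} (ha : 0 ≤ a)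
    (hb : 0 ≤ b) (hc : 0 ≤ c) (h : a + b + c = 1) :
    (κ * δ ^ e₁ * φ) ^ a * (κ * δ ^ e₂ * φ) ^ b * (κ * δ ^ e₃ * φ) ^ c =
      κ * δ ^ (e₁ * a + e₂ * b + e₃ * c) * φ := by
  have e : ∀ z : ℝ≥0∞, z ^ a * z ^ b * z ^ c = z := fun z => by
    rw [← ENNReal.rpow_add_of_nonneg _ _ ha hb, ← ENNReal.rpow_add_of_nonneg _ _ (by positivity) hc,
      h, ENNReal.rpow_one]
  simp only [ENNReal.mul_rpow_of_nonneg _ _ ha, ENNReal.mul_rpow_of_nonneg _ _ hb,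
    ENNReal.mul_rpow_of_nonneg _ _ hc, ← ENNReal.rpow_mul]
  rw [ENNReal.rpow_add _ _ hδ0 hδ, ENNReal.rpow_add _ _ hδ0 hδ]
  calc _ = (κ ^ a * κ ^ b * κ ^ c) * (δ ^ (e₁ * a) * δ ^ (e₂ * b) * δ ^ (e₃ * c)) *
        (φ ^ a * φ ^ b * φ ^ c) := by ring
    _ = _ := by rw [e, e]

/-- Interaction of two dyadic bands, for a given perturbation of the exponents. -/
theorem mixN_dyadic_mul_le (h : Admissible α q r) {da db dc : ℝ} (hsum : da + db + dc = 0)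
    (ha : |da| ≤ 1 - 2 * (1 / r).toReal - 4 * (1 / q).toReal) (hb : |db| ≤ 2 * (1 / r).toReal)
    (hc : |dc| ≤ 4 * (1 / q).toReal) {D E : ℝ} (hD : 0 < D) (hE : 0 < E) {H : ℝ → ℂ}
    (hH : MemLp H 2 volume) :
    mixN (q / 2) (r / 2)
        (fun t x => ‖ev (band α D (D * 2) H) t x‖ₑ * ‖ev (band α E (E * 2) H) t x‖ₑ) ≤
      ENNReal.ofReal (14 * 2 ^ |α|) ^ 2 * (ENNReal.ofReal (D / E) ^ (da / 2 - dc / 4) *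
        (eLpNorm ((shell D (D * 2)).indicator H) 2 volume *
          eLpNorm ((shell E (E * 2)).indicator H) 2 volume)) := by
  have htop : ∀ (D e : ℝ), 0 < D → ENNReal.ofReal (14 * 2 ^ |α|) * ENNReal.ofReal D ^ e *
      eLpNorm ((shell D (D * 2)).indicator H) 2 volume ≠ ⊤ := by
    intro D e hD
    refine ENNReal.mul_ne_top (ENNReal.mul_ne_top ENNReal.ofReal_ne_top ?_)
      (memLp_indicator_shell hH _ _).2.ne
    exact ENNReal.rpow_ne_top_of_ne_zero (by simpa using hD) (by simp)
  set a := 1 - 2 * (1 / r).toReal - 4 * (1 / q).toReal with ha_def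
  set b := 2 * (1 / r).toReal with hb_def
  set c := 4 * (1 / q).toReal with hc_def
  have ha1 := abs_le.1 ha
  have hb1 := abs_le.1 hb
  have hc1 := abs_le.1 hc
  refine ((cornerBounds_ev_dyadic α hD hH).mixN_mul_le (cornerBounds_ev_dyadic α hE hH)
    (htop _ _ hD) (htop _ _ hD) (htop _ _ hE) (htop _ _ hE) h.q_ne_zero h.r_ne_zero
    (a := a + da) (b := b + db) (c := c + dc) (a' := a - da) (b' := b - db) (c' := c - dc)
    (by linarith) (by linarith) (by linarith) (by linarith) (by linarith) (by linarith)
    (by linarith) (by linarith) (by rw [hb_def]; ring) (by rw [hc_def]; ring)).trans (le_of_eq ?_)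
  rw [combine_rpow (by simpa using hD) (by simp) (by linarith) (by linarith) (by linarith)
      (by linarith),
    combine_rpow (by simpa using hE) (by simp) (by linarith) (by linarith) (by linarith)
      (by linarith)]
  have hs := h.scaling
  have e1 : (α + 1 / 2) * (a + da) + α * (b + db) + (α - 1 / 4) * (c + dc) = da / 2 - dc / 4 := by
    linear_combination α * hsum - hs
  have e2 : (α + 1 / 2) * (a - da) + α * (b - db) + (α - 1 / 4) * (c - dc) =
      -(da / 2 - dc / 4) := by
    linear_combination -α * hsum - hs
  rw [e1, e2]
  generalize da / 2 - dc / 4 = η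
  rw [ENNReal.ofReal_div_of_pos hE, div_eq_mul_inv,
    ENNReal.mul_rpow_of_ne_top (by simp) (by simp [hE]), ENNReal.inv_rpow, ENNReal.rpow_neg]
  ring

/-- Orthogonality of distant dyadic bands. -/
theorem exists_mixN_dyadic_mul_le (h : Admissible α q r) (hne : ¬ (q = 4 ∧ r = ⊤)) :
    ∃ ρ : ℝ≥0∞, ρ < 1 ∧ ∀ a : ℝ, 0 < a → ∀ H : ℝ → ℂ, MemLp H 2 volume → ∀ i j : ℕ,
      mixN (q / 2) (r / 2)
          (fun t x => ‖ev (band α (a * 2 ^ i) (a * 2 ^ (i + 1)) H) t x‖ₑ *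
            ‖ev (band α (a * 2 ^ j) (a * 2 ^ (j + 1)) H) t x‖ₑ) ≤
        ENNReal.ofReal (14 * 2 ^ |α|) ^ 2 * (ρ ^ ((i - j) + (j - i)) *
          (eLpNorm ((shell (a * 2 ^ i) (a * 2 ^ (i + 1))).indicator H) 2 volume *
            eLpNorm ((shell (a * 2 ^ j) (a * 2 ^ (j + 1))).indicator H) 2 volume)) := by
  obtain ⟨da, db, dc, hsum, ha, hb, hc, hη⟩ := h.exists_perturbation hne
  -- either sign of the perturbation is available, so that the gain `2^{-|η|}` per octave is too
  obtain ⟨da, db, dc, hsum, ha, hb, hc, hη⟩ : ∃ da db dc : ℝ, da + db + dc = 0 ∧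
      |da| ≤ 1 - 2 * (1 / r).toReal - 4 * (1 / q).toReal ∧ |db| ≤ 2 * (1 / r).toReal ∧
      |dc| ≤ 4 * (1 / q).toReal ∧ 0 < da / 2 - dc / 4 := by
    rcases lt_or_gt_of_ne hη with hη | hη
    · exact ⟨-da, -db, -dc, by linarith, by rwa [abs_neg], by rwa [abs_neg], by rwa [abs_neg],
        by linarith⟩
    · exact ⟨da, db, dc, hsum, ha, hb, hc, hη⟩
  set η := da / 2 - dc / 4 with hηdef
  set ρ : ℝ≥0∞ := ENNReal.ofReal (1 / 2) ^ η with hρ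
  have hρi : ∀ n : ℕ, ENNReal.ofReal ((1 / 2) ^ n) ^ η = ρ ^ n := fun n => by
    rw [hρ, ENNReal.ofReal_pow (by norm_num), ← ENNReal.rpow_natCast, ← ENNReal.rpow_natCast,
      ← ENNReal.rpow_mul, ← ENNReal.rpow_mul, mul_comm]
  refine ⟨ρ, ENNReal.rpow_lt_one (by rw [ENNReal.ofReal_lt_one]; norm_num) hη, ?_⟩
  intro a ha0 H hH i j
  have hpos : ∀ i : ℕ, 0 < a * 2 ^ i := fun i => by positivity
  have hsucc : ∀ i : ℕ, a * 2 ^ (i + 1) = a * 2 ^ i * 2 := fun i => by ring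
  simp only [hsucc]
  rcases le_total i j with hij | hij
  · refine (h.mixN_dyadic_mul_le hsum ha hb hc (hpos i) (hpos j) hH).trans (le_of_eq ?_)
    obtain ⟨k, rfl⟩ := Nat.exists_eq_add_of_le hij
    have : a * 2 ^ i / (a * 2 ^ (i + k)) = (1 / 2) ^ k := by
      rw [pow_add, one_div, inv_pow]; field_simp
    rw [this, hρi, show i - (i + k) + (i + k - i) = k by omega]
  · refine (h.mixN_dyadic_mul_le (da := -da) (db := -db) (dc := -dc) (by linarith)
      (by rwa [abs_neg]) (by rwa [abs_neg]) (by rwa [abs_neg]) (hpos i) (hpos j) hH).trans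
      (le_of_eq ?_)
    obtain ⟨k, rfl⟩ := Nat.exists_eq_add_of_le hij
    have : a * 2 ^ (j + k) / (a * 2 ^ j) = ((1 / 2) ^ k)⁻¹ := by
      rw [pow_add, one_div, inv_pow, inv_inv]; field_simp
    rw [this, ENNReal.ofReal_inv_of_pos (by positivity), ENNReal.inv_rpow,
      show -da / 2 - -dc / 4 = -η by rw [hηdef]; ring, ENNReal.rpow_neg, inv_inv, hρi,
      show j + k - j + (j - (j + k)) = k by omega]

/-- Strichartz estimates, uniformly over finite unions of dyadic bands. -/
theorem exists_mixN_ev_band_le (h : Admissible α q r) :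
    ∃ K : ℝ≥0∞, K ≠ ⊤ ∧ ∀ a : ℝ, 0 < a → ∀ (n : ℕ) (H : ℝ → ℂ), MemLp H 2 volume →
      mixN q r (fun t x => ‖ev (band α a (a * 2 ^ n) H) t x‖ₑ) ≤
        K * eLpNorm ((shell a (a * 2 ^ n)).indicator H) 2 volume := by
  by_cases hne : q = 4 ∧ r = ⊤
  · obtain ⟨rfl, rfl⟩ := hne
    have hα : α = 1 / 4 := by
      have := h.scaling
      norm_num at this
      linarith
    subst hα
    refine ⟨7, by norm_num, fun a ha n H hH => ?_⟩
    have e : band (1 / 4) a (a * 2 ^ n) H = fun ξ => (quarterWeight a (a * 2 ^ n) ξ : ℂ) *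
        (shell a (a * 2 ^ n)).indicator H ξ := by
      funext ξ
      rw [band_eq_mul_indicator]
      rfl
    rw [e]
    exact mixN_ev_quarterWeight_le ha
      (le_mul_of_one_le_right ha.le (one_le_pow₀ (by norm_num))) (memLp_indicator_shell hH _ _)
  obtain ⟨ρ, hρ, hmul⟩ := h.exists_mixN_dyadic_mul_le hne
  set κ := ENNReal.ofReal (14 * 2 ^ |α|) with hκ
  set K₂ : ℝ≥0∞ := κ ^ 2 * (4 * (1 - ρ)⁻¹) with hK₂
  have hK₂t : K₂ ≠ ⊤ := by
    refine ENNReal.mul_ne_top (ENNReal.pow_ne_top ENNReal.ofReal_ne_top)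
      (ENNReal.mul_ne_top (by norm_num) ?_)
    exact ENNReal.inv_ne_top.2 (tsub_pos_of_lt hρ).ne'
  refine ⟨K₂ ^ (1 / 2 : ℝ), ENNReal.rpow_ne_top_of_nonneg (by norm_num) hK₂t,
    fun a ha n H hH => ?_⟩
  set φ : ℕ → ℝ≥0∞ := fun i =>
    eLpNorm ((shell (a * 2 ^ i) (a * 2 ^ (i + 1))).indicator H) 2 volume with hφ
  set f : ℕ → ℝ → ℝ → ℝ≥0∞ := fun i t x =>
    ‖ev (band α (a * 2 ^ i) (a * 2 ^ (i + 1)) H) t x‖ₑ with hf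
  have hfm : ∀ i, AEM (f i) := fun i => by
    refine aem_ev (integrable_band (by positivity) ?_ hH α)
    gcongr <;> simp
  have hsq : mixN q r (fun t x => ‖ev (band α a (a * 2 ^ n) H) t x‖ₑ) ^ 2 ≤
      K₂ * eLpNorm ((shell a (a * 2 ^ n)).indicator H) 2 volume ^ 2 := by
    calc mixN q r (fun t x => ‖ev (band α a (a * 2 ^ n) H) t x‖ₑ) ^ 2
        ≤ mixN q r (fun t x => ∑ i ∈ Finset.range n, f i t x) ^ 2 := by
          refine pow_le_pow_left₀ zero_le (mixN_mono fun t x => ?_) 2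
          rw [ev_band_eq_sum ha n hH]
          exact enorm_sum_le _ _
      _ ≤ ∑ i ∈ Finset.range n, ∑ j ∈ Finset.range n,
            mixN (q / 2) (r / 2) (fun t x => f i t x * f j t x) :=
          mixN_sum_sq_le h.one_le_half_q h.one_le_half_r n hfm
      _ ≤ ∑ i ∈ Finset.range n, ∑ j ∈ Finset.range n,
            κ ^ 2 * (ρ ^ ((i - j) + (j - i)) * (φ i * φ j)) :=
          Finset.sum_le_sum fun i _ => Finset.sum_le_sum fun j _ => hmul a ha H hH i j
      _ = κ ^ 2 * ∑ i ∈ Finset.range n, ∑ j ∈ Finset.range n,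
            ρ ^ ((i - j) + (j - i)) * (φ i * φ j) := by
          simp only [Finset.mul_sum]
      _ ≤ κ ^ 2 * (4 * (1 - ρ)⁻¹ * ∑ i ∈ Finset.range n, φ i ^ 2) := by
          gcongr
          exact sum_sum_pow_dist_mul_le n φ
      _ = _ := by
          rw [sum_eLpNorm_indicator_shell_sq ha n hH, hK₂]
          ring
  have e : ∀ z : ℝ≥0∞, (z ^ 2) ^ (1 / 2 : ℝ) = z := fun z => by
    rw [← ENNReal.rpow_natCast, ← ENNReal.rpow_mul]; norm_num
  calc _ = (mixN q r (fun t x => ‖ev (band α a (a * 2 ^ n) H) t x‖ₑ) ^ 2) ^ (1 / 2 : ℝ) :=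
        (e _).symm
    _ ≤ (K₂ * eLpNorm ((shell a (a * 2 ^ n)).indicator H) 2 volume ^ 2) ^ (1 / 2 : ℝ) := by
        gcongr
    _ = _ := by rw [ENNReal.mul_rpow_of_nonneg _ _ (by norm_num), e]

end Admissible

/-! ### Decay of band-limited waves -/

theorem norm_phase_sub_le (t s x ξ : ℝ) :
    ‖phase t x ξ - phase s x ξ‖ ≤ |t - s| * |2 * Real.pi * ξ| ^ 3 := by
  have h1 : phase t x ξ = phase s x ξ *
      Complex.exp (Complex.I * (((t - s) * (2 * Real.pi * ξ) ^ 3 : ℝ) : ℂ)) := by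
    simp only [phase, ← Complex.exp_add]
    congr 1
    push_cast
    ring
  rw [h1, ← mul_sub_one, norm_mul, norm_phase, one_mul]
  refine (Real.norm_exp_I_mul_ofReal_sub_one_le).trans (le_of_eq ?_)
  rw [Real.norm_eq_abs, abs_mul, abs_pow]

theorem norm_ev_band_sub_le {α a b : ℝ} (ha : 0 < a) (hab : a ≤ b) {H : ℝ → ℂ}
    (hH : MemLp H 2 volume) (t s x : ℝ) :
    ‖ev (band α a b H) t x - ev (band α a b H) s x‖ ≤
      b ^ 3 * (∫ ξ, ‖band α a b H ξ‖) * |t - s| := by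
  have hi := integrable_band ha hab hH α
  rw [ev, ev, ← integral_sub (integrable_phase_mul hi t x) (integrable_phase_mul hi s x)]
  calc _ ≤ ∫ ξ, (b ^ 3 * |t - s|) * ‖band α a b H ξ‖ := by
        refine norm_integral_le_of_norm_le (hi.norm.const_mul _) (Eventually.of_forall fun ξ => ?_)
        by_cases h : ξ ∈ shell a b
        · rw [← sub_mul, norm_mul]
          gcongr
          refine (norm_phase_sub_le t s x ξ).trans ?_
          rw [mul_comm]
          have := h.2.le
          gcongr
        · simp [band, h]
    _ = _ := by rw [integral_const_mul]; ring

/-- Riemann–Lebesgue in `x` for a fixed time. -/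
theorem tendsto_ev_cocompact (h : ℝ → ℂ) (t : ℝ) : Tendsto (ev h t) (cocompact ℝ) (𝓝 0) := by
  have h1 := (Real.tendsto_integral_exp_smul_cocompact fun ξ => airyMult t ξ * h ξ).comp
    (Homeomorph.neg ℝ).isClosedEmbedding.tendsto_cocompact
  refine h1.congr fun x => ?_
  simp only [Function.comp, Homeomorph.coe_neg, ev]
  refine integral_congr_ae (Eventually.of_forall fun ξ => ?_)
  simp only [phase_eq_airyMult_mul, Circle.smul_def, Real.fourierChar_apply, smul_eq_mul]
  have : (2 * Real.pi * Complex.I * ((x * ξ : ℝ) : ℂ)) =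
      ((2 * Real.pi * -(ξ * -x) : ℝ) : ℂ) * Complex.I := by push_cast; ring
  rw [this]
  ring

theorem enorm_le_essSup_of_continuous {f : ℝ → ℂ} (hf : Continuous f) (x : ℝ) :
    ‖f x‖ₑ ≤ eLpNorm (fun x => ‖f x‖ₑ) ⊤ volume := by
  set c := eLpNorm (fun x => ‖f x‖ₑ) ⊤ volume with hc
  have h1 : ∀ᵐ x : ℝ, ‖f x‖ₑ ≤ c := by
    rw [hc, eLpNorm_ennreal_top]; exact ENNReal.ae_le_essSup _
  have hcl : IsClosed {x | ‖f x‖ₑ ≤ c} := isClosed_le hf.enorm continuous_const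
  exact hcl.closure_subset_iff.2 subset_rfl (Measure.dense_of_ae h1 x)

/-- The indicator of the complement of the box `[-n, n]²`. -/
noncomputable def offBox (n : ℕ) (t x : ℝ) : ℝ≥0∞ := if |t| ≤ n ∧ |x| ≤ n then 0 else 1

theorem measurable_offBox (n : ℕ) : Measurable (Function.uncurry (offBox n)) := by
  refine Measurable.ite ?_ measurable_const measurable_const
  have h1 : Measurable fun z : ℝ × ℝ => |z.1| := by fun_prop
  have h2 : Measurable fun z : ℝ × ℝ => |z.2| := by fun_prop
  exact (measurableSet_le h1 measurable_const).inter (measurableSet_le h2 measurable_const)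

theorem offBox_le_one (n : ℕ) (t x : ℝ) : offBox n t x ≤ 1 := by
  unfold offBox; split_ifs <;> simp

section BandDecay

variable {α a b : ℝ} {H : ℝ → ℂ}

theorem exists_cornerBounds_ev_band (α : ℝ) (ha : 0 < a) (hab : a ≤ b) (hH : MemLp H 2 volume) :
    ∃ A B C : ℝ≥0∞, A ≠ ⊤ ∧ B ≠ ⊤ ∧ C ≠ ⊤ ∧
      CornerBounds (fun t x => ‖ev (band α a b H) t x‖ₑ) A B C := by
  obtain ⟨m, -, hm⟩ := exists_weight_bound (b := b) ha α
  obtain ⟨m', -, hm'⟩ := exists_weight_bound (b := b) ha (α - 1 / 4)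
  have hf := (memLp_indicator_shell hH a b).2.ne
  refine ⟨_, _, _, ?_, ?_, ?_, cornerBounds_ev_band ha hab hm hm' hH⟩
  · exact ENNReal.mul_ne_top (ENNReal.rpow_ne_top_of_nonneg (by norm_num) (by simp))
      (ENNReal.mul_ne_top (by simp) hf)
  · exact ENNReal.mul_ne_top (by simp) hf
  · exact ENNReal.mul_ne_top (by simp) (ENNReal.mul_ne_top (by simp) hf)

theorem lintegral_sup_ev_band_ne_top (α : ℝ) (ha : 0 < a) (hab : a ≤ b) (hH : MemLp H 2 volume) :
    ∫⁻ t, eLpNorm (fun x => ‖ev (band α a b H) t x‖ₑ) ⊤ volume ^ (4 : ℝ) ≠ ⊤ := by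
  obtain ⟨A, B, C, -, -, hC, hcb⟩ := exists_cornerBounds_ev_band α ha hab hH
  have h := hcb.four_top_le
  rw [mixN, eLpNorm_ennreal_of_ne_top (by norm_num) (by norm_num)] at h
  intro htop
  have e4 : (4 : ℝ≥0∞).toReal = 4 := by norm_num
  rw [e4, htop, ENNReal.top_rpow_of_pos (by norm_num)] at h
  exact hC (top_le_iff.1 h)

/-- The supremum in `x` tends to zero as `|t| → ∞`, being Lipschitz continuous and fourth-power
integrable in time. -/
theorem exists_forall_time_norm_ev_band_le (α : ℝ) (ha : 0 < a) (hab : a ≤ b)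
    (hH : MemLp H 2 volume) {ε : ℝ} (hε : 0 < ε) :
    ∃ T : ℝ, 0 ≤ T ∧ ∀ t x, T < |t| → ‖ev (band α a b H) t x‖ ≤ ε := by
  set u := ev (band α a b H) with hu
  have hc : Continuous fun z : ℝ × ℝ => u z.1 z.2 := continuous_ev (integrable_band ha hab hH α)
  set S : ℝ → ℝ≥0∞ := fun t => eLpNorm (fun x => ‖u t x‖ₑ) ⊤ volume with hS
  have hSm : AEMeasurable S volume :=
    (aem_ev (integrable_band ha hab hH α)).eLpNorm_slice ⊤
  set L : ℝ := b ^ 3 * (∫ ξ, ‖band α a b H ξ‖) + 1 with hL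
  have hb : 0 < b := ha.trans_le hab
  have hL0 : 0 < L := by
    have : 0 ≤ ∫ ξ, ‖band α a b H ξ‖ := integral_nonneg fun _ => norm_nonneg _
    positivity
  set η : ℝ := ε / (2 * L) with hη
  have hη0 : 0 < η := by positivity
  set c : ℝ≥0∞ := ENNReal.ofReal (ε / 2) ^ (4 : ℝ) * ENNReal.ofReal (2 * η) with hc0
  have hcpos : 0 < c := by
    refine ENNReal.mul_pos ?_ ?_
    · refine (ENNReal.rpow_pos ?_ (by simp)).ne'
      simpa using by positivity
    · simpa using by positivity
  -- the tail of `∫ S⁴`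
  have htail : Tendsto (fun n : ℕ => ∫⁻ t, (Set.Icc (-(n : ℝ)) n)ᶜ.indicator
      (fun t => S t ^ (4 : ℝ)) t) atTop (𝓝 0) := by
    rw [← lintegral_zero (μ := (volume : Measure ℝ))]
    refine tendsto_lintegral_of_dominated_convergence' (fun t => S t ^ (4 : ℝ)) ?_ ?_
      (lintegral_sup_ev_band_ne_top α ha hab hH) ?_
    · exact fun n => (hSm.pow_const _).indicator measurableSet_Icc.compl
    · exact fun n => Eventually.of_forall fun t => Set.indicator_le_self _ _ _
    · refine Eventually.of_forall fun t => ?_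
      obtain ⟨N, hN⟩ := exists_nat_ge |t|
      refine tendsto_const_nhds.congr' ?_
      filter_upwards [eventually_ge_atTop N] with n hn
      rw [Set.indicator_of_notMem]
      have h1 : |t| ≤ n := hN.trans (by exact_mod_cast hn)
      simpa using abs_le.1 h1
  obtain ⟨n, hn⟩ := (htail.eventually (gt_mem_nhds hcpos)).exists
  refine ⟨n + η, by positivity, fun t x ht => ?_⟩
  by_contra hcon
  have hlow : ∀ s ∈ Set.Ioo (t - η) (t + η), ENNReal.ofReal (ε / 2) ≤ S s := by
    intro s hs
    have h1 := norm_ev_band_sub_le (α := α) ha hab hH t s x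
    have h2 : |t - s| ≤ η := abs_le.2 ⟨by linarith [hs.2], by linarith [hs.1]⟩
    have h3 : b ^ 3 * (∫ ξ, ‖band α a b H ξ‖) * |t - s| ≤ ε / 2 := by
      calc _ ≤ L * η := by
            gcongr
            linarith
        _ = ε / 2 := by rw [hη]; field_simp
    have h4 : ε / 2 ≤ ‖u s x‖ := by
      have := norm_sub_norm_le (u t x) (u s x)
      have h5 : ‖u t x - u s x‖ ≤ ε / 2 := h1.trans h3
      linarith [not_le.1 hcon]
    calc ENNReal.ofReal (ε / 2) ≤ ‖u s x‖ₑ := by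
          rw [← ofReal_norm]; exact ENNReal.ofReal_le_ofReal h4
      _ ≤ S s := enorm_le_essSup_of_continuous
          (hc.comp (by fun_prop : Continuous fun x : ℝ => (s, x))) x
  refine absurd hn (not_lt.2 ?_)
  calc c = ∫⁻ s in Set.Ioo (t - η) (t + η), ENNReal.ofReal (ε / 2) ^ (4 : ℝ) := by
        rw [setLIntegral_const, Real.volume_Ioo, hc0]
        congr 2
        ring
    _ ≤ ∫⁻ s in Set.Ioo (t - η) (t + η), (Set.Icc (-(n : ℝ)) n)ᶜ.indicator
          (fun t => S t ^ (4 : ℝ)) s := by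
        refine setLIntegral_mono' measurableSet_Ioo fun s hs => ?_
        rw [Set.indicator_of_mem]
        · have := hlow s hs
          gcongr
        · intro hs'
          have h1 : |s| ≤ n := abs_le.2 hs'
          have h2 : |t| ≤ |s| + |t - s| := by
            have := abs_add_le s (t - s); simpa using this
          have h3 : |t - s| ≤ η := abs_le.2 ⟨by linarith [hs.2], by linarith [hs.1]⟩
          linarith
    _ ≤ _ := setLIntegral_le_lintegral _ _

/-- Band-limited waves vanish at infinity in space-time. -/
theorem exists_forall_norm_ev_band_le (α : ℝ) (ha : 0 < a) (hab : a ≤ b)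
    (hH : MemLp H 2 volume) {ε : ℝ} (hε : 0 < ε) :
    ∃ N : ℕ, ∀ t x : ℝ, ¬ (|t| ≤ N ∧ |x| ≤ N) → ‖ev (band α a b H) t x‖ ≤ ε := by
  obtain ⟨T, hT0, hT⟩ := exists_forall_time_norm_ev_band_le α ha hab hH hε
  have hcpt : ∃ R : ℝ, ∀ t ∈ Set.Icc (-T) T, ∀ x, R < |x| → ‖ev (band α a b H) t x‖ ≤ ε := by
    refine isCompact_Icc.induction_on (p := fun s => ∃ R : ℝ, ∀ t ∈ s, ∀ x, R < |x| →
      ‖ev (band α a b H) t x‖ ≤ ε) ⟨0, by simp⟩ ?_ ?_ ?_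
    · rintro s s' hss ⟨R, hR⟩
      exact ⟨R, fun t ht => hR t (hss ht)⟩
    · rintro s s' ⟨R, hR⟩ ⟨R', hR'⟩
      refine ⟨max R R', fun t ht x hx => ?_⟩
      rcases ht with ht | ht
      · exact hR t ht x ((le_max_left _ _).trans_lt hx)
      · exact hR' t ht x ((le_max_right _ _).trans_lt hx)
    · intro t _
      have h1 := (tendsto_ev_cocompact (band α a b H) t).eventually
        (Metric.ball_mem_nhds 0 (half_pos hε))
      rw [← Metric.cobounded_eq_cocompact, ← comap_norm_atTop, eventually_comap] at h1
      obtain ⟨R, hR⟩ := eventually_atTop.1 h1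
      set L : ℝ := b ^ 3 * (∫ ξ, ‖band α a b H ξ‖) + 1 with hL
      have hb : 0 < b := ha.trans_le hab
      have hL0 : 0 < L := by
        have : 0 ≤ ∫ ξ, ‖band α a b H ξ‖ := integral_nonneg fun _ => norm_nonneg _
        positivity
      refine ⟨Metric.ball t (ε / (2 * L)), mem_nhdsWithin_of_mem_nhds
        (Metric.ball_mem_nhds t (by positivity)), R, fun s hs x hx => ?_⟩
      have h2 := hR |x| hx.le x rfl
      rw [dist_zero_right] at h2
      have h3 := norm_ev_band_sub_le (α := α) ha hab hH s t x
      have h4 : |s - t| ≤ ε / (2 * L) := by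
        have := Metric.mem_ball.1 hs
        rw [Real.dist_eq] at this
        exact this.le
      have h5 : b ^ 3 * (∫ ξ, ‖band α a b H ξ‖) * |s - t| ≤ ε / 2 := by
        calc _ ≤ L * (ε / (2 * L)) := by
              gcongr
              linarith
          _ = ε / 2 := by field_simp
      have h6 := norm_sub_norm_le (ev (band α a b H) s x) (ev (band α a b H) t x)
      linarith
  obtain ⟨R, hR⟩ := hcpt
  obtain ⟨N, hN⟩ := exists_nat_gt (max T R)
  refine ⟨N, fun t x h => ?_⟩
  by_cases ht : T < |t|
  · exact hT t x ht
  · refine hR t (abs_le.1 (not_lt.1 ht)) x ?_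
    by_contra hx
    exact h ⟨(not_lt.1 ht).trans ((le_max_left _ _).trans hN.le),
      (not_lt.1 hx).trans ((le_max_right _ _).trans hN.le)⟩

theorem aem_offBox_mul {f : ℝ → ℝ → ℝ≥0∞} (hf : AEM f) (n : ℕ) :
    AEM fun t x => offBox n t x * f t x :=
  (measurable_offBox n).aemeasurable.mul hf

theorem offBox_mul_le (n : ℕ) (f : ℝ → ℝ → ℝ≥0∞) (t x : ℝ) : offBox n t x * f t x ≤ f t x :=
  mul_le_of_le_one_left zero_le (offBox_le_one n t x)

theorem tendsto_iSup_offBox_mul_ev (α : ℝ) (ha : 0 < a) (hab : a ≤ b) (hH : MemLp H 2 volume) :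
    Tendsto (fun n : ℕ => ⨆ z : ℝ × ℝ, offBox n z.1 z.2 * ‖ev (band α a b H) z.1 z.2‖ₑ)
      atTop (𝓝 0) := by
  refine ENNReal.tendsto_atTop_zero.2 fun ε hε => ?_
  obtain ⟨δ, hδ, hδε⟩ : ∃ δ : ℝ, 0 < δ ∧ ENNReal.ofReal δ ≤ ε := by
    rcases eq_or_ne ε ⊤ with rfl | ht
    · exact ⟨1, one_pos, le_top⟩
    · exact ⟨ε.toReal, ENNReal.toReal_pos hε.ne' ht, (ENNReal.ofReal_toReal ht).le⟩
  obtain ⟨N, hN⟩ := exists_forall_norm_ev_band_le α ha hab hH hδ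
  refine ⟨N, fun n hn => iSup_le fun z => ?_⟩
  unfold offBox
  split_ifs with h
  · simp
  · rw [one_mul, ← ofReal_norm]
    refine (ENNReal.ofReal_le_ofReal (hN _ _ fun h' => h ?_)).trans hδε
    have : (N : ℝ) ≤ n := by exact_mod_cast hn
    exact ⟨h'.1.trans this, h'.2.trans this⟩

theorem tendsto_mixN_four_top_offBox_mul {f : ℝ → ℝ → ℝ≥0∞} (hf : AEM f)
    (hfin : ∫⁻ t, eLpNorm (f t) ⊤ volume ^ (4 : ℝ) ≠ ⊤)
    (hsup : Tendsto (fun n : ℕ => ⨆ z : ℝ × ℝ, offBox n z.1 z.2 * f z.1 z.2) atTop (𝓝 0)) :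
    Tendsto (fun n : ℕ => mixN 4 ⊤ fun t x => offBox n t x * f t x) atTop (𝓝 0) := by
  have e4 : (4 : ℝ≥0∞).toReal = 4 := by norm_num
  have hmain : Tendsto (fun n : ℕ => ∫⁻ t, eLpNorm (fun x => offBox n t x * f t x) ⊤ volume ^
      (4 : ℝ)) atTop (𝓝 (∫⁻ _ : ℝ, 0)) := by
    refine tendsto_lintegral_of_dominated_convergence'
      (fun t => eLpNorm (f t) ⊤ volume ^ (4 : ℝ)) ?_ ?_ hfin ?_
    · exact fun n => ((aem_offBox_mul hf n).eLpNorm_slice ⊤).pow_const _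
    · refine fun n => Eventually.of_forall fun t => ?_
      exact ENNReal.rpow_le_rpow (eLpNorm_ennreal_mono (Eventually.of_forall fun x =>
        offBox_mul_le n f t x)) (by norm_num)
    · refine Eventually.of_forall fun t => ?_
      rw [← ENNReal.zero_rpow_of_pos (show (0 : ℝ) < 4 by norm_num)]
      refine (ENNReal.continuous_rpow_const.tendsto _).comp ?_
      refine tendsto_of_tendsto_of_tendsto_of_le_of_le tendsto_const_nhds hsup
        (fun _ => zero_le) fun n => ?_
      dsimp only
      rw [eLpNorm_ennreal_top]
      exact essSup_le_of_ae_le _ (Eventually.of_forall fun x => le_iSup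
        (fun z : ℝ × ℝ => offBox n z.1 z.2 * f z.1 z.2) (t, x))
  rw [lintegral_zero] at hmain
  have h4 := (ENNReal.continuous_rpow_const (y := (1 / 4 : ℝ))).tendsto 0 |>.comp hmain
  rw [ENNReal.zero_rpow_of_pos (show (0 : ℝ) < 1 / 4 by norm_num)] at h4
  refine h4.congr fun n => ?_
  rw [mixN, eLpNorm_ennreal_of_ne_top (by norm_num) (by norm_num), e4]
  rfl

theorem tendsto_mixN_four_top_offBox_mul_ev (α : ℝ) (ha : 0 < a) (hab : a ≤ b)
    (hH : MemLp H 2 volume) :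
    Tendsto (fun n : ℕ => mixN 4 ⊤ fun t x => offBox n t x * ‖ev (band α a b H) t x‖ₑ)
      atTop (𝓝 0) :=
  tendsto_mixN_four_top_offBox_mul (aem_ev (integrable_band ha hab hH α))
    (lintegral_sup_ev_band_ne_top α ha hab hH) (tendsto_iSup_offBox_mul_ev α ha hab hH)

/-- Outside large boxes the admissible norms of a band-limited wave are small. -/
theorem Admissible.tendsto_mixN_offBox_mul_ev {q r : ℝ≥0∞} (h : Admissible α q r) (ha : 0 < a)
    (hab : a ≤ b) (hH : MemLp H 2 volume) :
    Tendsto (fun n : ℕ => mixN q r fun t x => offBox n t x * ‖ev (band α a b H) t x‖ₑ)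
      atTop (𝓝 0) := by
  obtain ⟨A, B, C, hA, hB, hC, hcb⟩ := exists_cornerBounds_ev_band α ha hab hH
  set f : ℕ → ℝ → ℝ → ℝ≥0∞ := fun n t x => offBox n t x * ‖ev (band α a b H) t x‖ₑ with hf
  set An : ℕ → ℝ≥0∞ := fun n => ⨆ z : ℝ × ℝ, f n z.1 z.2 with hAn
  set Cn : ℕ → ℝ≥0∞ := fun n => mixN 4 ⊤ (f n) with hCn
  have hA0 : Tendsto An atTop (𝓝 0) := tendsto_iSup_offBox_mul_ev α ha hab hH
  have hC0 : Tendsto Cn atTop (𝓝 0) := tendsto_mixN_four_top_offBox_mul_ev α ha hab hH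
  have hle : ∀ n t x, f n t x ≤ ‖ev (band α a b H) t x‖ₑ := fun n t x =>
    offBox_mul_le n (fun t x => ‖ev (band α a b H) t x‖ₑ) t x
  have hAnA : ∀ n, An n ≤ A := fun n => iSup_le fun z => (hle n _ _).trans (hcb.le_top _ _)
  have hCnC : ∀ n, Cn n ≤ C := fun n => (mixN_mono (hle n)).trans hcb.four_top_le
  have hcorner : ∀ n, CornerBounds (f n) (An n) B (Cn n) := fun n =>
    { aem := aem_offBox_mul hcb.aem n
      le_top := fun t x => le_iSup (fun z : ℝ × ℝ => f n z.1 z.2) (t, x)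
      two_le := fun t => (eLpNorm_ennreal_mono (Eventually.of_forall (hle n t))).trans
        (hcb.two_le t)
      four_top_le := le_rfl }
  set x := (1 / q).toReal with hx
  set y := (1 / r).toReal with hy
  have hx0 : 0 ≤ x := h.inv_q_nonneg
  have hy0 : 0 ≤ y := h.inv_r_nonneg
  have htri : 2 * x + y ≤ 1 / 2 := h.triangle
  have hy2 : y < 1 / 2 := h.inv_r_lt_half
  have hbound : ∀ n, mixN q r (f n) ≤
      An n ^ (1 - 2 * y - 4 * x) * B ^ (2 * y) * Cn n ^ (4 * x) := by
    intro n
    have h1 := (hcorner n).mixN_mul_le (hcorner n) ((hAnA n).trans_lt hA.lt_top).ne hB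
      ((hAnA n).trans_lt hA.lt_top).ne hB h.q_ne_zero h.r_ne_zero
      (a := 1 - 2 * y - 4 * x) (b := 2 * y) (c := 4 * x) (a' := 1 - 2 * y - 4 * x) (b' := 2 * y)
      (c' := 4 * x) (by linarith) (by linarith) (by linarith) (by linarith) (by linarith)
      (by linarith) (by ring) (by ring) (by rw [← hy]; ring) (by rw [← hx]; ring)
    simp only [← sq] at h1
    rw [mixN_sq] at h1
    exact (ENNReal.pow_le_pow_left_iff (by norm_num)).1 h1
  refine tendsto_of_tendsto_of_tendsto_of_le_of_le tendsto_const_nhds ?_ (fun _ => zero_le) hbound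
  rcases hx0.eq_or_lt with hx1 | hx1
  · -- `q = ∞`: the weight of the corner `L^∞_{t,x}` is positive
    have e : ∀ n, An n ^ (1 - 2 * y - 4 * x) * B ^ (2 * y) * Cn n ^ (4 * x) =
        An n ^ (1 - 2 * y) * B ^ (2 * y) := fun n => by rw [← hx1]; simp
    simp only [e]
    have h2 : Tendsto (fun n => An n ^ (1 - 2 * y)) atTop (𝓝 0) := by
      rw [← ENNReal.zero_rpow_of_pos (show (0 : ℝ) < 1 - 2 * y by linarith)]
      exact (ENNReal.continuous_rpow_const.tendsto _).comp hA0
    simpa using ENNReal.Tendsto.mul_const h2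
      (Or.inr (ENNReal.rpow_ne_top_of_nonneg (by linarith) hB))
  · have h2 : Tendsto (fun n => Cn n ^ (4 * x)) atTop (𝓝 0) := by
      rw [← ENNReal.zero_rpow_of_pos (show (0 : ℝ) < 4 * x by linarith)]
      exact (ENNReal.continuous_rpow_const.tendsto _).comp hC0
    have h3 : Tendsto (fun n => A ^ (1 - 2 * y - 4 * x) * B ^ (2 * y) * Cn n ^ (4 * x)) atTop
        (𝓝 0) := by
      have := ENNReal.Tendsto.const_mul (a := A ^ (1 - 2 * y - 4 * x) * B ^ (2 * y)) h2
        (Or.inr (ENNReal.mul_ne_top (ENNReal.rpow_ne_top_of_nonneg (by linarith) hA)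
          (ENNReal.rpow_ne_top_of_nonneg (by linarith) hB)))
      simpa using this
    refine tendsto_of_tendsto_of_tendsto_of_le_of_le tendsto_const_nhds h3 (fun _ => zero_le)
      fun n => ?_
    have h4 := hAnA n
    dsimp only
    gcongr
    linarith

end BandDecay

/-! ### Approximation by bounded functions supported in boxes -/

/-- A bounded measurable function of `(t, x)` vanishing outside the box `[-R, R]²`. -/
structure BoxBounded (M R : ℝ) (w : ℝ → ℝ → ℂ) : Prop where
  aesm : AEStronglyMeasurable (Function.uncurry w) ((volume : Measure ℝ).prod (volume : Measure ℝ))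
  norm_le : ∀ t x, ‖w t x‖ ≤ M
  support : ∀ t x, w t x ≠ 0 → |t| ≤ R ∧ |x| ≤ R

/-- `U` is a limit, in the mixed norm, of bounded functions supported in boxes. -/
def Approximable (q r : ℝ≥0∞) (U : ℝ → ℝ → ℂ) : Prop :=
  ∀ ε : ℝ≥0∞, 0 < ε → ∃ (w : ℝ → ℝ → ℂ) (M R : ℝ), 0 < M ∧ 0 < R ∧ BoxBounded M R w ∧
    mixN q r (fun t x => ‖U t x - w t x‖ₑ) ≤ ε

theorem aem_enorm {u : ℝ → ℝ → ℂ} (hu : AEStronglyMeasurable (Function.uncurry u)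
    ((volume : Measure ℝ).prod (volume : Measure ℝ))) : AEM fun t x => ‖u t x‖ₑ := hu.enorm

theorem Admissible.approximable_ev_band {α a b : ℝ} {q r : ℝ≥0∞} (h : Admissible α q r)
    (ha : 0 < a) (hab : a ≤ b) {H : ℝ → ℂ} (hH : MemLp H 2 volume) :
    Approximable q r (ev (band α a b H)) := by
  intro ε hε
  obtain ⟨n, hn⟩ := ((h.tendsto_mixN_offBox_mul_ev ha hab hH).eventually
    (gt_mem_nhds hε)).exists
  have hms : MeasurableSet {z : ℝ × ℝ | |z.1| ≤ n ∧ |z.2| ≤ n} := by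
    have h1 : Measurable fun z : ℝ × ℝ => |z.1| := by fun_prop
    have h2 : Measurable fun z : ℝ × ℝ => |z.2| := by fun_prop
    exact (measurableSet_le h1 measurable_const).inter (measurableSet_le h2 measurable_const)
  refine ⟨fun t x => {z : ℝ × ℝ | |z.1| ≤ n ∧ |z.2| ≤ n}.indicator
    (fun z => ev (band α a b H) z.1 z.2) (t, x), (∫ ξ, ‖band α a b H ξ‖) + 1, n + 1, ?_,
    by positivity, ⟨?_, ?_, ?_⟩, ?_⟩
  · have : 0 ≤ ∫ ξ, ‖band α a b H ξ‖ := integral_nonneg fun _ => norm_nonneg _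
    positivity
  · exact ((continuous_ev (integrable_band ha hab hH α)).aestronglyMeasurable).indicator hms
  · intro t x
    refine (norm_indicator_le_norm_self _ _).trans ((norm_ev_le _ t x).trans (by linarith))
  · intro t x hne
    have := Set.mem_of_indicator_ne_zero hne
    exact ⟨this.1.trans (by linarith), this.2.trans (by linarith)⟩
  · refine le_trans (mixN_mono fun t x => le_of_eq ?_) hn.le
    unfold offBox
    by_cases hz : |t| ≤ n ∧ |x| ≤ n
    · have : (t, x) ∈ {z : ℝ × ℝ | |z.1| ≤ n ∧ |z.2| ≤ n} := hz
      dsimp only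
      rw [Set.indicator_of_mem this, if_pos hz]
      simp
    · have : (t, x) ∉ {z : ℝ × ℝ | |z.1| ≤ n ∧ |z.2| ≤ n} := hz
      dsimp only
      rw [Set.indicator_of_notMem this, if_neg hz]
      simp

theorem BoxBounded.add {M R M' R' : ℝ} {w w' : ℝ → ℝ → ℂ} (h : BoxBounded M R w)
    (h' : BoxBounded M' R' w') : BoxBounded (M + M') (max R R') fun t x => w t x + w' t x where
  aesm := h.aesm.add h'.aesm
  norm_le t x := (norm_add_le _ _).trans (add_le_add (h.norm_le t x) (h'.norm_le t x))
  support t x hne := by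
    by_cases h0 : w t x = 0
    · have h1 : w' t x ≠ 0 := fun h1 => hne (by simp [h0, h1])
      have := h'.support t x h1
      exact ⟨this.1.trans (le_max_right _ _), this.2.trans (le_max_right _ _)⟩
    · have := h.support t x h0
      exact ⟨this.1.trans (le_max_left _ _), this.2.trans (le_max_left _ _)⟩

theorem approximable_zero (q r : ℝ≥0∞) : Approximable q r fun _ _ => 0 := by
  intro ε _
  refine ⟨fun _ _ => 0, 1, 1, one_pos, one_pos,
    ⟨aestronglyMeasurable_const, by simp, by simp⟩, ?_⟩
  simp [mixN]

theorem Approximable.add {q r : ℝ≥0∞} (hq : 1 ≤ q) (hr : 1 ≤ r) {U V : ℝ → ℝ → ℂ}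
    (hUm : AEStronglyMeasurable (Function.uncurry U)
      ((volume : Measure ℝ).prod (volume : Measure ℝ)))
    (hVm : AEStronglyMeasurable (Function.uncurry V)
      ((volume : Measure ℝ).prod (volume : Measure ℝ)))
    (hU : Approximable q r U) (hV : Approximable q r V) :
    Approximable q r fun t x => U t x + V t x := by
  intro ε hε
  obtain ⟨w, M, R, hM, hR, hw, h1⟩ := hU (ε / 2) (ENNReal.half_pos hε.ne')
  obtain ⟨w', M', R', hM', hR', hw', h2⟩ := hV (ε / 2) (ENNReal.half_pos hε.ne')
  refine ⟨_, _, _, by positivity, by positivity, hw.add hw', ?_⟩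
  calc _ ≤ mixN q r (fun t x => ‖U t x - w t x‖ₑ + ‖V t x - w' t x‖ₑ) := by
        refine mixN_mono fun t x => ?_
        rw [add_sub_add_comm]
        exact enorm_add_le _ _
    _ ≤ _ := mixN_add_le hq hr (aem_enorm (u := fun t x => U t x - w t x) (hUm.sub hw.aesm))
        (aem_enorm (u := fun t x => V t x - w' t x) (hVm.sub hw'.aesm))
    _ ≤ ε / 2 + ε / 2 := add_le_add h1 h2
    _ = ε := ENNReal.add_halves ε

theorem Approximable.of_forall_close {q r : ℝ≥0∞} (hq : 1 ≤ q) (hr : 1 ≤ r) {U : ℝ → ℝ → ℂ}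
    (hUm : AEStronglyMeasurable (Function.uncurry U)
      ((volume : Measure ℝ).prod (volume : Measure ℝ)))
    (h : ∀ ε : ℝ≥0∞, 0 < ε → ∃ V : ℝ → ℝ → ℂ, AEStronglyMeasurable (Function.uncurry V)
      ((volume : Measure ℝ).prod (volume : Measure ℝ)) ∧ Approximable q r V ∧
      mixN q r (fun t x => ‖U t x - V t x‖ₑ) ≤ ε) : Approximable q r U := by
  intro ε hε
  obtain ⟨V, hVm, hV, h1⟩ := h (ε / 2) (ENNReal.half_pos hε.ne')
  obtain ⟨w, M, R, hM, hR, hw, h2⟩ := hV (ε / 2) (ENNReal.half_pos hε.ne')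
  refine ⟨w, M, R, hM, hR, hw, ?_⟩
  calc _ ≤ mixN q r (fun t x => ‖U t x - V t x‖ₑ + ‖V t x - w t x‖ₑ) := by
        refine mixN_mono fun t x => ?_
        rw [← sub_add_sub_cancel (U t x) (V t x) (w t x)]
        exact enorm_add_le _ _
    _ ≤ _ := mixN_add_le hq hr (aem_enorm (u := fun t x => U t x - V t x) (hUm.sub hVm))
        (aem_enorm (u := fun t x => V t x - w t x) (hVm.sub hw.aesm))
    _ ≤ ε / 2 + ε / 2 := add_le_add h1 h2
    _ = ε := ENNReal.add_halves ε

/-! ### Construction of the evolution of a square integrable datum -/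

theorem integrableOn_abs_rpow {β : ℝ} (hβ : -1 < β) :
    IntegrableOn (fun x : ℝ => |x| ^ β) (Set.Icc (-1) 1) := by
  have h1 : IntegrableOn (fun x : ℝ => |x| ^ β) (Set.Ioc 0 1) := by
    have h := (intervalIntegral.intervalIntegrable_rpow' (a := 0) (b := 1) hβ)
    rw [intervalIntegrable_iff_integrableOn_Ioc_of_le zero_le_one] at h
    exact h.congr_fun (fun x hx => by simp only [abs_of_pos hx.1]) measurableSet_Ioc
  have h2 : IntegrableOn (fun x : ℝ => |x| ^ β) (Set.Icc 0 1) := by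
    rwa [integrableOn_Icc_iff_integrableOn_Ioc]
  have h3 : IntegrableOn (fun x : ℝ => |x| ^ β) (Set.Icc (-1) 0) := by
    have h := (Measure.measurePreserving_neg (volume : Measure ℝ)).integrableOn_comp_preimage
      (Homeomorph.neg ℝ).measurableEmbedding (s := Set.Icc 0 1) (f := fun x : ℝ => |x| ^ β)
    have h4 := h.2 h2
    have h5 : (Neg.neg : ℝ → ℝ) ⁻¹' Set.Icc 0 1 = Set.Icc (-1) 0 := by
      ext x; simp [and_comm]
    rw [h5] at h4
    exact h4.congr_fun (fun x _ => by simp) measurableSet_Icc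
  have h6 := h3.union h2
  rwa [Set.Icc_union_Icc_eq_Icc (by norm_num) (by norm_num)] at h6

/-- Since `α > -1/2`, the weight `|k|^α` keeps Schwartz functions square integrable. -/
theorem memLp_rpow_mul_schwartz {α : ℝ} (h1 : -(1 / 2) < α) (h2 : α ≤ 1) (ψ : 𝓢(ℝ, ℂ)) :
    MemLp (fun ξ : ℝ => ((|2 * Real.pi * ξ| ^ α : ℝ) : ℂ) * ψ ξ) 2 volume := by
  have hm : AEStronglyMeasurable (fun ξ : ℝ => ((|2 * Real.pi * ξ| ^ α : ℝ) : ℂ) * ψ ξ)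
      volume := by
    have : Measurable fun ξ : ℝ => ((|2 * Real.pi * ξ| ^ α : ℝ) : ℂ) := by fun_prop
    exact this.aestronglyMeasurable.mul ψ.continuous.aestronglyMeasurable
  rw [memLp_two_iff_integrable_sq_norm hm]
  obtain ⟨M, hM⟩ : ∃ M : ℝ, ∀ x, ‖ψ x‖ ≤ M := by
    obtain ⟨M, hM⟩ := ψ.decay 0 0
    exact ⟨M, fun x => by simpa using hM.2 x⟩
  have hM0 : 0 ≤ M := (norm_nonneg _).trans (hM 0)
  set P : ℝ := 2 * Real.pi with hP
  have hP0 : 0 < P := by positivity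
  have hP1 : 1 ≤ P := by have := Real.pi_gt_three; linarith
  have hI1 : Integrable ((Set.Icc (-1 : ℝ) 1).indicator fun x : ℝ => |x| ^ (2 * α)) :=
    (integrable_indicator_iff measurableSet_Icc).2 (integrableOn_abs_rpow (by linarith))
  have hI2 := ψ.integrable_pow_mul (volume : Measure ℝ) 2
  refine ((hI1.const_mul (M ^ 2 * P ^ (2 * α))).add (hI2.const_mul (P ^ 2 * M))).mono'
    (hm.norm.pow 2) (Eventually.of_forall fun ξ => ?_)
  have e : ‖((|P * ξ| ^ α : ℝ) : ℂ) * ψ ξ‖ ^ 2 = |P * ξ| ^ (2 * α) * ‖ψ ξ‖ ^ 2 := by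
    rw [norm_mul, Complex.norm_real, Real.norm_of_nonneg (by positivity), mul_pow,
      ← Real.rpow_natCast (|P * ξ| ^ α), ← Real.rpow_mul (abs_nonneg _)]
    congr 2
    push_cast
    ring
  rw [Real.norm_of_nonneg (by positivity), e]
  have hψ := hM ξ
  have hn1 : 0 ≤ M ^ 2 * P ^ (2 * α) * (Set.Icc (-1 : ℝ) 1).indicator
      (fun x : ℝ => |x| ^ (2 * α)) ξ :=
    mul_nonneg (by positivity) (Set.indicator_nonneg (fun _ _ => by positivity) _)
  simp only [Pi.add_apply]
  by_cases hξ : ξ ∈ Set.Icc (-1 : ℝ) 1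
  · rw [Set.indicator_of_mem hξ, abs_mul, abs_of_pos hP0,
      Real.mul_rpow hP0.le (abs_nonneg _)]
    have h5 : P ^ (2 * α) * |ξ| ^ (2 * α) * ‖ψ ξ‖ ^ 2 ≤
        P ^ (2 * α) * |ξ| ^ (2 * α) * M ^ 2 := by gcongr
    have h6 : 0 ≤ P ^ 2 * M * (‖ξ‖ ^ 2 * ‖ψ ξ‖) := by positivity
    linarith
  · have h7 : 1 < |ξ| := by
      by_contra h; exact hξ (abs_le.1 (not_lt.1 h))
    have h8 : 1 ≤ |P * ξ| := by
      rw [abs_mul, abs_of_pos hP0]; nlinarith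
    have h9 : |P * ξ| ^ (2 * α) ≤ |P * ξ| ^ (2 : ℝ) :=
      Real.rpow_le_rpow_of_exponent_le h8 (by linarith)
    have h10 : |P * ξ| ^ (2 : ℝ) = P ^ 2 * ‖ξ‖ ^ 2 := by
      rw [Real.rpow_two, sq_abs, Real.norm_eq_abs, sq_abs]; ring
    calc |P * ξ| ^ (2 * α) * ‖ψ ξ‖ ^ 2 ≤ P ^ 2 * ‖ξ‖ ^ 2 * (M * ‖ψ ξ‖) := by
          rw [← h10, sq ‖ψ ξ‖]
          gcongr
      _ ≤ _ := by nlinarith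

/-- The annuli `2^{-m} ≤ |k| < 2^m` exhausting the frequency line. -/
def wideShell (m : ℕ) : Set ℝ := shell ((1 / 2) ^ m) ((1 / 2) ^ m * 2 ^ (2 * m))

theorem mem_wideShell {m : ℕ} {ξ : ℝ} :
    ξ ∈ wideShell m ↔ (1 / 2 : ℝ) ^ m ≤ |2 * Real.pi * ξ| ∧ |2 * Real.pi * ξ| < 2 ^ m := by
  have : (1 / 2 : ℝ) ^ m * 2 ^ (2 * m) = 2 ^ m := by
    rw [two_mul, pow_add, ← mul_assoc, ← mul_pow]; norm_num
  rw [wideShell, this]; rfl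

theorem monotone_wideShell : Monotone wideShell := by
  refine monotone_nat_of_le_succ fun m ξ hξ => ?_
  rw [mem_wideShell] at hξ ⊢
  refine ⟨le_trans ?_ hξ.1, hξ.2.trans_le ?_⟩
  · exact pow_le_pow_of_le_one (by norm_num) (by norm_num) (Nat.le_succ m)
  · exact pow_le_pow_right₀ (by norm_num) (Nat.le_succ m)

theorem eventually_mem_wideShell {ξ : ℝ} (hξ : ξ ≠ 0) : ∀ᶠ m in atTop, ξ ∈ wideShell m := by
  have h0 : 0 < |2 * Real.pi * ξ| := by
    have := Real.pi_pos; positivity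
  have h1 : Tendsto (fun m : ℕ => (1 / 2 : ℝ) ^ m) atTop (𝓝 0) :=
    tendsto_pow_atTop_nhds_zero_of_lt_one (by norm_num) (by norm_num)
  have h2 : Tendsto (fun m : ℕ => (2 : ℝ) ^ m) atTop atTop :=
    tendsto_pow_atTop_atTop_of_one_lt (by norm_num)
  filter_upwards [h1.eventually (gt_mem_nhds h0), h2.eventually_gt_atTop |2 * Real.pi * ξ|]
    with m hm1 hm2
  exact mem_wideShell.2 ⟨hm1.le, hm2⟩

theorem tendsto_eLpNorm_indicator_compl_wideShell {F : ℝ → ℂ} (hF : MemLp F 2 volume) :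
    Tendsto (fun m => eLpNorm ((wideShell m)ᶜ.indicator F) 2 volume) atTop (𝓝 0) := by
  have h1 : Tendsto (fun m => ∫⁻ ξ, (wideShell m)ᶜ.indicator (fun ξ => ‖F ξ‖ₑ ^ 2) ξ) atTop
      (𝓝 (∫⁻ _ : ℝ, 0)) := by
    refine tendsto_lintegral_of_dominated_convergence' (fun ξ => ‖F ξ‖ₑ ^ 2) (fun m => ?_)
      (fun m => Eventually.of_forall fun ξ => Set.indicator_le_self _ _ _) ?_ ?_
    · exact (hF.1.enorm.pow_const 2).indicator (measurableSet_shell _ _).compl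
    · rw [← eLpNorm_two_sq_eq_lintegral]
      exact ENNReal.pow_ne_top hF.2.ne
    · have h0 : ∀ᵐ ξ : ℝ, ξ ≠ 0 := by simp [ae_iff]
      filter_upwards [h0] with ξ hξ
      refine tendsto_const_nhds.congr' ?_
      filter_upwards [eventually_mem_wideShell hξ] with m hm
      simp [hm]
  rw [lintegral_zero] at h1
  have h2 := (ENNReal.continuous_rpow_const (y := (1 / 2 : ℝ))).tendsto 0 |>.comp h1
  rw [ENNReal.zero_rpow_of_pos (show (0 : ℝ) < 1 / 2 by norm_num)] at h2
  refine h2.congr fun m => ?_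
  have h3 : ∫⁻ ξ, (wideShell m)ᶜ.indicator (fun ξ => ‖F ξ‖ₑ ^ 2) ξ =
      eLpNorm ((wideShell m)ᶜ.indicator F) 2 volume ^ 2 := by
    rw [eLpNorm_two_sq_eq_lintegral]
    refine lintegral_congr fun ξ => ?_
    by_cases h : ξ ∈ (wideShell m)ᶜ
    · simp only [Set.indicator_of_mem h]
    · simp only [Set.indicator_of_notMem h]; simp
  simp only [Function.comp]
  rw [h3, ← ENNReal.rpow_natCast, ← ENNReal.rpow_mul]
  norm_num

/-- A square integrable function is cut into pieces living in annuli, with summable norms. -/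
theorem exists_summable_decomposition {F : ℝ → ℂ} (hF : MemLp F 2 volume) :
    ∃ (N : ℕ → ℕ) (S : ℕ → Set ℝ), (∀ k, MeasurableSet (S k)) ∧
      Pairwise (Function.onFun Disjoint S) ∧ (∀ k, S k ⊆ wideShell (N k)) ∧
      (⋃ k, S k) =ᵐ[volume] (Set.univ : Set ℝ) ∧
      ∑' k, eLpNorm ((S k).indicator F) 2 volume ≠ ⊤ := by
  have hev : ∀ k : ℕ, ∀ᶠ m in atTop,
      eLpNorm ((wideShell m)ᶜ.indicator F) 2 volume ≤ 2⁻¹ ^ k := fun k =>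
    ((tendsto_eLpNorm_indicator_compl_wideShell hF).eventually
      (gt_mem_nhds (ENNReal.pow_pos (by simp) k))).mono fun _ h => le_of_lt h
  obtain ⟨N, hN, hNk⟩ := extraction_forall_of_eventually hev
  set T : ℕ → Set ℝ := fun k => wideShell (N k) with hT
  have hTm : ∀ k, MeasurableSet (T k) := fun k => measurableSet_shell _ _
  have hTmono : Monotone T := monotone_wideShell.comp hN.monotone
  refine ⟨N, disjointed T, fun k => MeasurableSet.disjointed hTm k, disjoint_disjointed T,
    fun k => disjointed_subset T k, ?_, ?_⟩
  · rw [iUnion_disjointed]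
    have h0 : ∀ᵐ ξ : ℝ, ξ ≠ 0 := by simp [ae_iff]
    refine eventuallyEq_univ.2 ?_
    filter_upwards [h0] with ξ hξ
    obtain ⟨m, hm⟩ := (eventually_mem_wideShell hξ).exists
    exact Set.mem_iUnion.2 ⟨m, monotone_wideShell (hN.id_le m) hm⟩
  · rw [tsum_eq_zero_add' ENNReal.summable]
    refine ENNReal.add_ne_top.2 ⟨?_, ?_⟩
    · exact (hF.indicator (MeasurableSet.disjointed hTm 0)).2.ne
    · refine ((ENNReal.tsum_le_tsum fun k => ?_).trans_lt
        (b := ∑' k : ℕ, (2⁻¹ : ℝ≥0∞) ^ k) ?_).ne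
      · refine le_trans ?_ (hNk k)
        have hsub : disjointed T (k + 1) ⊆ (wideShell (N k))ᶜ := by
          rw [hTmono.disjointed_add_one]
          exact fun ξ hξ => hξ.2
        refine eLpNorm_mono fun ξ => ?_
        exact norm_indicator_le_of_subset hsub F ξ
      · rw [ENNReal.tsum_geometric]
        simp

theorem enorm_tsum_sub_sum_le (d : ℕ → ℂ) (n : ℕ) :
    ‖∑' k, d k - ∑ k ∈ Finset.range n, d k‖ₑ ≤ ∑' k, ‖d (k + n)‖ₑ := by
  by_cases h : ∑' k, ‖d (k + n)‖ₑ = ⊤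
  · rw [h]; exact le_top
  have h1 : Summable fun k => d (k + n) :=
    (tsum_enorm_ne_top_iff_summable_norm.1 h).of_norm
  rw [← ((summable_nat_add_iff n).1 h1).sum_add_tsum_nat_add n, add_sub_cancel_left]
  exact enorm_tsum_le_tsum_enorm

theorem lintegral_mul_schwartz_ne_top {r : ℝ≥0∞} (hr : 2 ≤ r) {f : ℝ → ℝ≥0∞}
    (hfm : AEMeasurable f volume) (hf : eLpNorm f r volume ≠ ⊤) (ψ : 𝓢(ℝ, ℂ)) :
    ∫⁻ x, f x * ‖ψ x‖ₑ ≠ ⊤ := by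
  rcases eq_or_ne r ⊤ with rfl | hrt
  · rw [eLpNorm_ennreal_top] at hf
    refine ((lintegral_mono_ae (g := fun x => essSup f volume * ‖ψ x‖ₑ) ?_).trans_lt ?_).ne
    · filter_upwards [ENNReal.ae_le_essSup f] with x hx
      gcongr
    · rw [lintegral_const_mul' _ _ hf]
      exact ENNReal.mul_lt_top hf.lt_top ψ.integrable.2
  · have h1 : 1 < r.toReal := by
      have := ENNReal.toReal_mono hrt hr
      norm_num at this
      linarith
    have hc := Real.HolderConjugate.conjExponent h1
    have h2 := ENNReal.lintegral_mul_le_Lp_mul_Lq volume hc hfm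
      (ψ.continuous.aestronglyMeasurable (μ := volume)).enorm
    refine (h2.trans_lt ?_).ne
    have hr0 : r ≠ 0 := (zero_lt_two.trans_le hr).ne'
    rw [← eLpNorm_ennreal_of_ne_top hr0 hrt]
    have hs : 0 < r.toReal.conjExponent := hc.symm.pos
    have h3 := (ψ.memLp (ENNReal.ofReal r.toReal.conjExponent) volume).2
    rw [eLpNorm_eq_lintegral_rpow_enorm_toReal (by simpa using hs) (by simp),
      ENNReal.toReal_ofReal hs.le] at h3
    exact ENNReal.mul_lt_top hf.lt_top h3

theorem ae_ne_top_of_eLpNorm_ne_top {p : ℝ≥0∞} (hp : p ≠ 0) {f : ℝ → ℝ≥0∞}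
    (hf : AEMeasurable f volume) (h : eLpNorm f p volume ≠ ⊤) : ∀ᵐ t : ℝ, f t ≠ ⊤ := by
  rcases eq_or_ne p ⊤ with rfl | hpt
  · rw [eLpNorm_ennreal_top] at h
    filter_upwards [ENNReal.ae_le_essSup f] with t ht
    exact (ht.trans_lt h.lt_top).ne
  · have h0 : 0 < p.toReal := ENNReal.toReal_pos hp hpt
    rw [eLpNorm_ennreal_of_ne_top hp hpt, Ne,
      ENNReal.rpow_eq_top_iff_of_pos (by positivity)] at h
    filter_upwards [ae_lt_top' (hf.pow_const _) h] with t ht h2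
    rw [h2, ENNReal.top_rpow_of_pos h0] at ht
    exact absurd ht (lt_irrefl _)

section Series

variable {q r : ℝ≥0∞} {D : ℕ → ℝ → ℝ → ℂ}

theorem measurable_tsum_enorm (hD : ∀ k, Continuous fun z : ℝ × ℝ => D k z.1 z.2) :
    Measurable (Function.uncurry fun t x => ∑' k, ‖D k t x‖ₑ) :=
  Measurable.tsum fun k => (hD k).enorm.measurable

theorem ae_eLpNorm_tsum_enorm_ne_top (hq : 1 ≤ q) (hr : 1 ≤ r)
    (hD : ∀ k, Continuous fun z : ℝ × ℝ => D k z.1 z.2)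
    (hsum : ∑' k, mixN q r (fun t x => ‖D k t x‖ₑ) ≠ ⊤) :
    ∀ᵐ t : ℝ, eLpNorm (fun x => ∑' k, ‖D k t x‖ₑ) r volume ≠ ⊤ := by
  have hm : AEM fun t x => ∑' k, ‖D k t x‖ₑ := (measurable_tsum_enorm hD).aemeasurable
  refine ae_ne_top_of_eLpNorm_ne_top (zero_lt_one.trans_le hq).ne' (hm.eLpNorm_slice r)
    (((mixN_tsum_le hq hr fun k => ?_).trans_lt hsum.lt_top).ne)
  exact (hD k).enorm.measurable.aemeasurable

theorem aestronglyMeasurable_tsum (hq : 1 ≤ q) (hr : 1 ≤ r)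
    (hD : ∀ k, Continuous fun z : ℝ × ℝ => D k z.1 z.2)
    (hsum : ∑' k, mixN q r (fun t x => ‖D k t x‖ₑ) ≠ ⊤) :
    AEStronglyMeasurable (Function.uncurry fun t x => ∑' k, D k t x)
      ((volume : Measure ℝ).prod (volume : Measure ℝ)) := by
  have hGmeas := measurable_tsum_enorm hD
  have hGtx : ∀ᵐ z : ℝ × ℝ ∂((volume : Measure ℝ).prod volume),
      ∑' k, ‖D k z.1 z.2‖ₑ ≠ ⊤ := by
    refine (Measure.ae_prod_iff_ae_ae ?_).2 ?_
    · exact (hGmeas (measurableSet_singleton ⊤)).compl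
    · filter_upwards [ae_eLpNorm_tsum_enorm_ne_top hq hr hD hsum] with t ht
      exact ae_ne_top_of_eLpNorm_ne_top (zero_lt_one.trans_le hr).ne'
        (hGmeas.comp measurable_prodMk_left).aemeasurable ht
  refine aestronglyMeasurable_of_tendsto_ae atTop
    (f := fun n (z : ℝ × ℝ) => ∑ k ∈ Finset.range n, D k z.1 z.2)
    (fun n => (continuous_finsetSum _ fun k _ => hD k).aestronglyMeasurable) ?_
  filter_upwards [hGtx] with z hz
  exact (tsum_enorm_ne_top_iff_summable_norm.1 hz).of_norm.hasSum.tendsto_sum_nat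

theorem approximable_tsum (hq : 1 ≤ q) (hr : 1 ≤ r)
    (hD : ∀ k, Continuous fun z : ℝ × ℝ => D k z.1 z.2)
    (hsum : ∑' k, mixN q r (fun t x => ‖D k t x‖ₑ) ≠ ⊤)
    (happ : ∀ k, Approximable q r (D k)) : Approximable q r fun t x => ∑' k, D k t x := by
  have hpm : ∀ n, AEStronglyMeasurable
      (Function.uncurry fun t x => ∑ k ∈ Finset.range n, D k t x)
      ((volume : Measure ℝ).prod (volume : Measure ℝ)) := fun n =>
    (continuous_finsetSum (Finset.range n) fun k _ => hD k).aestronglyMeasurable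
  have hpart : ∀ n, Approximable q r fun t x => ∑ k ∈ Finset.range n, D k t x := by
    intro n
    induction n with
    | zero => simpa using approximable_zero q r
    | succ n ih =>
      simp only [Finset.sum_range_succ]
      exact Approximable.add hq hr (hpm n) (hD n).aestronglyMeasurable ih (happ n)
  refine Approximable.of_forall_close hq hr (aestronglyMeasurable_tsum hq hr hD hsum)
    fun ε hε => ?_
  obtain ⟨n, hn⟩ := ((ENNReal.tendsto_sum_nat_add _ hsum).eventually (gt_mem_nhds hε)).exists
  refine ⟨_, hpm n, hpart n, ?_⟩
  calc _ ≤ mixN q r (fun t x => ∑' k, ‖D (k + n) t x‖ₑ) :=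
        mixN_mono fun t x => enorm_tsum_sub_sum_le (fun k => D k t x) n
    _ ≤ ∑' k, mixN q r (fun t x => ‖D (k + n) t x‖ₑ) :=
        mixN_tsum_le hq hr fun k => (hD (k + n)).enorm.measurable.aemeasurable
    _ ≤ ε := hn.le

end Series

/-- If the frequency density `|k|^α F` is cut into the integrable pieces `B k`, supported in
disjoint sets, then the sum of the corresponding waves has the right Fourier transform at each time
at which the series converges absolutely in `L^r`. -/
theorem integral_tsum_ev_mul_fourier {α : ℝ} {r : ℝ≥0∞} (hr : 2 ≤ r) (hα : -(1 / 2) < α)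
    (hα' : α ≤ 1) {F : ℝ → ℂ} (hF : MemLp F 2 volume) {S : ℕ → Set ℝ}
    (hSm : ∀ k, MeasurableSet (S k)) (hSd : Pairwise (Function.onFun Disjoint S))
    (hSu : (⋃ k, S k) =ᵐ[volume] (Set.univ : Set ℝ)) {B : ℕ → ℝ → ℂ}
    (hBi : ∀ k, Integrable (B k))
    (hB : ∀ k, B k = (S k).indicator fun ξ => ((|2 * Real.pi * ξ| ^ α : ℝ) : ℂ) * F ξ) {t : ℝ}
    (hm : AEStronglyMeasurable (fun x => ∑' k, ev (B k) t x) volume)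
    (ht : eLpNorm (fun x => ∑' k, ‖ev (B k) t x‖ₑ) r volume ≠ ⊤) (ψ : 𝓢(ℝ, ℂ)) :
    Integrable (fun x => (∑' k, ev (B k) t x) * (𝓕 ψ) x) ∧
      ∫ x, (∑' k, ev (B k) t x) * (𝓕 ψ) x =
        ∫ ξ, airyMult t ξ * (((|2 * Real.pi * ξ| ^ α : ℝ) : ℂ) * F ξ) * ψ ξ := by
  have hc : ∀ k, Continuous fun x => ev (B k) t x := fun k =>
    (continuous_ev (hBi k)).comp (by fun_prop : Continuous fun x : ℝ => (t, x))
  have hGψ : ∫⁻ x, (∑' k, ‖ev (B k) t x‖ₑ) * ‖(𝓕 ψ) x‖ₑ ≠ ⊤ :=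
    lintegral_mul_schwartz_ne_top hr
      (Measurable.tsum fun k => (hc k).enorm.measurable).aemeasurable ht (𝓕 ψ)
  have hDtm : ∀ k, AEStronglyMeasurable (fun x => ev (B k) t x * (𝓕 ψ) x) volume := fun k =>
    (integrable_ev_mul_schwartz (hBi k) t (𝓕 ψ)).1
  refine ⟨⟨hm.mul (𝓕 ψ).continuous.aestronglyMeasurable, ?_⟩, ?_⟩
  · refine (lintegral_mono fun x => ?_).trans_lt hGψ.lt_top
    rw [enorm_mul]
    gcongr
    exact enorm_tsum_le_tsum_enorm
  · have hfi : Integrable fun ξ => airyMult t ξ * (((|2 * Real.pi * ξ| ^ α : ℝ) : ℂ) * F ξ) *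
        ψ ξ := by
      have h1 := (memLp_rpow_mul_schwartz hα hα' ψ).integrable_mul hF
      have h2 := h1.bdd_mul (c := 1) (continuous_airyMult t).aestronglyMeasurable
        (Eventually.of_forall fun ξ => (norm_airyMult t ξ).le)
      refine h2.congr (Eventually.of_forall fun ξ => ?_)
      simp only [Pi.mul_apply]
      ring
    calc _ = ∑' k, ∫ x, ev (B k) t x * (𝓕 ψ) x := by
          simp only [← tsum_mul_right]
          refine integral_tsum hDtm ?_
          rw [← lintegral_tsum fun k => (hDtm k).enorm]
          simpa only [enorm_mul, ENNReal.tsum_mul_right] using hGψ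
      _ = ∑' k, ∫ ξ in S k,
            airyMult t ξ * (((|2 * Real.pi * ξ| ^ α : ℝ) : ℂ) * F ξ) * ψ ξ := by
          congr 1
          ext k
          rw [integral_ev_mul_fourier (hBi k), hB k, ← integral_indicator (hSm k)]
          congr 1
          ext ξ
          by_cases hξ : ξ ∈ S k
          · simp only [Set.indicator_of_mem hξ]
          · simp only [Set.indicator_of_notMem hξ]; simp
      _ = _ := by
          rw [← integral_iUnion hSm hSd hfi.integrableOn, setIntegral_congr_set hSu,
            setIntegral_univ]

/-- The evolution exists as the sum of the series of the waves of the frequency pieces, which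
converges absolutely in the mixed norm by the Strichartz estimates; the sum inherits
approximability from the waves. -/
theorem Admissible.exists_evolution {α : ℝ} {q r : ℝ≥0∞} (h : Admissible α q r) (φ : L2) :
    ∃ U : ℝ → ℝ → ℂ, IsFracAiryEvolution α φ 0 U ∧ Approximable q r U := by
  have hF2 : MemLp (fun ξ => (𝓕 φ : L2) ξ) 2 volume := Lp.memLp _
  set F : ℝ → ℂ := fun ξ => (𝓕 φ : L2) ξ with hF
  clear_value F
  obtain ⟨N, S, hSm, hSd, hSN, hSu, hsum⟩ := exists_summable_decomposition hF2
  obtain ⟨K, hK, hKb⟩ := h.exists_mixN_ev_band_le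
  have ha0 : ∀ k, (0 : ℝ) < (1 / 2) ^ N k := fun k => by positivity
  have hab : ∀ k, ((1 : ℝ) / 2) ^ N k ≤ (1 / 2) ^ N k * 2 ^ (2 * N k) := fun k =>
    le_mul_of_one_le_right (ha0 k).le (one_le_pow₀ (by norm_num))
  have hH2 : ∀ k, MemLp ((S k).indicator F) 2 volume := fun k => hF2.indicator (hSm k)
  set B : ℕ → ℝ → ℂ := fun k =>
    band α ((1 / 2) ^ N k) ((1 / 2) ^ N k * 2 ^ (2 * N k)) ((S k).indicator F) with hB
  have hBi : ∀ k, Integrable (B k) := fun k => integrable_band (ha0 k) (hab k) (hH2 k) α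
  have hBeq : ∀ k, B k = (S k).indicator fun ξ => ((|2 * Real.pi * ξ| ^ α : ℝ) : ℂ) * F ξ := by
    intro k
    ext ξ
    by_cases hξ : ξ ∈ S k
    · have h1 : ξ ∈ shell ((1 / 2) ^ N k) ((1 / 2) ^ N k * 2 ^ (2 * N k)) := hSN k hξ
      simp only [hB, band, Set.indicator_of_mem h1, Set.indicator_of_mem hξ]
    · rw [Set.indicator_of_notMem hξ, hB]
      dsimp only
      rw [band_eq_mul_indicator, mul_eq_zero]
      right
      rw [Set.indicator_apply_eq_zero]
      intro _
      exact Set.indicator_of_notMem hξ _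
  have hDle : ∀ k, mixN q r (fun t x => ‖ev (B k) t x‖ₑ) ≤
      K * eLpNorm ((S k).indicator F) 2 volume := by
    intro k
    refine (hKb _ (ha0 k) (2 * N k) _ (hH2 k)).trans ?_
    gcongr
    exact eLpNorm_indicator_le _
  have happ : ∀ k, Approximable q r (ev (B k)) := fun k =>
    h.approximable_ev_band (ha0 k) (hab k) (hH2 k)
  clear_value B
  have hDsum : ∑' k, mixN q r (fun t x => ‖ev (B k) t x‖ₑ) ≠ ⊤ := by
    refine ((ENNReal.tsum_le_tsum hDle).trans_lt ?_).ne
    rw [ENNReal.tsum_mul_left]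
    exact ENNReal.mul_lt_top hK.lt_top hsum.lt_top
  have hDc : ∀ k, Continuous fun z : ℝ × ℝ => ev (B k) z.1 z.2 := fun k => continuous_ev (hBi k)
  have hUm := aestronglyMeasurable_tsum h.one_le_q h.one_le_r hDc hDsum
  refine ⟨fun t x => ∑' k, ev (B k) t x, ⟨hUm, ?_⟩,
    approximable_tsum h.one_le_q h.one_le_r hDc hDsum happ⟩
  have hα' : α ≤ 1 := h.le_inv.trans (by
    rw [one_div]
    exact ENNReal.toReal_mono ENNReal.one_ne_top (ENNReal.inv_le_one.2 h.one_le_q))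
  filter_upwards [ae_eLpNorm_tsum_enorm_ne_top h.one_le_q h.one_le_r hDc hDsum,
    hUm.prodMk_left] with t ht hUt ψ
  obtain ⟨h1, h2⟩ := integral_tsum_ev_mul_fourier h.two_le_r h.neg_half_lt hα' hF2 hSm hSd hSu
    hBi hBeq hUt ht ψ
  refine ⟨h1, h2.trans (integral_congr_ae (Eventually.of_forall fun ξ => ?_))⟩
  simp only [airyMult, sub_zero, hF]
  ring

/-! ### Scaling and translation of the evolution -/

theorem integral_comp_sub_div (f : ℝ → ℂ) (a : ℝ) {h : ℝ} (hh : 0 < h) :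
    ∫ x, f ((x - a) / h) = (h : ℂ) * ∫ x, f x := by
  rw [integral_sub_right_eq_self (fun x => f (x / h)) a, Measure.integral_comp_div,
    abs_of_pos hh, Complex.real_smul]

theorem integrable_comp_sub_div {f : ℝ → ℂ} (hf : Integrable f) (a : ℝ) {h : ℝ} (hh : h ≠ 0) :
    Integrable fun x => f ((x - a) / h) :=
  (hf.comp_div hh).comp_sub_right a

theorem quasiMeasurePreserving_sub_div (a : ℝ) {h : ℝ} (hh : h ≠ 0) :
    Measure.QuasiMeasurePreserving (fun x : ℝ => (x - a) / h) volume volume := by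
  have h1 : Measure.QuasiMeasurePreserving (fun x : ℝ => h⁻¹ * x) volume volume := by
    refine ⟨by fun_prop, ?_⟩
    rw [Real.map_volume_mul_left (inv_ne_zero hh)]
    exact Measure.smul_absolutelyContinuous
  have h2 := h1.comp (measurePreserving_sub_right (volume : Measure ℝ) a).quasiMeasurePreserving
  convert h2 using 2 with x
  simp [div_eq_inv_mul]

/-- The effect of an affine change of variables on the frequency side, for Schwartz functions. -/
theorem exists_schwartz_fourier_eq_comp_affine (ψ : 𝓢(ℝ, ℂ)) (a : ℝ) {h : ℝ} (hh : 0 < h) :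
    ∃ χ : 𝓢(ℝ, ℂ), (∀ x, (𝓕 χ) ((x - a) / h) = (𝓕 ψ) x) ∧
      ∀ ξ, (h : ℂ) * χ (h * ξ) =
        Complex.exp (-(2 * Real.pi * Complex.I * ((a * ξ : ℝ) : ℂ))) * ψ ξ := by
  let e : ℝ ≃L[ℝ] ℝ := ContinuousLinearEquiv.unitsEquivAut ℝ (Units.mk0 h hh.ne')
  let θ : 𝓢(ℝ, ℂ) := SchwartzMap.compCLMOfContinuousLinearEquiv ℂ e
    (SchwartzMap.compSubConstCLM ℂ (-a) (𝓕 ψ))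
  have hθ : ∀ y, θ y = (𝓕 ψ) (y * h + a) := fun y => by
    simp [θ, e, ContinuousLinearEquiv.unitsEquivAut_apply]
  have hθ' : ∀ x, θ ((x - a) / h) = (𝓕 ψ) x := fun x => by
    rw [hθ, div_mul_cancel₀ _ hh.ne', sub_add_cancel]
  refine ⟨𝓕⁻ θ, fun x => by simp [hθ'], fun ξ => ?_⟩
  have h1 : ψ ξ = (𝓕⁻ (𝓕 ψ)) ξ := by simp
  rw [h1, SchwartzMap.fourierInv_coe, SchwartzMap.fourierInv_coe, Real.fourierInv_eq',
    Real.fourierInv_eq', ← integral_comp_sub_div _ a hh, ← integral_const_mul]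
  refine integral_congr_ae (Eventually.of_forall fun x => ?_)
  simp only [hθ', smul_eq_mul, RCLike.inner_apply, conj_trivial]
  conv_rhs => rw [← mul_assoc, ← Complex.exp_add]
  congr 2
  have : (h : ℂ) ≠ 0 := by exact_mod_cast hh.ne'
  push_cast
  field_simp
  ring

theorem fourier_g_ae_eq (x₀ : ℝ) {h : ℝ} (hh : 0 < h) (φ : L2) :
    (𝓕 (g 0 x₀ h hh φ) : L2) =ᵐ[volume] fun ξ =>
      ((h ^ (-(1 / 2) : ℝ) : ℝ) : ℂ) * h *
        Complex.exp (-(2 * Real.pi * Complex.I * ((x₀ * ξ : ℝ) : ℂ))) * (𝓕 φ : L2) (h * ξ) := by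
  set c : ℂ := ((h ^ (-(1 / 2) : ℝ) : ℝ) : ℂ) with hc
  have hhc : (h : ℂ) ≠ 0 := by exact_mod_cast hh.ne'
  -- the pairing of the right side with `ψ` is the pairing of `φ̂` with the rescaled `ψ`
  have key : ∀ ψ χ : 𝓢(ℝ, ℂ), (∀ ξ, (h : ℂ) * χ (h * ξ) =
      Complex.exp (-(2 * Real.pi * Complex.I * ((x₀ * ξ : ℝ) : ℂ))) * ψ ξ) → ∀ ξ,
      c * h * Complex.exp (-(2 * Real.pi * Complex.I * ((x₀ * ξ : ℝ) : ℂ))) *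
        (𝓕 φ : L2) (h * ξ) * ψ ξ = c * h * h * ((𝓕 φ : L2) (h * ξ) * χ (h * ξ)) := by
    intro ψ χ hχ ξ
    linear_combination -(c * h * (𝓕 φ : L2) (h * ξ)) * hχ ξ
  refine ae_eq_of_integral_mul_schwartz_eq (fun ψ => ?_) (fun ψ => ?_) (fun ψ => ?_)
  · exact (Lp.memLp (𝓕 (g 0 x₀ h hh φ) : L2)).integrable_mul (ψ.memLp 2)
  · obtain ⟨χ, -, hχ⟩ := exists_schwartz_fourier_eq_comp_affine ψ x₀ hh
    simp only [key ψ χ hχ]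
    have h1 : Integrable fun ξ => (𝓕 φ : L2) ξ * χ ξ :=
      (Lp.memLp (𝓕 φ : L2)).integrable_mul (χ.memLp 2)
    exact (h1.comp_mul_left' hh.ne').const_mul _
  · obtain ⟨χ, hχ1, hχ2⟩ := exists_schwartz_fourier_eq_comp_affine ψ x₀ hh
    simp only [key ψ χ hχ2]
    rw [integral_const_mul, Measure.integral_comp_mul_left (fun ξ => (𝓕 φ : L2) ξ * χ ξ) h,
      integral_fourier_L2_mul, integral_fourier_L2_mul, abs_of_pos (inv_pos.2 hh)]
    have h2 : ∫ x, (g 0 x₀ h hh φ : L2) x * (𝓕 ψ) x =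
        ∫ x, c * (φ ((x - x₀) / h) * (𝓕 χ) ((x - x₀) / h)) := by
      refine integral_congr_ae ?_
      have h3 : (g 0 x₀ h hh φ : L2) =ᵐ[volume] gFun 0 x₀ h φ :=
        (memLp_gFun 0 x₀ hh (Lp.memLp φ)).coeFn_toLp
      filter_upwards [h3] with x hx
      rw [hx, hχ1, gFun]
      simp only [Complex.ofReal_zero, mul_zero, Complex.exp_zero, mul_one, ← hc]
      ring
    rw [h2, integral_const_mul, integral_comp_sub_div (fun x : ℝ => φ x * (𝓕 χ : 𝓢(ℝ, ℂ)) x) x₀ hh,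
      Complex.real_smul]
    push_cast
    field_simp

/-- The function `h^{-1/2-α} U((t - t₀)/h³, (x - x₀)/h)`. -/
noncomputable def rescale (α h x₀ t₀ : ℝ) (U : ℝ → ℝ → ℂ) (t x : ℝ) : ℂ :=
  ((h ^ (-(1 / 2) - α : ℝ) : ℝ) : ℂ) * U ((t - t₀) / h ^ 3) ((x - x₀) / h)

theorem aestronglyMeasurable_rescale (α : ℝ) {h : ℝ} (hh : 0 < h) (x₀ t₀ : ℝ) {U : ℝ → ℝ → ℂ}
    (hU : AEStronglyMeasurable (Function.uncurry U)
      ((volume : Measure ℝ).prod (volume : Measure ℝ))) :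
    AEStronglyMeasurable (Function.uncurry (rescale α h x₀ t₀ U))
      ((volume : Measure ℝ).prod (volume : Measure ℝ)) :=
  (hU.comp_quasiMeasurePreserving (QuasiMeasurePreserving.prodMap
    (quasiMeasurePreserving_sub_div t₀ (pow_pos hh 3).ne')
    (quasiMeasurePreserving_sub_div x₀ hh.ne'))).const_mul _

theorem airyMult_div_cube (t ξ : ℝ) {h : ℝ} (hh : h ≠ 0) :
    airyMult (t / h ^ 3) (h * ξ) = airyMult t ξ := by
  have : (h : ℂ) ≠ 0 := by exact_mod_cast hh
  simp only [airyMult]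
  congr 1
  push_cast
  field_simp

theorem isFracAirySlice_rescale {α : ℝ} {φ : L2} {s h x₀ : ℝ} (hh : 0 < h) {V : ℝ → ℂ}
    (hV : IsFracAirySlice α φ (s / h ^ 3) V) :
    IsFracAirySlice α (g 0 x₀ h hh φ) s fun x =>
      ((h ^ (-(1 / 2) - α : ℝ) : ℝ) : ℂ) * V ((x - x₀) / h) := by
  intro ψ
  obtain ⟨χ, hχ1, hχ2⟩ := exists_schwartz_fourier_eq_comp_affine ψ x₀ hh
  obtain ⟨hi, he⟩ := hV χ
  set C : ℂ := ((h ^ (-(1 / 2) - α : ℝ) : ℝ) : ℂ) with hC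
  have h1 : ∀ x, C * V ((x - x₀) / h) * (𝓕 ψ) x =
      C * (V ((x - x₀) / h) * (𝓕 χ) ((x - x₀) / h)) := fun x => by rw [hχ1]; ring
  simp only [h1]
  refine ⟨(integrable_comp_sub_div hi x₀ hh.ne').const_mul C, ?_⟩
  rw [integral_const_mul, integral_comp_sub_div (fun x : ℝ => V x * (𝓕 χ : 𝓢(ℝ, ℂ)) x) x₀ hh, he]
  set f : ℝ → ℂ := fun ξ => airyMult (s / h ^ 3) ξ * ((|2 * Real.pi * ξ| ^ α : ℝ) : ℂ) *
    (𝓕 φ : L2) ξ * χ ξ with hf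
  have h2 : ∫ ξ, airyMult s ξ * ((|2 * Real.pi * ξ| ^ α : ℝ) : ℂ) *
      (𝓕 (g 0 x₀ h hh φ) : L2) ξ * ψ ξ = ∫ ξ, C * h * h * f (h * ξ) := by
    refine integral_congr_ae ?_
    filter_upwards [fourier_g_ae_eq x₀ hh φ] with ξ hξ
    have h3 : |2 * Real.pi * (h * ξ)| ^ α = h ^ α * |2 * Real.pi * ξ| ^ α := by
      rw [← Real.mul_rpow hh.le (abs_nonneg _), ← abs_of_pos hh, ← abs_mul, abs_of_pos hh]
      congr 2
      ring
    have h4 : C * ((h ^ α : ℝ) : ℂ) = ((h ^ (-(1 / 2) : ℝ) : ℝ) : ℂ) := by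
      rw [hC, ← Complex.ofReal_mul, ← Real.rpow_add hh, sub_add_cancel]
    rw [hξ, hf]
    dsimp only
    rw [airyMult_div_cube s ξ hh.ne', h3, ← h4, Complex.ofReal_mul (h ^ α)]
    linear_combination -(C * ((h ^ α : ℝ) : ℂ) * h * airyMult s ξ *
      ((|2 * Real.pi * ξ| ^ α : ℝ) : ℂ) * (𝓕 φ : L2) (h * ξ)) * hχ2 ξ
  refine Eq.trans ?_ h2.symm
  rw [integral_const_mul, Measure.integral_comp_mul_left f h, abs_of_pos (inv_pos.2 hh),
    Complex.real_smul]
  have hhc : (h : ℂ) ≠ 0 := by exact_mod_cast hh.ne'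
  have h5 : C * (h * ∫ ξ, f ξ) = C * h * h * (((h⁻¹ : ℝ) : ℂ) * ∫ ξ, f ξ) := by
    push_cast
    field_simp
  exact h5

/-- The evolution of a rescaled and translated datum is the rescaled and translated evolution. -/
theorem IsFracAiryEvolution.rescale {α : ℝ} {φ : L2} {U : ℝ → ℝ → ℂ}
    (hU : IsFracAiryEvolution α φ 0 U) {h : ℝ} (hh : 0 < h) (x₀ t₀ : ℝ) :
    IsFracAiryEvolution α (g 0 x₀ h hh φ) t₀ (rescale α h x₀ t₀ U) := by
  refine ⟨aestronglyMeasurable_rescale α hh x₀ t₀ hU.1, ?_⟩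
  filter_upwards [(quasiMeasurePreserving_sub_div t₀ (pow_pos hh 3).ne').ae hU.2] with t ht
  rw [sub_zero] at ht
  exact isFracAirySlice_rescale hh ht

/-! ### Decoupling of orthogonal profiles -/

theorem rescale_sub (α h x₀ t₀ : ℝ) (U V : ℝ → ℝ → ℂ) (t x : ℝ) :
    rescale α h x₀ t₀ (fun t x => U t x - V t x) t x =
      rescale α h x₀ t₀ U t x - rescale α h x₀ t₀ V t x := by
  simp only [rescale, mul_sub]

theorem enorm_rescale (α : ℝ) {h : ℝ} (hh : 0 < h) (x₀ t₀ : ℝ) (U : ℝ → ℝ → ℂ) (t x : ℝ) :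
    ‖rescale α h x₀ t₀ U t x‖ₑ =
      ENNReal.ofReal (h ^ (-(1 / 2) - α)) * ‖U ((t - t₀) / h ^ 3) ((x - x₀) / h)‖ₑ := by
  rw [rescale, enorm_mul, ← ofReal_norm, Complex.norm_real, Real.norm_of_nonneg (by positivity)]

/-- The admissible norms are invariant under the rescaling. -/
theorem Admissible.mixN_rescale {α : ℝ} {q r : ℝ≥0∞} (ha : Admissible α q r) {h : ℝ} (hh : 0 < h)
    (x₀ t₀ : ℝ) (U : ℝ → ℝ → ℂ) :
    mixN q r (fun t x => ‖rescale α h x₀ t₀ U t x‖ₑ) = mixN q r (fun t x => ‖U t x‖ₑ) := by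
  simp only [enorm_rescale α hh]
  rw [mixN_const_mul ENNReal.ofReal_ne_top,
    mixN_comp_affine q r (fun t x => ‖U t x‖ₑ) t₀ x₀ hh, ← mul_assoc,
    ENNReal.ofReal_rpow_of_pos hh, ← ENNReal.ofReal_mul (by positivity), ← Real.rpow_add hh]
  have : -(1 / 2) - α + (3 * (1 / q).toReal + (1 / r).toReal) = 0 := by
    linarith [ha.scaling]
  rw [this]
  simp

theorem toReal_one_div_half (p : ℝ≥0∞) : (1 / (p / 2)).toReal = 2 * (1 / p).toReal := by
  rw [one_div, ENNReal.inv_div (by simp) (by simp), one_div, ENNReal.div_eq_inv_mul,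
    ENNReal.toReal_mul, mul_comm]
  simp

/-- If the second factor is bounded, the product is controlled by a power of the ratio of the
scales. -/
theorem Admissible.mixN_rescale_mul_le {α : ℝ} {q r : ℝ≥0∞} (ha : Admissible α q r)
    {h h' : ℝ} (hh : 0 < h) (hh' : 0 < h') (x₀ t₀ x₀' t₀' : ℝ) (w w' : ℝ → ℝ → ℂ) {M' : ℝ}
    (hw' : ∀ t x, ‖w' t x‖ ≤ M') :
    mixN (q / 2) (r / 2) (fun t x => ‖rescale α h x₀ t₀ w t x‖ₑ * ‖rescale α h' x₀' t₀' w' t x‖ₑ) ≤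
      ENNReal.ofReal M' * mixN (q / 2) (r / 2) (fun t x => ‖w t x‖ₑ) *
        ENNReal.ofReal ((h / h') ^ (1 / 2 + α)) := by
  set c := ENNReal.ofReal (h ^ (-(1 / 2) - α)) * ENNReal.ofReal (h' ^ (-(1 / 2) - α)) *
    ENNReal.ofReal M' with hc
  have hct : c ≠ ⊤ := by
    rw [hc]
    exact ENNReal.mul_ne_top (ENNReal.mul_ne_top ENNReal.ofReal_ne_top ENNReal.ofReal_ne_top)
      ENNReal.ofReal_ne_top
  calc _ ≤ mixN (q / 2) (r / 2) (fun t x => c * ‖w ((t - t₀) / h ^ 3) ((x - x₀) / h)‖ₑ) := by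
        refine mixN_mono fun t x => ?_
        rw [enorm_rescale α hh, enorm_rescale α hh', hc]
        have h1 : ‖w' ((t - t₀') / h' ^ 3) ((x - x₀') / h')‖ₑ ≤ ENNReal.ofReal M' := by
          rw [← ofReal_norm]
          exact ENNReal.ofReal_le_ofReal (hw' _ _)
        calc _ ≤ ENNReal.ofReal (h ^ (-(1 / 2) - α)) * ‖w ((t - t₀) / h ^ 3) ((x - x₀) / h)‖ₑ *
              (ENNReal.ofReal (h' ^ (-(1 / 2) - α)) * ENNReal.ofReal M') := by gcongr
          _ = _ := by ring
    _ = c * (ENNReal.ofReal h ^ (3 * (1 / (q / 2)).toReal + (1 / (r / 2)).toReal) *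
          mixN (q / 2) (r / 2) (fun t x => ‖w t x‖ₑ)) := by
        rw [mixN_const_mul hct, mixN_comp_affine (q / 2) (r / 2) (fun t x => ‖w t x‖ₑ) t₀ x₀ hh]
    _ = _ := by
        have e : ENNReal.ofReal (h ^ (-(1 / 2) - α)) * ENNReal.ofReal (h' ^ (-(1 / 2) - α)) *
            ENNReal.ofReal h ^ (3 * (1 / (q / 2)).toReal + (1 / (r / 2)).toReal) =
            ENNReal.ofReal ((h / h') ^ (1 / 2 + α)) := by
          have e1 : 3 * (1 / (q / 2)).toReal + (1 / (r / 2)).toReal =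
              (1 / 2 + α) + (1 / 2 + α) := by
            rw [toReal_one_div_half, toReal_one_div_half]
            linarith [ha.scaling]
          rw [e1, ENNReal.ofReal_rpow_of_pos hh, ← ENNReal.ofReal_mul (by positivity),
            ← ENNReal.ofReal_mul (by positivity)]
          congr 1
          rw [show -(1 / 2) - α = -(1 / 2 + α) by ring, Real.rpow_neg hh.le, Real.rpow_neg hh'.le,
            Real.rpow_add hh (1 / 2 + α), Real.div_rpow hh.le hh'.le]
          have := (Real.rpow_pos_of_pos hh (1 / 2 + α)).ne'
          generalize h ^ (1 / 2 + α) = y at this ⊢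
          field_simp
        rw [← e, hc]
        ring

theorem BoxBounded.mixN_ne_top {M R : ℝ} {w : ℝ → ℝ → ℂ} (hw : BoxBounded M R w) (q r : ℝ≥0∞) :
    mixN q r (fun t x => ‖w t x‖ₑ) ≠ ⊤ := by
  set b : ℝ → ℝ := (Set.Icc (-R) R).indicator fun _ => 1 with hb
  have hbp : ∀ p : ℝ≥0∞, eLpNorm (fun x => ‖b x‖ₑ) p volume ≠ ⊤ := fun p => by
    rw [eLpNorm_enorm]
    exact (memLp_indicator_const p measurableSet_Icc (1 : ℝ) (Or.inr (by simp))).2.ne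
  have h1 : mixN q r (fun t x => ‖w t x‖ₑ) ≤
      mixN q r fun t x => ENNReal.ofReal M * (‖b t‖ₑ * ‖b x‖ₑ) := by
    refine mixN_mono fun t x => ?_
    by_cases h0 : w t x = 0
    · simp [h0]
    · obtain ⟨ht, hx⟩ := hw.support t x h0
      have ht' : t ∈ Set.Icc (-R) R := abs_le.1 ht
      have hx' : x ∈ Set.Icc (-R) R := abs_le.1 hx
      rw [hb, Set.indicator_of_mem ht', Set.indicator_of_mem hx', ← ofReal_norm]
      simpa using ENNReal.ofReal_le_ofReal (hw.norm_le t x)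
  have h2 : mixN q r (fun t x => ‖b t‖ₑ * ‖b x‖ₑ) =
      eLpNorm (fun x => ‖b x‖ₑ) r volume * eLpNorm (fun t => ‖b t‖ₑ) q volume := by
    simp only [mixN, eLpNorm_ennreal_const_mul enorm_ne_top]
    rw [← eLpNorm_ennreal_const_mul (hbp r)]
    simp only [mul_comm]
  rw [mixN_const_mul ENNReal.ofReal_ne_top, h2] at h1
  exact (h1.trans_lt (ENNReal.mul_lt_top ENNReal.ofReal_lt_top
    (ENNReal.mul_lt_top (hbp r).lt_top (hbp q).lt_top))).ne

theorem BoxBounded.abs_sub_le_of_rescale_ne_zero {M R α h x₀ t₀ t x : ℝ} {w : ℝ → ℝ → ℂ}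
    (hw : BoxBounded M R w) (hh : 0 < h) (hne : rescale α h x₀ t₀ w t x ≠ 0) :
    |t - t₀| ≤ R * h ^ 3 ∧ |x - x₀| ≤ R * h := by
  obtain ⟨h1, h2⟩ := hw.support _ _ (right_ne_zero_of_mul hne)
  rw [abs_div, abs_of_pos (pow_pos hh 3), div_le_iff₀ (pow_pos hh 3)] at h1
  rw [abs_div, abs_of_pos hh, div_le_iff₀ hh] at h2
  exact ⟨h1, h2⟩

/-- For bounded box-supported profiles: either the scales are far apart, and the product is small,
or they are comparable, and the supports are eventually disjoint. -/
theorem Admissible.eventually_mixN_rescale_mul_le {α : ℝ} {q r : ℝ≥0∞} (ha : Admissible α q r)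
    {h x t h' x' t' : ℕ → ℝ} (hh : ∀ n, 0 < h n) (hh' : ∀ n, 0 < h' n)
    (hQ : Tendsto (fun n => orthoQuantity (h n) (x n) (t n) (h' n) (x' n) (t' n)) atTop atTop)
    {w w' : ℝ → ℝ → ℂ} {M R M' R' : ℝ} (hw : BoxBounded M R w) (hw' : BoxBounded M' R' w')
    {ε : ℝ≥0∞} (hε : 0 < ε) :
    ∀ᶠ n in atTop, mixN (q / 2) (r / 2) (fun s y =>
      ‖rescale α (h n) (x n) (t n) w s y‖ₑ * ‖rescale α (h' n) (x' n) (t' n) w' s y‖ₑ) ≤ ε := by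
  have hs : 0 < 1 / 2 + α := by linarith [ha.neg_half_lt]
  set A : ℝ≥0∞ := ENNReal.ofReal M' * mixN (q / 2) (r / 2) (fun t x => ‖w t x‖ₑ) with hA
  set B : ℝ≥0∞ := ENNReal.ofReal M * mixN (q / 2) (r / 2) (fun t x => ‖w' t x‖ₑ) with hB
  have hAt : A ≠ ⊤ := ENNReal.mul_ne_top ENNReal.ofReal_ne_top (hw.mixN_ne_top _ _)
  have hBt : B ≠ ⊤ := ENNReal.mul_ne_top ENNReal.ofReal_ne_top (hw'.mixN_ne_top _ _)
  -- a ratio of scales below which the product is small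
  obtain ⟨δ, hδ, hδA, hδB⟩ : ∃ δ : ℝ, 0 < δ ∧ A * ENNReal.ofReal (δ ^ (1 / 2 + α)) ≤ ε ∧
      B * ENNReal.ofReal (δ ^ (1 / 2 + α)) ≤ ε := by
    have h1 : Tendsto (fun δ : ℝ => ENNReal.ofReal (δ ^ (1 / 2 + α))) (𝓝[>] 0) (𝓝 0) := by
      have h2 : Tendsto (fun δ : ℝ => δ ^ (1 / 2 + α)) (𝓝 0) (𝓝 0) := by
        have := (Real.continuous_rpow_const hs.le).tendsto 0
        rwa [Real.zero_rpow hs.ne'] at this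
      have h3 := (ENNReal.continuous_ofReal.tendsto 0).comp h2
      rw [ENNReal.ofReal_zero] at h3
      exact h3.mono_left nhdsWithin_le_nhds
    have h4 : ∀ C : ℝ≥0∞, C ≠ ⊤ →
        ∀ᶠ δ : ℝ in 𝓝[>] 0, C * ENNReal.ofReal (δ ^ (1 / 2 + α)) ≤ ε := by
      intro C hC
      have h5 := ENNReal.Tendsto.const_mul (a := C) h1 (Or.inr hC)
      rw [mul_zero] at h5
      exact (h5.eventually (gt_mem_nhds hε)).mono fun _ h => le_of_lt h
    obtain ⟨δ, h6, h7, h8⟩ :=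
      ((h4 A hAt).and ((h4 B hBt).and self_mem_nhdsWithin)).exists
    exact ⟨δ, h8, h6, h7⟩
  set S : ℝ := max (max R R') 0 with hS
  have hS0 : 0 ≤ S := le_max_right _ _
  have hRS : R ≤ S := (le_max_left _ _).trans (le_max_left _ _)
  have hRS' : R' ≤ S := (le_max_right _ _).trans (le_max_left _ _)
  filter_upwards [hQ.eventually_gt_atTop
    (δ⁻¹ + δ⁻¹ + S * (1 + δ⁻¹ ^ 3) + S * (1 + δ⁻¹))] with n hn
  have hhn := hh n
  have hhn' := hh' n
  by_cases h1 : h n / h' n ≤ δ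
  · refine (ha.mixN_rescale_mul_le hhn hhn' _ _ _ _ w w' hw'.norm_le).trans (le_trans ?_ hδA)
    gcongr
  by_cases h2 : h' n / h n ≤ δ
  · simp only [mul_comm ‖rescale α (h n) (x n) (t n) w _ _‖ₑ]
    refine (ha.mixN_rescale_mul_le hhn' hhn _ _ _ _ w' w hw.norm_le).trans (le_trans ?_ hδB)
    gcongr
  -- comparable scales
  have h3 : h' n / h n ≤ δ⁻¹ := by
    rw [← inv_div]; exact inv_anti₀ hδ (not_le.1 h1).le
  have h4 : h n / h' n ≤ δ⁻¹ := by
    rw [← inv_div]; exact inv_anti₀ hδ (not_le.1 h2).le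
  have h5 : ∀ s y, ‖rescale α (h n) (x n) (t n) w s y‖ₑ *
      ‖rescale α (h' n) (x' n) (t' n) w' s y‖ₑ = 0 := by
    intro s y
    by_contra hne
    obtain ⟨hn1, hn2⟩ := hw.abs_sub_le_of_rescale_ne_zero hhn
      (enorm_ne_zero.1 (left_ne_zero_of_mul hne))
    obtain ⟨hn3, hn4⟩ := hw'.abs_sub_le_of_rescale_ne_zero hhn'
      (enorm_ne_zero.1 (right_ne_zero_of_mul hne))
    have hle : h' n ≤ δ⁻¹ * h n := (div_le_iff₀ hhn).1 h3
    have hle3 : h' n ^ 3 ≤ δ⁻¹ ^ 3 * h n ^ 3 := by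
      rw [← mul_pow]
      exact pow_le_pow_left₀ hhn'.le hle 3
    have ht : |t n - t' n| / h n ^ 3 ≤ S * (1 + δ⁻¹ ^ 3) := by
      rw [div_le_iff₀ (pow_pos hhn 3)]
      calc |t n - t' n| ≤ |s - t n| + |s - t' n| := by
            have := abs_sub_le (t n) s (t' n)
            rwa [abs_sub_comm (t n) s] at this
        _ ≤ R * h n ^ 3 + R' * h' n ^ 3 := add_le_add hn1 hn3
        _ ≤ S * h n ^ 3 + S * (δ⁻¹ ^ 3 * h n ^ 3) := by gcongr
        _ = _ := by ring
    have hx : |x n - x' n| / h n ≤ S * (1 + δ⁻¹) := by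
      rw [div_le_iff₀ hhn]
      calc |x n - x' n| ≤ |y - x n| + |y - x' n| := by
            have := abs_sub_le (x n) y (x' n)
            rwa [abs_sub_comm (x n) y] at this
        _ ≤ R * h n + R' * h' n := add_le_add hn2 hn4
        _ ≤ S * h n + S * (δ⁻¹ * h n) := by gcongr
        _ = _ := by ring
    rw [orthoQuantity] at hn
    linarith
  simp only [h5]
  simp [mixN]

theorem Approximable.mixN_ne_top {q r : ℝ≥0∞} (hq : 1 ≤ q) (hr : 1 ≤ r) {U : ℝ → ℝ → ℂ}
    (hUm : AEStronglyMeasurable (Function.uncurry U)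
      ((volume : Measure ℝ).prod (volume : Measure ℝ))) (hU : Approximable q r U) :
    mixN q r (fun t x => ‖U t x‖ₑ) ≠ ⊤ := by
  obtain ⟨w, M, R, -, -, hw, h1⟩ := hU 1 one_pos
  have h2 : mixN q r (fun t x => ‖U t x‖ₑ) ≤
      mixN q r (fun t x => ‖U t x - w t x‖ₑ) + mixN q r (fun t x => ‖w t x‖ₑ) := by
    refine le_trans (mixN_mono fun t x => ?_) (mixN_add_le hq hr
      (aem_enorm (u := fun t x => U t x - w t x) (hUm.sub hw.aesm)) (aem_enorm hw.aesm))
    have := enorm_add_le (U t x - w t x) (w t x)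
    rwa [sub_add_cancel] at this
  exact (h2.trans_lt (ENNReal.add_lt_top.2
    ⟨h1.trans_lt ENNReal.one_lt_top, (hw.mixN_ne_top q r).lt_top⟩)).ne

/-- Products of rescaled approximable functions with orthogonal parameters tend to zero: up to
small errors, measured by Hölder's inequality and the invariance of the norms, both factors may be
taken bounded and supported in boxes. -/
theorem Admissible.tendsto_mixN_rescale_mul {α : ℝ} {q r : ℝ≥0∞} (ha : Admissible α q r)
    {h x t h' x' t' : ℕ → ℝ} (hh : ∀ n, 0 < h n) (hh' : ∀ n, 0 < h' n)
    (hQ : Tendsto (fun n => orthoQuantity (h n) (x n) (t n) (h' n) (x' n) (t' n)) atTop atTop)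
    {U V : ℝ → ℝ → ℂ}
    (hUm : AEStronglyMeasurable (Function.uncurry U)
      ((volume : Measure ℝ).prod (volume : Measure ℝ)))
    (hVm : AEStronglyMeasurable (Function.uncurry V)
      ((volume : Measure ℝ).prod (volume : Measure ℝ)))
    (hU : Approximable q r U) (hV : Approximable q r V) :
    Tendsto (fun n => mixN (q / 2) (r / 2) (fun s y =>
      ‖rescale α (h n) (x n) (t n) U s y‖ₑ * ‖rescale α (h' n) (x' n) (t' n) V s y‖ₑ))
      atTop (𝓝 0) := by
  rw [ENNReal.tendsto_nhds_zero]
  intro ε hε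
  have hε3 : 0 < ε / 3 := ENNReal.div_pos hε.ne' (by simp)
  have hVt := hV.mixN_ne_top ha.one_le_q ha.one_le_r hVm
  obtain ⟨w, M, R, -, -, hw, hUw⟩ := hU (ε / 3 / (mixN q r (fun t x => ‖V t x‖ₑ) + 1))
    (ENNReal.div_pos hε3.ne' (by simp [hVt]))
  have hwt := hw.mixN_ne_top q r
  obtain ⟨w', M', R', -, -, hw', hVw⟩ := hV (ε / 3 / (mixN q r (fun t x => ‖w t x‖ₑ) + 1))
    (ENNReal.div_pos hε3.ne' (by simp [hwt]))
  have hdiv : ∀ N : ℝ≥0∞, ε / 3 / (N + 1) * N ≤ ε / 3 := fun N => by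
    calc _ ≤ ε / 3 / (N + 1) * (N + 1) := by gcongr; exact le_self_add
      _ ≤ ε / 3 := by rw [mul_comm]; exact ENNReal.mul_div_le
  filter_upwards [ha.eventually_mixN_rescale_mul_le hh hh' hQ hw hw' hε3] with n hn
  have hm : ∀ {W : ℝ → ℝ → ℂ}, AEStronglyMeasurable (Function.uncurry W)
      ((volume : Measure ℝ).prod (volume : Measure ℝ)) →
      AEM fun s y => ‖rescale α (h n) (x n) (t n) W s y‖ₑ := fun hW =>
    aem_enorm (aestronglyMeasurable_rescale α (hh n) _ _ hW)
  have hm' : ∀ {W : ℝ → ℝ → ℂ}, AEStronglyMeasurable (Function.uncurry W)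
      ((volume : Measure ℝ).prod (volume : Measure ℝ)) →
      AEM fun s y => ‖rescale α (h' n) (x' n) (t' n) W s y‖ₑ := fun hW =>
    aem_enorm (aestronglyMeasurable_rescale α (hh' n) _ _ hW)
  have hUwm : AEStronglyMeasurable (Function.uncurry fun t x => U t x - w t x)
      ((volume : Measure ℝ).prod (volume : Measure ℝ)) := hUm.sub hw.aesm
  have hVwm : AEStronglyMeasurable (Function.uncurry fun t x => V t x - w' t x)
      ((volume : Measure ℝ).prod (volume : Measure ℝ)) := hVm.sub hw'.aesm
  set u := rescale α (h n) (x n) (t n) U with hu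
  set v := rescale α (h' n) (x' n) (t' n) V with hv
  set d := rescale α (h n) (x n) (t n) (fun t x => U t x - w t x) with hd
  set d' := rescale α (h' n) (x' n) (t' n) (fun t x => V t x - w' t x) with hd'
  set z := rescale α (h n) (x n) (t n) w with hz
  set z' := rescale α (h' n) (x' n) (t' n) w' with hz'
  have e1 : ∀ s y, d s y = u s y - z s y := fun s y => rescale_sub _ _ _ _ _ _ _ _
  have e2 : ∀ s y, d' s y = v s y - z' s y := fun s y => rescale_sub _ _ _ _ _ _ _ _
  have hE1 : mixN (q / 2) (r / 2) (fun s y => ‖d s y‖ₑ * ‖v s y‖ₑ) ≤ ε / 3 := by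
    refine (mixN_mul_le (hm hUwm) (hm' hVm)).trans ?_
    rw [ha.mixN_rescale (hh n), ha.mixN_rescale (hh' n)]
    refine le_trans ?_ (hdiv (mixN q r (fun t x => ‖V t x‖ₑ)))
    gcongr
  have hE2 : mixN (q / 2) (r / 2) (fun s y => ‖z s y‖ₑ * ‖d' s y‖ₑ) ≤ ε / 3 := by
    refine (mixN_mul_le (hm hw.aesm) (hm' hVwm)).trans ?_
    rw [ha.mixN_rescale (hh n), ha.mixN_rescale (hh' n), mul_comm]
    refine le_trans ?_ (hdiv (mixN q r (fun t x => ‖w t x‖ₑ)))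
    gcongr
  have hm1 : AEM fun s y => ‖d s y‖ₑ * ‖v s y‖ₑ := (hm hUwm).mul (hm' hVm)
  have hm2 : AEM fun s y => ‖z s y‖ₑ * ‖d' s y‖ₑ := (hm hw.aesm).mul (hm' hVwm)
  have hm3 : AEM fun s y => ‖z s y‖ₑ * ‖z' s y‖ₑ := (hm hw.aesm).mul (hm' hw'.aesm)
  calc _ ≤ mixN (q / 2) (r / 2) (fun s y => ‖d s y‖ₑ * ‖v s y‖ₑ +
        (‖z s y‖ₑ * ‖d' s y‖ₑ + ‖z s y‖ₑ * ‖z' s y‖ₑ)) := by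
        refine mixN_mono fun s y => ?_
        have h1 : u s y * v s y = d s y * v s y + (z s y * d' s y + z s y * z' s y) := by
          rw [e1, e2]; ring
        rw [← enorm_mul, h1]
        refine (enorm_add_le _ _).trans ?_
        rw [enorm_mul]
        gcongr
        refine (enorm_add_le _ _).trans ?_
        rw [enorm_mul, enorm_mul]
    _ ≤ mixN (q / 2) (r / 2) (fun s y => ‖d s y‖ₑ * ‖v s y‖ₑ) +
        mixN (q / 2) (r / 2) (fun s y => ‖z s y‖ₑ * ‖d' s y‖ₑ + ‖z s y‖ₑ * ‖z' s y‖ₑ) :=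
        mixN_add_le ha.one_le_half_q ha.one_le_half_r hm1 (hm2.add hm3)
    _ ≤ ε / 3 + (ε / 3 + ε / 3) :=
        add_le_add hE1 ((mixN_add_le ha.one_le_half_q ha.one_le_half_r hm2 hm3).trans
          (add_le_add hE2 hn))
    _ = ε := by rw [← add_assoc]; exact ENNReal.add_thirds ε

theorem OrthogonalParameters.exists_subseq {h x t h' x' t' : ℕ → ℝ}
    (ho : OrthogonalParameters h x t h' x' t') :
    ∃ σ : ℕ → ℕ, StrictMono σ ∧ Tendsto (fun m => orthoQuantity
      (h (σ m)) (x (σ m)) (t (σ m)) (h' (σ m)) (x' (σ m)) (t' (σ m))) atTop atTop := by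
  have h1 : ∀ k : ℕ, ∃ᶠ n in atTop,
      (k : ℝ) < orthoQuantity (h n) (x n) (t n) (h' n) (x' n) (t' n) := by
    intro k
    have h2 : ((k : ℝ) : EReal) < limsup (fun n =>
        ((orthoQuantity (h n) (x n) (t n) (h' n) (x' n) (t' n) : ℝ) : EReal)) atTop := by
      rw [OrthogonalParameters] at ho
      rw [ho]
      exact EReal.coe_lt_top _
    exact (frequently_lt_of_lt_limsup (by isBoundedDefault) h2).mono
      fun n hn => EReal.coe_lt_coe_iff.1 hn
  obtain ⟨σ, hσ, hσ2⟩ := extraction_forall_of_frequently h1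
  exact ⟨σ, hσ, tendsto_atTop_mono (fun n => (hσ2 n).le) tendsto_natCast_atTop_atTop⟩

end AiryStrichartz

theorem mainTheorem7 (α : ℝ) (q r : ℝ≥0∞) (hq : 1 ≤ q) (hr : 1 ≤ r)
    (hscal : -α + 3 * (1 / q).toReal + (1 / r).toReal = 1 / 2)
    (hα₁ : -(1 / 2) < α) (hα₂ : α < 1 / 2) (hα₃ : α ≤ (1 / q).toReal)
    (hqr : ¬ (q = ⊤ ∧ r = 2))
    (φj φk : AiryStrichartz.L2)
    (hj xj tj hk xk tk : ℕ → ℝ) (hjpos : ∀ n, 0 < hj n) (hkpos : ∀ n, 0 < hk n)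
    (hortho : AiryStrichartz.OrthogonalParameters hj xj tj hk xk tk) :
    -- the two evolutions are well-defined as functions of `(t, x)`
    (∀ n, (∃ u, AiryStrichartz.IsFracAiryEvolution α
          (AiryStrichartz.g 0 (xj n) (hj n) (hjpos n) φj) (tj n) u) ∧
        ∃ v, AiryStrichartz.IsFracAiryEvolution α
          (AiryStrichartz.g 0 (xk n) (hk n) (hkpos n) φk) (tk n) v) ∧
    -- there are subsequences along which the orthogonality quantity diverges
    (∃ σ : ℕ → ℕ, StrictMono σ ∧ Tendsto (fun m => AiryStrichartz.orthoQuantity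
        (hj (σ m)) (xj (σ m)) (tj (σ m)) (hk (σ m)) (xk (σ m)) (tk (σ m))) atTop atTop) ∧
    -- along each of them (along the whole sequence, if the quantity itself diverges) the norm
    -- of the product tends to zero
    ∀ u v : ℕ → ℝ → ℝ → ℂ,
      (∀ n, AiryStrichartz.IsFracAiryEvolution α
        (AiryStrichartz.g 0 (xj n) (hj n) (hjpos n) φj) (tj n) (u n)) →
      (∀ n, AiryStrichartz.IsFracAiryEvolution α
        (AiryStrichartz.g 0 (xk n) (hk n) (hkpos n) φk) (tk n) (v n)) →
      ∀ σ : ℕ → ℕ, StrictMono σ →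
        Tendsto (fun m => AiryStrichartz.orthoQuantity
          (hj (σ m)) (xj (σ m)) (tj (σ m)) (hk (σ m)) (xk (σ m)) (tk (σ m))) atTop atTop →
        Tendsto (fun m => AiryStrichartz.mixedNorm (q / 2) (r / 2)
          (fun t x => u (σ m) t x * v (σ m) t x)) atTop (𝓝 0) := by

  have ha : AiryStrichartz.Admissible α q r := ⟨hq, hr, hscal, hα₁, hα₃, hqr⟩
  obtain ⟨U, hU, hUa⟩ := ha.exists_evolution φj
  obtain ⟨V, hV, hVa⟩ := ha.exists_evolution φk
  refine ⟨fun n => ⟨⟨_, hU.rescale (hjpos n) (xj n) (tj n)⟩,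
    ⟨_, hV.rescale (hkpos n) (xk n) (tk n)⟩⟩,
    hortho.exists_subseq, fun u v hu hv σ _ hQ => ?_⟩
  have hlim := ha.tendsto_mixN_rescale_mul (fun m => hjpos (σ m)) (fun m => hkpos (σ m)) hQ
    hU.1 hV.1 hUa hVa
  refine hlim.congr fun m => ?_
  rw [AiryStrichartz.mixedNorm_eq_mixN]
  have h1 : ∀ᵐ t : ℝ, ∀ᵐ x : ℝ,
      ‖AiryStrichartz.rescale α (hj (σ m)) (xj (σ m)) (tj (σ m)) U t x‖ₑ *
        ‖AiryStrichartz.rescale α (hk (σ m)) (xk (σ m)) (tk (σ m)) V t x‖ₑ =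
      ‖u (σ m) t x * v (σ m) t x‖ₑ := by
    filter_upwards [(hU.rescale (hjpos (σ m)) (xj (σ m)) (tj (σ m))).ae_eq (hu (σ m)),
      (hV.rescale (hkpos (σ m)) (xk (σ m)) (tk (σ m))).ae_eq (hv (σ m))] with t h2 h3
    filter_upwards [h2, h3] with x h4 h5
    rw [h4, h5, enorm_mul]
  exact le_antisymm
    (AiryStrichartz.mixN_mono_ae (h1.mono fun t ht => ht.mono fun x hx => hx.le))
    (AiryStrichartz.mixN_mono_ae (h1.mono fun t ht => ht.mono fun x hx => hx.ge))
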